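/- Let $m,n\ge 0$ and $N\ge 2$ be integers. Let $\Pi=\{1,\dots,N(m+n)\}$ with parity $\tilde\imath=0$ if $0<i\le m \pmod{m+n}$ and $\tilde\imath=1$ otherwise, let $\mathfrak g=\mathfrak{gl}(\Pi)\cong\mathfrak{gl}(Nm|Nn)=\mathfrak{gl}_N\otimes\mathfrak{gl}(m|n)$, with matrix units $e_{ij}$ and the form $(a|b)=\mathrm{str}(ab)$. View matrices in $\mathfrak g$ as $N\times N$ block matrices with blocks of size $m+n$. Let $f$ be the $N\times(m|n)$ rectangular nilpotent element, which has identity matrices in the blocks $(u+1,u)$, $1\le u<N$, and zeros elsewhere. Let $h=\mathrm{diag}$ with entry $N-2u+1$ in the $u$-th diagonal block, $\mathfrak g_d=\{a\in\mathfrak g: [h,a]=2d\,a\}$, $\mathfrak n=\mathfrak g_{\ge 1/2}$, $\mathfrak p=\mathfrak g_{<1}$. For a vector superspace $U$ let $\mathcal V(U)=S(\mathbb C[\partial]\otimes U)$ be the superalgebra of differential polynomials. Equip $\mathcal V(\mathfrak g)$ with the affine $\lambda$-bracket of level $-1$, $\{a_\lambda b\}=[a,b]-\lambda(a|b)$ for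 $a,b\in\mathfrak g$, extended by sesquilinearity and the Leibniz rules; write $q_{ij}\in\mathcal V(\mathfrak g)$ for the generator $e_{ij}$. Let $\rho:\mathcal V(\mathfrak g)\to\mathcal V(\mathfrak p)$ be the homomorphism of differential superalgebras with $\rho(a)=\pi_{\mathfrak p}(a)+(f|a)$ for $a\in\mathfrak g$, where $\pi_{\mathfrak p}:\mathfrak g\to\mathfrak p$ is the projection along $\bigoplus_{d\ge1}\mathfrak g_d$, and let $$\mathcal W(\mathfrak{gl}(Nm|Nn),f)=\{v\in\mathcal V(\mathfrak p):\ \rho(\{a_\lambda v\})=0\ \text{for all } a\in\mathfrak n\}.$$ Let $A(\partial)$ be the matrix differential operator with entries $A_{ij}(\partial)=\delta_{ij}\partial+(-1)^{\tilde\imath}q_{ij}$, $i,j\in\Pi$, and let $\rho(A(\partial))$ be obtained by applying $\rho$ to the coefficients. Matrix pseudo-differential operators are multiplied by $(a\otimes v)\star(b\otimes w)=(-1)^{\tilde b\tilde v+\tilde a\tilde b}\,ab\otimes vw$. Let $I=\{(N-1)(m+n)+1,\dots,N(m+n)\}$ and $J=\{1,\dots,m+n\}$, and let $|\,\cdot\,|_{IJ}$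 denote the quasi-determinant $|X|_{IJ}=\big((X^{\mathrm{inv}})_{JI}\big)^{\mathrm{inv}}$, all inverses being two-sided $\star$-inverses over $\mathcal V(\mathfrak p)(\!(\partial^{-1})\!)$. **Theorem.** The quasi-determinant $|\rho(A(\partial))|_{IJ}$ exists and is unique, and, with $I$ identified with $J$ in the order-preserving way, $$L(\partial)=(-1)^{N-1}|\rho(A(\partial))|_{IJ}$$ is a monic matrix differential operator of order $N$, $L_{ij}(\partial)=\delta_{ij}\partial^N+\sum_{k=0}^{N-1}w_{ij;k}\partial^k$ for $i,j\in J$. Its coefficients $w_{ij;k}$ ($i,j\in J$, $0\le k\le N-1$), which have parity $\tilde\imath+\tilde\jmath$, freely generate $\mathcal W(\mathfrak{gl}(Nm|Nn),f)$ as a differential superalgebra: the homomorphism of differential superalgebras from $\mathbb C[u_{ij;k}^{(l)}\mid i,j\in J,\ 0\le k\le N-1,\ l\ge 0]$ (with $u_{ij;k}$ of parity $\tilde\imath+\tilde\jmath$) to $\mathcal V(\mathfrak p)$ that sends $u_{ij;k}$ to $w_{ij;k}$ is injective and its image is $\mathcal W(\mathfrak{gl}(Nm|Nn),f)$. -/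

import Mathlib

open Polynomial

noncomputable section

namespace RectW

/-! ### Signs -/

/-- The sign `(-1)^a` of a parity `a ∈ ℤ/2`, as a complex number. -/
def eps (a : ZMod 2) : ℂ := (-1) ^ a.val

theorem eps_zero : eps 0 = 1 := by simp [eps]

theorem eps_add (a b : ZMod 2) : eps (a + b) = eps a * eps b := by
  have h : ∀ a b : ZMod 2, (a + b).val % 2 = (a.val + b.val) % 2 := by decide
  unfold eps
  rw [← pow_add, neg_one_pow_eq_pow_mod_two, h a b, ← neg_one_pow_eq_pow_mod_two]

theorem eps_mul_self (a : ZMod 2) : eps a * eps a = 1 := by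
  rw [← eps_add, CharTwo.add_self_eq_zero, eps_zero]

/-! ### Superalgebras of differential polynomials

For a vector superspace `U` with homogeneous basis `(u_b)`, `b ∈ B`, of parities `p b`, the
superalgebra `𝒱(U) = S(ℂ[∂] ⊗ U) = ℂ[u_b^{(k)}]` is the unital associative algebra on the generators
`u_b^{(k)}`, `k ≥ 0`, of parity `p b`, modulo supercommutativity of the generators. -/

/-- The relations `x y = (-1)^{p(x) p(y)} y x` between the generators. (For odd `x` this gives
`2 x² = 0`, hence `x² = 0`.) -/
inductive SuperCommRel {B : Type} (p : B → ZMod 2) :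
    FreeAlgebra ℂ (B × ℕ) → FreeAlgebra ℂ (B × ℕ) → Prop
  | swap (x y : B × ℕ) : SuperCommRel p
      (FreeAlgebra.ι ℂ x * FreeAlgebra.ι ℂ y)
      (eps (p x.1 * p y.1) • (FreeAlgebra.ι ℂ y * FreeAlgebra.ι ℂ x))

/-- The superalgebra of differential polynomials `ℂ[u_b^{(k)} | b ∈ B, k ≥ 0]`. -/
def SDiffPoly {B : Type} (p : B → ZMod 2) : Type := RingQuot (SuperCommRel p)

instance {B : Type} (p : B → ZMod 2) : Ring (SDiffPoly p) :=
  inferInstanceAs (Ring (RingQuot (SuperCommRel p)))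

instance {B : Type} (p : B → ZMod 2) : Algebra ℂ (SDiffPoly p) :=
  inferInstanceAs (Algebra ℂ (RingQuot (SuperCommRel p)))

namespace SDiffPoly

section Basics

variable {B : Type} (p : B → ZMod 2)

/-- The generator `u_b^{(k)}`. -/
def gen (b : B) (k : ℕ) : SDiffPoly p :=
  RingQuot.mkAlgHom ℂ (SuperCommRel p) (FreeAlgebra.ι ℂ (b, k))

theorem gen_comm (b c : B) (k l : ℕ) :
    gen p b k * gen p c l = eps (p b * p c) • (gen p c l * gen p b k) := by
  have h := RingQuot.mkAlgHom_rel ℂ (SuperCommRel.swap (p := p) (b, k) (c, l))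
  rw [map_mul, map_smul, map_mul] at h
  exact h

/-- The universal property: an algebra homomorphism out of `ℂ[u_b^{(k)}]` is given by the
(supercommuting) images of the generators. -/
def lift {S : Type} [Ring S] [Algebra ℂ S] (F : B → ℕ → S)
    (hF : ∀ b k c l, F b k * F c l = eps (p b * p c) • (F c l * F b k)) :
    SDiffPoly p →ₐ[ℂ] S :=
  RingQuot.liftAlgHom ℂ ⟨FreeAlgebra.lift ℂ (fun x : B × ℕ => F x.1 x.2), by
    rintro _ _ ⟨x, y⟩
    simp [hF x.1 x.2 y.1 y.2]⟩

@[simp] theorem lift_gen {S : Type} [Ring S] [Algebra ℂ S] (F : B → ℕ → S)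
    (hF : ∀ b k c l, F b k * F c l = eps (p b * p c) • (F c l * F b k)) (b : B) (k : ℕ) :
    lift p F hF (gen p b k) = F b k := by
  unfold lift gen
  erw [RingQuot.liftAlgHom_mkAlgHom_apply]
  simp

theorem algHom_ext {S : Type} [Ring S] [Algebra ℂ S] {f g : SDiffPoly p →ₐ[ℂ] S}
    (h : ∀ b k, f (gen p b k) = g (gen p b k)) : f = g := by
  apply RingQuot.ringQuot_ext' ℂ
  apply FreeAlgebra.hom_ext
  funext x
  exact h x.1 x.2

theorem induction {C : SDiffPoly p → Prop} (hc : ∀ r : ℂ, C (algebraMap ℂ _ r))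
    (hg : ∀ b k, C (gen p b k)) (hm : ∀ a b, C a → C b → C (a * b))
    (ha : ∀ a b, C a → C b → C (a + b)) (a : SDiffPoly p) : C a := by
  obtain ⟨x, rfl⟩ := RingQuot.mkAlgHom_surjective ℂ (SuperCommRel p) a
  induction x using FreeAlgebra.induction with
  | grade0 r => rw [AlgHom.commutes]; exact hc r
  | grade1 x => exact hg x.1 x.2
  | mul a b iha ihb => rw [map_mul]; exact hm _ _ iha ihb
  | add a b iha ihb => rw [map_add]; exact ha _ _ iha ihb

/-- The automorphism which acts on elements of parity `i` as multiplication by `(-1)^{c i}`.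
For `c = 1` it is the parity automorphism. -/
def tw (c : ZMod 2) : SDiffPoly p →ₐ[ℂ] SDiffPoly p :=
  lift p (fun b k => eps (c * p b) • gen p b k) (by
    intro b k d l
    rw [smul_mul_smul_comm, smul_mul_smul_comm, gen_comm p b d k l, smul_smul, smul_smul]
    congr 1; ring)

@[simp] theorem tw_gen (c : ZMod 2) (b : B) (k : ℕ) :
    tw p c (gen p b k) = eps (c * p b) • gen p b k := lift_gen p _ _ b k

/-- The subspace of elements of parity `i`. -/
def parityPart (i : ZMod 2) : Submodule ℂ (SDiffPoly p) where
  carrier := {a | ∀ c, tw p c a = eps (c * i) • a}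
  zero_mem' := by intro c; simp
  add_mem' := by intro a b ha hb c; rw [map_add, ha c, hb c, smul_add]
  smul_mem' := by intro r a ha c; rw [map_smul, ha c, smul_comm]

theorem mem_parityPart {i : ZMod 2} {a : SDiffPoly p} :
    a ∈ parityPart p i ↔ ∀ c, tw p c a = eps (c * i) • a := Iff.rfl

theorem gen_mem (b : B) (k : ℕ) : gen p b k ∈ parityPart p (p b) := fun c => tw_gen p c b k

theorem algebraMap_mem (r : ℂ) : algebraMap ℂ (SDiffPoly p) r ∈ parityPart p 0 := by
  intro c; simp [eps_zero]

theorem gen_mul_eq (b : B) (k : ℕ) (a : SDiffPoly p) :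
    gen p b k * a = tw p (p b) a * gen p b k := by
  refine induction p (C := fun a => gen p b k * a = tw p (p b) a * gen p b k) ?_ ?_ ?_ ?_ a
  · intro r; rw [AlgHom.commutes]; exact (Algebra.commutes r _).symm
  · intro c l; rw [tw_gen, gen_comm, smul_mul_assoc]
  · intro x y hx hy; rw [map_mul, ← mul_assoc, hx, mul_assoc, hy, mul_assoc]
  · intro x y hx hy; rw [map_add, mul_add, hx, hy, add_mul]

/-- Homogeneous elements supercommute with the generators. -/
theorem gen_supercomm (b : B) (k : ℕ) {i : ZMod 2} {a : SDiffPoly p} (ha : a ∈ parityPart p i) :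
    gen p b k * a = eps (p b * i) • (a * gen p b k) := by
  rw [gen_mul_eq, ha (p b), smul_mul_assoc]

theorem supercomm {i j : ZMod 2} {x y : SDiffPoly p} (hx : x ∈ parityPart p i)
    (hy : y ∈ parityPart p j) : x * y = eps (i * j) • (y * x) := by
  have key : ∀ a : SDiffPoly p, a * y = y * tw p j a := by
    intro a
    refine induction p (C := fun a => a * y = y * tw p j a) ?_ ?_ ?_ ?_ a
    · intro r; rw [AlgHom.commutes]; exact Algebra.commutes r _
    · intro b k; rw [tw_gen, gen_supercomm p b k hy, mul_smul_comm, mul_comm (p b)]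
    · intro s t hs ht; rw [map_mul, mul_assoc, ht, ← mul_assoc, hs, mul_assoc]
    · intro s t hs ht; rw [map_add, mul_add, ← hs, ← ht, add_mul]
  rw [key, hx j, mul_smul_comm, mul_comm j]

end Basics

/-! ### Twisted derivations -/

section Derivations

variable {B : Type} (p : B → ZMod 2) {S : Type} [Ring S] [Algebra ℂ S]

/-- The homomorphism `a ↦ !![φ a, d a; 0, ψ a]` to triangular matrices that encodes the unique
linear map `d` with `d (a b) = φ a * d b + d a * ψ b` and given values on the generators. -/
def triHom (φ ψ : SDiffPoly p →ₐ[ℂ] S) (d : B → ℕ → S)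
    (hd : ∀ b k c l, φ (gen p b k) * d c l + d b k * ψ (gen p c l) =
      eps (p b * p c) • (φ (gen p c l) * d b k + d c l * ψ (gen p b k))) :
    SDiffPoly p →ₐ[ℂ] Matrix (Fin 2) (Fin 2) S :=
  lift p (fun b k => !![φ (gen p b k), d b k; 0, ψ (gen p b k)]) (by
    intro b k c l
    rw [Matrix.mul_fin_two, Matrix.mul_fin_two, Matrix.smul_of]
    simp only [Matrix.smul_cons, Matrix.smul_empty, mul_zero, zero_mul, add_zero, zero_add,
      smul_zero, hd b k c l]
    rw [← map_mul, ← map_mul, ← map_mul, ← map_mul, gen_comm p b c k l, map_smul, map_smul])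

variable (φ ψ : SDiffPoly p →ₐ[ℂ] S) (d : B → ℕ → S)
    (hd : ∀ b k c l, φ (gen p b k) * d c l + d b k * ψ (gen p c l) =
      eps (p b * p c) • (φ (gen p c l) * d b k + d c l * ψ (gen p b k)))

/-- The linear map `d` with `d (a b) = φ a * d b + d a * ψ b` and given values on the generators. -/
def twDer : SDiffPoly p →ₗ[ℂ] S where
  toFun a := triHom p φ ψ d hd a 0 1
  map_add' a b := by rw [map_add]; rfl
  map_smul' r a := by rw [map_smul]; rfl

theorem twDer_gen (b : B) (k : ℕ) : twDer p φ ψ d hd (gen p b k) = d b k := by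
  simp [twDer, triHom]

theorem triHom_eq (a : SDiffPoly p) :
    triHom p φ ψ d hd a = !![φ a, twDer p φ ψ d hd a; 0, ψ a] := by
  refine induction p (C := fun a =>
    triHom p φ ψ d hd a = !![φ a, triHom p φ ψ d hd a 0 1; 0, ψ a]) ?_ ?_ ?_ ?_ a
  · intro r
    rw [AlgHom.commutes, AlgHom.commutes, AlgHom.commutes]
    ext i j; fin_cases i <;> fin_cases j <;> simp [Matrix.algebraMap_matrix_apply]
  · intro b k; simp [triHom]
  · intro x y hx hy
    rw [map_mul, hx, hy, Matrix.mul_fin_two]; simp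
  · intro x y hx hy
    rw [map_add, hx, hy]
    ext i j; fin_cases i <;> fin_cases j <;> simp

theorem twDer_mul (a b : SDiffPoly p) :
    twDer p φ ψ d hd (a * b) = φ a * twDer p φ ψ d hd b + twDer p φ ψ d hd a * ψ b := by
  have h := congrFun (congrFun (map_mul (triHom p φ ψ d hd) a b) 0) 1
  rw [triHom_eq, triHom_eq, triHom_eq, Matrix.mul_fin_two] at h
  simpa using h

end Derivations

/-! ### The even derivation `∂` -/

section Deriv

variable {B : Type} (p : B → ZMod 2)

/-- The even derivation `∂` with `∂ u_b^{(k)} = u_b^{(k+1)}`. -/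
def D : SDiffPoly p →ₗ[ℂ] SDiffPoly p :=
  twDer p (AlgHom.id ℂ _) (AlgHom.id ℂ _) (fun b k => gen p b (k + 1)) (by
    intro b k c l
    simp only [AlgHom.id_apply]
    rw [gen_comm p b c k (l + 1), gen_comm p b c (k + 1) l, smul_add, add_comm])

theorem D_gen (b : B) (k : ℕ) : D p (gen p b k) = gen p b (k + 1) := twDer_gen p _ _ _ _ b k

theorem D_mul (a b : SDiffPoly p) : D p (a * b) = a * D p b + D p a * b :=
  twDer_mul p _ _ _ _ a b

theorem D_algebraMap (r : ℂ) : D p (algebraMap ℂ _ r) = 0 := by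
  have h := D_mul p 1 1
  simp only [mul_one, one_mul] at h
  rw [Algebra.algebraMap_eq_smul_one, map_smul, left_eq_add.mp h, smul_zero]

theorem D_tw (c : ZMod 2) (a : SDiffPoly p) : D p (tw p c a) = tw p c (D p a) := by
  refine induction p (C := fun a => D p (tw p c a) = tw p c (D p a)) ?_ ?_ ?_ ?_ a
  · intro r; rw [AlgHom.commutes, D_algebraMap, map_zero]
  · intro b k; rw [tw_gen, map_smul, D_gen, tw_gen]
  · intro x y hx hy; rw [map_mul, D_mul, D_mul, map_add, map_mul, map_mul, hx, hy]
  · intro x y hx hy; simp only [map_add, hx, hy]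

theorem D_mem {i : ZMod 2} {a : SDiffPoly p} (ha : a ∈ parityPart p i) :
    D p a ∈ parityPart p i := by
  intro c; rw [← D_tw, ha c, map_smul]

theorem D_pow_mem {i : ZMod 2} {a : SDiffPoly p} (ha : a ∈ parityPart p i) (k : ℕ) :
    (D p ^ k) a ∈ parityPart p i := by
  induction k with
  | zero => simpa using ha
  | succ k ih => rw [pow_succ']; exact D_mem p ih

/-- The even derivation `∂` on `𝒱[λ]`, acting on coefficients. -/
def DPoly : (SDiffPoly p)[X] →ₗ[ℂ] (SDiffPoly p)[X] :=
  Polynomial.lsum fun n => ((Polynomial.monomial n).restrictScalars ℂ).comp (D p)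

theorem coeff_DPoly (f : (SDiffPoly p)[X]) (n : ℕ) : (DPoly p f).coeff n = D p (f.coeff n) := by
  simp only [DPoly, Polynomial.lsum_apply, LinearMap.comp_apply, LinearMap.restrictScalars_apply]
  rw [Polynomial.sum_def, Polynomial.finsetSum_coeff]
  simp only [Polynomial.coeff_monomial]
  rw [Finset.sum_ite_eq']
  split_ifs with h
  · rfl
  · rw [Polynomial.notMem_support_iff.mp h, map_zero]

/-- The operator `λ + ∂` on `𝒱[λ]`. -/
def lamD : (SDiffPoly p)[X] →ₗ[ℂ] (SDiffPoly p)[X] :=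
  LinearMap.mulLeft ℂ X + DPoly p

theorem lamD_apply (f : (SDiffPoly p)[X]) : lamD p f = X * f + DPoly p f := rfl

/-- Polynomials in `λ` with all coefficients of parity `i`. -/
def PolyParity (i : ZMod 2) (f : (SDiffPoly p)[X]) : Prop := ∀ n, f.coeff n ∈ parityPart p i

theorem lamD_parity {i : ZMod 2} {f : (SDiffPoly p)[X]} (hf : PolyParity p i f) :
    PolyParity p i (lamD p f) := by
  intro n
  rw [lamD_apply, Polynomial.coeff_add, coeff_DPoly]
  refine Submodule.add_mem _ ?_ (D_mem p (hf n))
  cases n with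
  | zero => simp
  | succ n => rw [Polynomial.coeff_X_mul]; exact hf n

theorem lamD_pow_parity {i : ZMod 2} {f : (SDiffPoly p)[X]} (hf : PolyParity p i f) (k : ℕ) :
    PolyParity p i ((lamD p ^ k) f) := by
  induction k with
  | zero => simpa using hf
  | succ k ih => rw [pow_succ']; exact lamD_parity p ih

theorem C_gen_supercomm (b : B) (k : ℕ) {i : ZMod 2} {f : (SDiffPoly p)[X]}
    (hf : PolyParity p i f) :
    C (gen p b k) * f = eps (p b * i) • (f * C (gen p b k)) := by
  ext n
  rw [Polynomial.coeff_C_mul, Polynomial.coeff_smul, Polynomial.coeff_mul_C,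
    gen_supercomm p b k (hf n)]

/-- Inclusion of constants `𝒱 → 𝒱[λ]`. -/
def constHom : SDiffPoly p →ₐ[ℂ] (SDiffPoly p)[X] := Polynomial.CAlgHom

end Deriv

end SDiffPoly

open SDiffPoly

/-! ### The Lie superalgebra `𝔤𝔩(P)` and its affine Poisson vertex superalgebra -/

section Affine

variable {P : Type} [Fintype P] [DecidableEq P] (p : P → ZMod 2)

/-- The Lie superbracket of `𝔤𝔩(P)`: on matrix units,
`[e_{ij}, e_{kl}] = δ_{jk} e_{il} - (-1)^{(i+j)(k+l)} δ_{il} e_{kj}`. -/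
def superBracket (a b : Matrix P P ℂ) : Matrix P P ℂ := fun x y =>
  ∑ z, (a x z * b z y - eps ((p x + p z) * (p z + p y)) * (b x z * a z y))

/-- The supertrace. -/
def str (a : Matrix P P ℂ) : ℂ := ∑ x, eps (p x) * a x x

/-- The invariant supersymmetric even bilinear form `(a|b) = str(ab)`. -/
def form (a b : Matrix P P ℂ) : ℂ := str p (a * b)

/-- The parity of the matrix unit `e_{ij}`. -/
def glParity (x : P × P) : ZMod 2 := p x.1 + p x.2

/-- The differential superalgebra `𝒱(𝔤𝔩(P))`, with generators `q_{ij}` corresponding to `e_{ij}`. -/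
abbrev VGl : Type := SDiffPoly (glParity p)

/-- The embedding `𝔤𝔩(P) → 𝒱(𝔤𝔩(P))`, `e_{ij} ↦ q_{ij}`. -/
def ofGl (a : Matrix P P ℂ) : VGl p := ∑ x, ∑ y, a x y • gen (glParity p) (x, y) 0

/-- The affine `λ`-bracket `{a_λ b} = [a,b] + kλ(a|b)` for `a, b ∈ 𝔤𝔩(P)`. -/
def affBase (k : ℂ) (a b : Matrix P P ℂ) : (VGl p)[X] :=
  C (ofGl p (superBracket p a b)) + C (algebraMap ℂ (VGl p) (k * form p a b)) * X

theorem superBracket_single (i j k l : P) :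
    superBracket p (Matrix.single i j 1) (Matrix.single k l 1) =
      (if j = k then Matrix.single i l 1 else 0) -
        eps ((p i + p j) * (p k + p l)) • (if i = l then Matrix.single k j 1 else 0) := by
  ext x y
  simp only [superBracket, Finset.sum_sub_distrib, Matrix.sub_apply, Matrix.smul_apply]
  congr 1
  · simp only [Matrix.single_apply]
    rw [Finset.sum_eq_single j]
    · by_cases h : j = k
      · subst h; by_cases h1 : i = x <;> by_cases h2 : l = y <;> simp [h1, h2]
      · have : ¬ k = j := fun e => h e.symm
        simp [h, this]
    · intro z _ hz; simp [hz.symm]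
    · simp
  · simp only [Matrix.single_apply]
    rw [Finset.sum_eq_single l]
    · by_cases h : i = l
      · subst h
        by_cases h1 : k = x <;> by_cases h2 : j = y <;> simp [h1, h2]
        rw [mul_comm, ← h1, ← h2, add_comm (p k), add_comm (p i) (p j)]
      · simp [h]
    · intro z _ hz; simp [hz.symm]
    · simp

theorem form_single (i j k l : P) :
    form p (Matrix.single i j 1) (Matrix.single k l 1) = if j = k ∧ i = l then eps (p i) else 0 := by
  unfold form str
  by_cases h : j = k
  · subst h
    rw [Matrix.single_mul_single_same]
    simp only [Matrix.single_apply]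
    rw [Finset.sum_eq_single i]
    · by_cases h : i = l <;> simp [h, eq_comm]
    · intro z _ hz; simp [hz.symm]
    · simp
  · rw [Matrix.single_mul_single_of_ne _ _ _ _ h]; simp [h]

theorem ofGl_single (i j : P) : ofGl p (Matrix.single i j 1) = gen (glParity p) (i, j) 0 := by
  unfold ofGl
  rw [Finset.sum_eq_single i, Finset.sum_eq_single j]
  · simp
  · intro y _ hy; simp [hy.symm]
  · simp
  · intro x _ hx; simp [hx.symm]
  · simp

theorem affBase_parity (k : ℂ) (i j : P) (x : P × P) :
    PolyParity (glParity p) (glParity p (i, j) + glParity p x)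
      (affBase p k (Matrix.single i j 1) (Matrix.single x.1 x.2 1)) := by
  intro n
  unfold affBase
  rw [Polynomial.coeff_add]
  refine Submodule.add_mem _ ?_ ?_
  · rw [Polynomial.coeff_C]
    split_ifs
    · refine Submodule.sum_mem _ fun a _ => Submodule.sum_mem _ fun b _ => ?_
      rw [superBracket_single]
      by_cases h : glParity p (i, j) + glParity p x = glParity p (a, b)
      · rw [h]; exact Submodule.smul_mem _ _ (gen_mem _ _ _)
      · convert Submodule.zero_mem _
        apply smul_eq_zero_of_left
        have h1 : ∀ a b c : ZMod 2, a + b + (b + c) = a + c := by decide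
        have h2 : ∀ a b c : ZMod 2, a + b + (c + a) = c + b := by decide
        rw [Matrix.sub_apply, Matrix.smul_apply]
        have e1 : (if j = x.1 then Matrix.single i x.2 (1 : ℂ) else 0) a b = 0 := by
          split_ifs with hj
          · rw [Matrix.single_apply, if_neg]
            rintro ⟨rfl, rfl⟩
            apply h; simp only [glParity, hj, h1]
          · rfl
        have e2 : (if i = x.2 then Matrix.single x.1 j (1 : ℂ) else 0) a b = 0 := by
          split_ifs with hj
          · rw [Matrix.single_apply, if_neg]
            rintro ⟨rfl, rfl⟩
            apply h; simp only [glParity, hj, h2]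
          · rfl
        rw [e1, e2]; simp
    · exact Submodule.zero_mem _
  · rw [Polynomial.coeff_C_mul, Polynomial.coeff_X]
    split_ifs
    · rw [mul_one, form_single]
      split_ifs with h
      · have : ∀ a b : ZMod 2, a + b + (b + a) = 0 := by decide
        obtain ⟨rfl, rfl⟩ := h
        simp only [glParity, this]
        exact algebraMap_mem _ _
      · simp
    · simp

theorem affUnit_aux (k : ℂ) (i j : P) (x : P × P) (m : ℕ) (y : P × P) (n : ℕ) :
    ((constHom (glParity p)).comp (tw (glParity p) (glParity p (i, j)))) (gen (glParity p) x m) *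
          (lamD (glParity p) ^ n)
            (affBase p k (Matrix.single i j 1) (Matrix.single y.1 y.2 1)) +
        (lamD (glParity p) ^ m) (affBase p k (Matrix.single i j 1) (Matrix.single x.1 x.2 1)) *
          constHom (glParity p) (gen (glParity p) y n) =
      eps (glParity p x * glParity p y) •
        (((constHom (glParity p)).comp (tw (glParity p) (glParity p (i, j))))
            (gen (glParity p) y n) *
          (lamD (glParity p) ^ m)
            (affBase p k (Matrix.single i j 1) (Matrix.single x.1 x.2 1)) +
        (lamD (glParity p) ^ n) (affBase p k (Matrix.single i j 1) (Matrix.single y.1 y.2 1)) *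
          constHom (glParity p) (gen (glParity p) x m)) := by
  have hx := lamD_pow_parity (glParity p) (affBase_parity p k i j x) m
  have hy := lamD_pow_parity (glParity p) (affBase_parity p k i j y) n
  have e1 := C_gen_supercomm (glParity p) x m hy
  have e2 := C_gen_supercomm (glParity p) y n hx
  simp only [constHom, AlgHom.comp_apply, tw_gen, map_smul, Polynomial.CAlgHom_apply,
    smul_mul_assoc]
  rw [e1, e2, smul_add, smul_smul, smul_smul, smul_smul, add_comm]
  have hs : ∀ a b c : ZMod 2,
      eps (a * b) * eps (b * (a + c)) = eps (c * b) := by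
    intro a b c
    rw [mul_add, eps_add, ← mul_assoc, mul_comm b a, eps_mul_self, one_mul, mul_comm]
  rw [mul_comm (glParity p x) (glParity p y), hs, mul_assoc, hs,
    mul_comm (glParity p y) (glParity p x), eps_mul_self, one_smul, add_comm]

/-- The affine `λ`-bracket `{e_{ij} _λ ·}` of level `k`: the linear map `𝒱(𝔤) → 𝒱(𝔤)[λ]` with
`{e_{ij} _λ ∂^n e_{kl}} = (λ+∂)^n ([e_{ij}, e_{kl}] + kλ(e_{ij}|e_{kl}))` and the left Leibniz rule
`{a _λ bc} = {a _λ b} c + (-1)^{p(a)p(b)} b {a _λ c}`. -/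
def affUnit (k : ℂ) (i j : P) : VGl p →ₗ[ℂ] (VGl p)[X] :=
  twDer (glParity p)
    ((constHom (glParity p)).comp (tw (glParity p) (glParity p (i, j))))
    (constHom (glParity p))
    (fun x n => (lamD (glParity p) ^ n)
      (affBase p k (Matrix.single i j 1) (Matrix.single x.1 x.2 1)))
    (affUnit_aux p k i j)

theorem affUnit_gen (k : ℂ) (i j : P) (x : P × P) (n : ℕ) :
    affUnit p k i j (gen (glParity p) x n) =
      (lamD (glParity p) ^ n) (affBase p k (Matrix.single i j 1) (Matrix.single x.1 x.2 1)) :=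
  twDer_gen _ _ _ _ _ x n

/-- The left Leibniz rule. -/
theorem affUnit_mul (k : ℂ) (i j : P) {c : ZMod 2} {a : VGl p} (b : VGl p)
    (ha : a ∈ parityPart (glParity p) c) :
    affUnit p k i j (a * b) =
      affUnit p k i j a * C b + eps (glParity p (i, j) * c) • (C a * affUnit p k i j b) := by
  have h := twDer_mul (glParity p) _ _ _ (affUnit_aux p k i j) a b
  rw [add_comm, ← smul_mul_assoc]
  rw [AlgHom.comp_apply, ha, map_smul] at h
  exact h

/-- The affine `λ`-bracket `{a _λ ·}` of level `k` on `𝒱(𝔤𝔩(P))`, for `a ∈ 𝔤𝔩(P)`. -/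
def affBracket (k : ℂ) (a : Matrix P P ℂ) : VGl p →ₗ[ℂ] (VGl p)[X] :=
  ∑ x, ∑ y, a x y • affUnit p k x y

theorem lamD_C_mul (a : VGl p) (f : (VGl p)[X]) :
    lamD (glParity p) (C a * f) = C a * lamD (glParity p) f + C (D (glParity p) a) * f := by
  ext n
  simp only [lamD_apply, mul_add, Polynomial.coeff_add, coeff_DPoly, Polynomial.coeff_C_mul, D_mul]
  rw [← mul_assoc, Polynomial.X_mul_C, mul_assoc, Polynomial.coeff_C_mul]
  abel

theorem lamD_mul_C (a : VGl p) (f : (VGl p)[X]) :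
    lamD (glParity p) (f * C a) = f * C (D (glParity p) a) + lamD (glParity p) f * C a := by
  ext n
  simp only [lamD_apply, add_mul, Polynomial.coeff_add, coeff_DPoly, Polynomial.coeff_mul_C, D_mul]
  rw [← mul_assoc, Polynomial.coeff_mul_C]
  abel

/-- Sesquilinearity in the second argument. -/
theorem affBracket_D (k : ℂ) (a : Matrix P P ℂ) (v : VGl p) :
    affBracket p k a (D (glParity p) v) = lamD (glParity p) (affBracket p k a v) := by
  have h : ∀ i j, affUnit p k i j (D (glParity p) v) = lamD (glParity p) (affUnit p k i j v) := by
    intro i j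
    have hm : ∀ a b, affUnit p k i j (a * b) = C (tw (glParity p) (glParity p (i, j)) a) *
        affUnit p k i j b + affUnit p k i j a * C b :=
      twDer_mul (glParity p) _ _ _ (affUnit_aux p k i j)
    have h0 : ∀ r : ℂ, affUnit p k i j (algebraMap ℂ _ r) = 0 := by
      intro r
      have h1 := hm 1 1
      simp only [map_one, mul_one, one_mul] at h1
      rw [Algebra.algebraMap_eq_smul_one, map_smul, left_eq_add.mp h1, smul_zero]
    refine induction (glParity p) (C := fun v =>
      affUnit p k i j (D (glParity p) v) = lamD (glParity p) (affUnit p k i j v)) ?_ ?_ ?_ ?_ v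
    · intro r; rw [D_algebraMap, h0, map_zero, map_zero]
    · intro b l
      rw [D_gen, affUnit_gen, affUnit_gen, pow_succ']; rfl
    · intro x y hx hy
      rw [D_mul, map_add, hm, hm, hm, map_add, lamD_C_mul, lamD_mul_C, hx, hy, D_tw]
      abel
    · intro x y hx hy; simp only [map_add, hx, hy]
  simp only [affBracket, LinearMap.sum_apply, LinearMap.smul_apply, map_sum, map_smul, h]

end Affine

/-! ### Matrix pseudo-differential operators -/

section PseudoDiff

variable {B : Type} (p : B → ZMod 2)

/-- Coefficient sequences `(a_n)_{n ∈ ℤ}` vanishing for large `n`. -/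
def psiSubmodule : Submodule ℂ (ℤ → SDiffPoly p) where
  carrier := {a | ∃ M : ℤ, ∀ n, M < n → a n = 0}
  zero_mem' := ⟨0, fun _ _ => rfl⟩
  add_mem' := by
    rintro a b ⟨M, hM⟩ ⟨M', hM'⟩
    refine ⟨max M M', fun n hn => ?_⟩
    rw [Pi.add_apply, hM n (lt_of_le_of_lt (le_max_left _ _) hn),
      hM' n (lt_of_le_of_lt (le_max_right _ _) hn), add_zero]
  smul_mem' := by
    rintro r a ⟨M, hM⟩
    exact ⟨M, fun n hn => by rw [Pi.smul_apply, hM n hn, smul_zero]⟩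

/-- The space `𝒱((∂⁻¹))` of pseudo-differential operators `∑_{n ≤ M} a_n ∂^n` over a superalgebra `𝒱`
of differential polynomials. -/
def PsiDO : Type := psiSubmodule p

instance : AddCommGroup (PsiDO p) := inferInstanceAs (AddCommGroup (psiSubmodule p))

instance : Module ℂ (PsiDO p) := inferInstanceAs (Module ℂ (psiSubmodule p))

variable {p}

/-- The coefficient of `∂^n`. -/
def PsiDO.coeff (A : PsiDO p) (n : ℤ) : SDiffPoly p := A.1 n

theorem PsiDO.bdd (A : PsiDO p) : ∃ M : ℤ, ∀ n, M < n → A.coeff n = 0 := A.2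

variable (p) in
/-- The operator `a ∂^k`. -/
def PsiDO.monomial (k : ℤ) (a : SDiffPoly p) : PsiDO p :=
  ⟨Pi.single k a, k, fun n hn => by rw [Pi.single_apply, if_neg (ne_of_gt hn)]⟩

instance : One (PsiDO p) := ⟨PsiDO.monomial p 0 1⟩

/-- The summand of the coefficient of `∂^n` in `A B` that comes from the term
`binom(m, k) a_m ∂^k(b_{n-m+k})` of `a_m ∂^m ∘ b_{n-m+k} ∂^{n-m+k}`. -/
def PsiDO.mulTerm (A B : PsiDO p) (n : ℤ) (x : ℤ × ℕ) : SDiffPoly p :=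
  Ring.choose x.1 x.2 • (A.coeff x.1 * (D p ^ x.2) (B.coeff (n - x.1 + x.2)))

theorem PsiDO.mulTerm_support_finite (A B : PsiDO p) (n : ℤ) :
    (Function.support (PsiDO.mulTerm A B n)).Finite := by
  obtain ⟨M, hM⟩ := A.bdd
  obtain ⟨M', hM'⟩ := B.bdd
  apply Set.Finite.subset (Set.Finite.prod (Set.finite_Icc (n - M') M)
    (Set.finite_Iic (M + M' - n).toNat))
  rintro ⟨m, k⟩ h
  have h1 : m ≤ M := by
    by_contra hc
    apply h; simp [PsiDO.mulTerm, hM m (by omega)]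
  have h2 : n - m + k ≤ M' := by
    by_contra hc
    apply h; simp [PsiDO.mulTerm, hM' (n - m + k) (by omega)]
  simp only [Set.mem_prod, Set.mem_Icc, Set.mem_Iic]
  omega

/-- The associative product of pseudo-differential operators, determined by
`∂^m ∘ b = ∑_{k ≥ 0} binom(m, k) ∂^k(b) ∂^{m-k}` for `m ∈ ℤ`; the sums below are finite. -/
instance : Mul (PsiDO p) where
  mul A B := ⟨fun n => ∑ᶠ x : ℤ × ℕ, PsiDO.mulTerm A B n x, by
    obtain ⟨M, hM⟩ := A.bdd
    obtain ⟨M', hM'⟩ := B.bdd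
    refine ⟨M + M', fun n hn => finsum_eq_zero_of_forall_eq_zero fun x => ?_⟩
    by_cases h1 : M < x.1
    · simp [PsiDO.mulTerm, hM _ h1]
    · simp [PsiDO.mulTerm, hM' (n - x.1 + x.2) (by omega)]⟩

theorem PsiDO.coeff_mul (A B : PsiDO p) (n : ℤ) :
    (A * B).coeff n = ∑ᶠ x : ℤ × ℕ, PsiDO.mulTerm A B n x := rfl

/-- Apply an algebra homomorphism to all coefficients. -/
def PsiDO.map {B' : Type} {p' : B' → ZMod 2} (φ : SDiffPoly p →ₐ[ℂ] SDiffPoly p') (A : PsiDO p) :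
    PsiDO p' :=
  ⟨fun n => φ (A.coeff n), by
    obtain ⟨M, hM⟩ := A.bdd
    exact ⟨M, fun n hn => by simp only [hM n hn, map_zero]⟩⟩

variable {J K L : Type} [Fintype J] [Fintype K] [Fintype L] [DecidableEq J] [DecidableEq K]
  (pJ : J → ZMod 2) (pK : K → ZMod 2) (pL : L → ZMod 2)

/-- The `⋆`-product `(a ⊗ v) ⋆ (b ⊗ w) = (-1)^{p(b)p(v) + p(a)p(b)} ab ⊗ vw` of the matrix
pseudo-differential operators `∑ e_{ik} ⊗ A_{ik}` and `∑ e_{kl} ⊗ B_{kl}`, where `e_{ik}` has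
parity `p(i) + p(k)`. -/
def starMul (A : Matrix J K (PsiDO p)) (B : Matrix K L (PsiDO p)) : Matrix J L (PsiDO p) :=
  fun i l => ∑ k, eps ((pJ i + pK k) * (pK k + pL l)) •
    ((A i k).map (tw p (pK k + pL l)) * B k l)

/-- `∑ e_{ik} ⊗ A_{ik}` is even. -/
def IsEvenMat (A : Matrix J K (PsiDO p)) : Prop :=
  ∀ i k n, (A i k).coeff n ∈ parityPart p (pJ i + pK k)

/-- Multiplying a pseudo-differential operator on the left by an even matrix involves no signs. -/
theorem starMul_of_even {A : Matrix J K (PsiDO p)} (hA : IsEvenMat pJ pK A)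
    (B : Matrix K L (PsiDO p)) : starMul pJ pK pL A B = fun i l => ∑ k, A i k * B k l := by
  funext i l
  refine Finset.sum_congr rfl fun k _ => ?_
  apply Subtype.ext
  funext n
  change eps _ • (∑ᶠ x, PsiDO.mulTerm _ _ n x) = ∑ᶠ x, PsiDO.mulTerm _ _ n x
  rw [smul_finsum]
  refine finsum_congr fun x => ?_
  have h : ((A i k).map (tw p (pK k + pL l))).coeff x.1 =
      eps ((pK k + pL l) * (pJ i + pK k)) • (A i k).coeff x.1 := hA i k x.1 _
  rw [PsiDO.mulTerm, PsiDO.mulTerm, h, smul_mul_assoc, smul_comm (eps _) (Ring.choose x.1 x.2),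
    smul_smul, mul_comm (pK k + pL l), eps_mul_self, one_smul]

/-- `B` is the two-sided `⋆`-inverse of `A`. -/
def IsStarInv (A : Matrix J K (PsiDO p)) (B : Matrix K J (PsiDO p)) : Prop :=
  starMul pJ pK pJ A B = (fun i j => if i = j then 1 else 0) ∧
    starMul pK pJ pK B A = (fun i j => if i = j then 1 else 0)

/-- `Q` is the quasi-determinant `|A|_{JK} = ((A^inv)_{KJ})^inv` of `A`, the inverses being taken for
the `⋆`-product. The sets of rows `J` and of columns `K` are given by maps `r`, `c` to the index set
of `A`. -/
def IsQuasiDet {P : Type} [Fintype P] [DecidableEq P] (pP : P → ZMod 2)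
    (A : Matrix P P (PsiDO p)) (r : J → P) (c : K → P) (Q : Matrix J K (PsiDO p)) : Prop :=
  ∃ B : Matrix P P (PsiDO p), IsStarInv pP pP A B ∧
    IsStarInv (fun k => pP (c k)) (fun j => pP (r j)) (B.submatrix c r) Q

/-- A monic matrix differential operator of order `N`. -/
def IsMonicDiffOp (N : ℕ) (A : Matrix J J (PsiDO p)) : Prop :=
  ∀ i j, (A i j).coeff N = (if i = j then 1 else 0) ∧
    ∀ k : ℤ, k < 0 ∨ (N : ℤ) < k → (A i j).coeff k = 0

end PseudoDiff

/-- The affine operator `A(∂)` with entries `A_{ij}(∂) = δ_{ij} ∂ + (-1)^{p(i)} q_{ij}`. -/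
def affineOp {P : Type} [Fintype P] [DecidableEq P] (p : P → ZMod 2) :
    Matrix P P (PsiDO (glParity p)) := fun i j =>
  (if i = j then PsiDO.monomial _ 1 1 else 0) +
    PsiDO.monomial _ 0 (eps (p i) • gen (glParity p) (i, j) 0)

/-! ### The rectangular `𝒲`-superalgebra -/

section Rectangular

variable (N m n : ℕ)

/-- The index set of `𝔤𝔩(Nm|Nn) = 𝔤𝔩_N ⊗ 𝔤𝔩(m|n)`: the pair `(u, i)` is the `i`-th index of
the block `u` (blocks are numbered from `0`). -/
abbrev Idx : Type := Fin N × (Fin m ⊕ Fin n)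

/-- The parity of the indices of `𝔤𝔩(m|n)`. -/
def inPar : Fin m ⊕ Fin n → ZMod 2 := Sum.elim (fun _ => 0) (fun _ => 1)

/-- The parity of the indices of `𝔤𝔩(Nm|Nn)`. -/
def par (x : Idx N m n) : ZMod 2 := inPar m n x.2

/-- The `N × (m|n)` rectangular nilpotent element: identity matrices in the blocks `(u+1, u)`. -/
def fNil : Matrix (Idx N m n) (Idx N m n) ℂ := fun x y =>
  if x.1.val = y.1.val + 1 ∧ x.2 = y.2 then 1 else 0

/-- The diagonal matrix `h` of the `𝔰𝔩₂`-triple, with entry `N - 2u + 1` in the `u`-th block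
(blocks being numbered from `1`). -/
def hDiag : Matrix (Idx N m n) (Idx N m n) ℂ :=
  Matrix.diagonal fun x => (N : ℂ) - 2 * ((x.1.val : ℂ) + 1) + 1

variable {N m n}

/-- The degree of the matrix unit `e_{xy}`, half its eigenvalue under `ad h`. -/
def deg (x y : Idx N m n) : ℤ := (y.1.val : ℤ) - (x.1.val : ℤ)

variable (N m n)

/-- `𝔤_d = {a | [h, a] = 2d a}` is spanned by the matrix units of degree `d`. -/
theorem mem_graded_iff (d : ℚ) (a : Matrix (Idx N m n) (Idx N m n) ℂ) :
    superBracket (par N m n) (hDiag N m n) a = (2 * (d : ℂ)) • a ↔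
      ∀ x y, a x y ≠ 0 → (deg x y : ℚ) = d := by
  have key : ∀ x y, superBracket (par N m n) (hDiag N m n) a x y = 2 * (deg x y : ℂ) * a x y := by
    intro x y
    unfold superBracket
    rw [Finset.sum_sub_distrib, Finset.sum_eq_single x, Finset.sum_eq_single y]
    · simp [hDiag, deg, CharTwo.add_self_eq_zero, eps_zero]; ring
    · intro z _ hz; simp [hDiag, hz]
    · simp
    · intro z _ hz; simp [hDiag, hz.symm]
    · simp
  constructor
  · intro h x y hxy
    have h1 := congrFun (congrFun h x) y
    rw [key, Matrix.smul_apply, smul_eq_mul] at h1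
    have h2 := mul_right_cancel₀ hxy h1
    have h3 : ((deg x y : ℚ) : ℂ) = (d : ℂ) := by
      push_cast; exact mul_left_cancel₀ two_ne_zero h2
    exact_mod_cast h3
  · intro h
    ext x y
    rw [key, Matrix.smul_apply, smul_eq_mul]
    by_cases hxy : a x y = 0
    · rw [hxy, mul_zero, mul_zero]
    · rw [← h x y hxy]; push_cast; ring

/-- `𝔫 = 𝔤_{≥ 1/2}`. -/
def nSub : Submodule ℂ (Matrix (Idx N m n) (Idx N m n) ℂ) where
  carrier := {a | ∀ x y, a x y ≠ 0 → (1 / 2 : ℚ) ≤ deg x y}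
  zero_mem' := by intro x y h; exact absurd rfl h
  add_mem' := by
    intro a b ha hb x y h
    by_cases h1 : a x y = 0
    · exact hb x y (by intro h2; apply h; rw [Matrix.add_apply, h1, h2, add_zero])
    · exact ha x y h1
  smul_mem' := by
    intro r a ha x y h
    exact ha x y (by intro h1; apply h; rw [Matrix.smul_apply, h1, smul_zero])

/-- The matrix units `e_{xy}` which form a basis of `𝔭 = 𝔤_{< 1}`. -/
def PIdx : Type := {x : Idx N m n × Idx N m n // deg x.1 x.2 < 1}

/-- The parities of the basis of `𝔭`. -/
def pPar (x : PIdx N m n) : ZMod 2 := glParity (par N m n) x.1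

/-- The differential superalgebra `𝒱(𝔭)`. -/
abbrev VP : Type := SDiffPoly (pPar N m n)

/-- The inclusion `𝒱(𝔭) ⊂ 𝒱(𝔤)`. -/
def inclP : VP N m n →ₐ[ℂ] VGl (par N m n) :=
  lift (pPar N m n) (fun x k => gen (glParity (par N m n)) x.1 k)
    (fun x k y l => gen_comm (glParity (par N m n)) x.1 y.1 k l)

/-- `ρ(a) = π_𝔭(a) + (f|a)` for a matrix unit `a = e_{xy}`. -/
def rhoUnit (x : Idx N m n × Idx N m n) : VP N m n :=
  (if h : deg x.1 x.2 < 1 then gen (pPar N m n) ⟨x, h⟩ 0 else 0) +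
    algebraMap ℂ (VP N m n) (form (par N m n) (fNil N m n) (Matrix.single x.1 x.2 1))

theorem rhoUnit_mem (x : Idx N m n × Idx N m n) :
    rhoUnit N m n x ∈ parityPart (pPar N m n) (glParity (par N m n) x) := by
  unfold rhoUnit
  refine Submodule.add_mem _ ?_ ?_
  · split_ifs with h
    · exact gen_mem (pPar N m n) ⟨x, h⟩ 0
    · exact Submodule.zero_mem _
  · have e : form (par N m n) (fNil N m n) (Matrix.single x.1 x.2 1) =
        eps (par N m n x.2) * fNil N m n x.2 x.1 := by
      unfold form str
      rw [Finset.sum_eq_single x.2]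
      · simp
      · intro z _ hz; rw [Matrix.mul_single_apply_of_ne _ _ _ _ _ hz, mul_zero]
      · simp
    rw [e]
    unfold fNil
    split_ifs with h
    · have : glParity (par N m n) x = 0 := by
        simp only [glParity, par, h.2, CharTwo.add_self_eq_zero]
      rw [this]; exact algebraMap_mem _ _
    · simp

/-- The homomorphism of differential superalgebras `ρ : 𝒱(𝔤) → 𝒱(𝔭)` with
`ρ(a) = π_𝔭(a) + (f|a)` for `a ∈ 𝔤`. -/
def rho : VGl (par N m n) →ₐ[ℂ] VP N m n :=
  lift (glParity (par N m n)) (fun x k => (D (pPar N m n) ^ k) (rhoUnit N m n x))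
    (fun x k y l => supercomm (pPar N m n) (D_pow_mem _ (rhoUnit_mem N m n x) k)
      (D_pow_mem _ (rhoUnit_mem N m n y) l))

/-- The classical `𝒲`-superalgebra of level `k`:
`𝒲^k(𝔤𝔩(Nm|Nn), f) = {v ∈ 𝒱(𝔭) | ρ({a _λ v}) = 0 for all a ∈ 𝔫}`, where `{ _λ }` is the affine
`λ`-bracket of level `k`. -/
def WAlg (k : ℂ) : Submodule ℂ (VP N m n) where
  carrier := {v | ∀ a ∈ nSub N m n,
    Polynomial.mapAlgHom (rho N m n) (affBracket (par N m n) k a (inclP N m n v)) = 0}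
  zero_mem' := by intro a _; simp
  add_mem' := by intro v w hv hw a ha; rw [map_add, map_add, map_add, hv a ha, hw a ha, add_zero]
  smul_mem' := by intro r v hv a ha; rw [map_smul, map_smul, map_smul, hv a ha, smul_zero]

/-- The matrix operator `ρ(A(∂))`. -/
def rhoA : Matrix (Idx N m n) (Idx N m n) (PsiDO (pPar N m n)) :=
  (affineOp (par N m n)).map (PsiDO.map (rho N m n))

variable {N}

/-- The indices in the last block (the subset `I`). -/
def lastBlock (hN : 2 ≤ N) (i : Fin m ⊕ Fin n) : Idx N m n := (⟨N - 1, by omega⟩, i)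

/-- The indices in the first block (the subset `J`). -/
def firstBlock (hN : 2 ≤ N) (i : Fin m ⊕ Fin n) : Idx N m n := (⟨0, by omega⟩, i)

end Rectangular

/-- The family `(w_g)`, with `w_g` of parity `pG g`, freely generates the subspace `W` of `𝒱` as a
differential superalgebra: the homomorphism of differential superalgebras
`ℂ[u_g^{(k)} | g ∈ G, k ≥ 0] → 𝒱`, `u_g ↦ w_g`, is injective with image `W`. -/
def FreelyGenerates {B G : Type} {p : B → ZMod 2} (pG : G → ZMod 2) (w : G → SDiffPoly p)
    (W : Submodule ℂ (SDiffPoly p)) : Prop :=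
  (∀ g, w g ∈ parityPart p (pG g)) ∧
  ∃ Φ : SDiffPoly pG →ₐ[ℂ] SDiffPoly p,
    (∀ a, Φ (D pG a) = D p (Φ a)) ∧ (∀ g, Φ (gen pG g 0) = w g) ∧
    Function.Injective Φ ∧ LinearMap.range Φ.toLinearMap = W

end RectW

namespace RectW

open SDiffPoly

namespace SDiffPoly

/-! ### Differential homomorphisms -/

section DiffHom

variable {B B' : Type} (p : B → ZMod 2) (p' : B' → ZMod 2)

/-! Number the blocks from 0 and write `a` for the matrix ρ(A(0)), so that ρ(A(∂)) = ∂ + a. The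
shift by f makes the blocks (u, u+1) of `a` identity matrices, and the blocks further above the
diagonal vanish. Hence all block rows but the last of ρ(A(∂)) Y = 0 can be solved successively from
Y_0 = 1, by Y_{u+1} = -(∂ Y_u + ∑_{v ≤ u} a_{uv} Y_v). These are the operators with symbols `symb`;
Y_u has order u and leading coefficient (-1)^u. The last block row of ρ(A(∂)) Y is then -Y_N.

Quasi-determinant. A column killed by all block rows but the last equals Y times its first block,
and the last row maps that block by -Y_N (`quasiDet_mulVec_first`). So the block JI of the inverse
is inverse to -Y_N, and L = (-1)^N Y_N. The inverses exist because an operator with scalar nonzero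
leading coefficient acts bijectively on columns of pseudo-differential operators
(`mulVec_injective_of_leadingCoeff`, `mulVec_surjective_of_leadingCoeff`), and bijectivity passes
from -Y_N to ρ(A(∂)) (`rhoA_bijective`). All left factors are even matrices of differential
operators, so the ⋆-signs disappear and only associativity with a differential operator on the left
is needed (`LeftAssoc`).

Invariance. The bracket with e_{xy} in 𝔫 acts on `a` as an infinitesimal gauge transformation
(`rhoBracket_rhoCoeff`). Carried through the recursion, it sends row y of Y to row x up to sign and
kills the other rows (`rhoBracket_coeff_symb`); it also kills Y_N (`rhoBracket_coeff_symb_last`). So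
the coefficients of L lie in the 𝒲-superalgebra.

Freeness and completeness. The non-leading coefficients of (-1)^u Y_u, 1 ≤ u ≤ N, correspond to the
basis of 𝔭 by a triangular substitution, hence are free differential generators of 𝒱(𝔭)
(`coordHom_bijective`). It remains to see that an invariant involves only those of Y_N. For u < N,
dividing by Y_0, ..., Y_{u-1} writes the lower part of each row of Y_u as a combination of rows of
earlier blocks (`exists_lower_eq_sum`). With the factors of this combination as weights, the
brackets with 𝔫 add up to a derivation commuting with ∂ which is the Euler derivation of the
coefficients of Y_1, ..., Y_{N-1}. It annihilates every invariant, and in characteristic zero an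
element annihilated by it does not involve these coordinates (`killHom_eq_of_euler_eq_zero`). -/

theorem one_mem_parityPart : (1 : SDiffPoly p) ∈ parityPart p 0 := by
  simpa using algebraMap_mem p 1

theorem mul_mem_parityPart {i j : ZMod 2} {a b : SDiffPoly p} (ha : a ∈ parityPart p i)
    (hb : b ∈ parityPart p j) : a * b ∈ parityPart p (i + j) := by
  intro c
  rw [map_mul, ha c, hb c, smul_mul_smul_comm, mul_add, eps_add]

/-- The homomorphism of differential superalgebras with prescribed homogeneous images of the
generators. -/
def diffHom (f : B → SDiffPoly p') (hf : ∀ b, f b ∈ parityPart p' (p b)) :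
    SDiffPoly p →ₐ[ℂ] SDiffPoly p' :=
  lift p (fun b k => (D p' ^ k) (f b))
    (fun b k c l => supercomm p' (D_pow_mem _ (hf b) k) (D_pow_mem _ (hf c) l))

variable {p p'}

theorem diffHom_gen (f : B → SDiffPoly p') (hf : ∀ b, f b ∈ parityPart p' (p b)) (b : B) (k : ℕ) :
    diffHom p p' f hf (gen p b k) = (D p' ^ k) (f b) := lift_gen p _ _ b k

theorem diffHom_gen_zero (f : B → SDiffPoly p') (hf : ∀ b, f b ∈ parityPart p' (p b)) (b : B) :
    diffHom p p' f hf (gen p b 0) = f b := by rw [diffHom_gen]; rfl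

theorem D_pow_gen (b : B) (k : ℕ) : (D p ^ k) (gen p b 0) = gen p b k := by
  induction k with
  | zero => rfl
  | succ k ih => rw [pow_succ', Module.End.mul_apply, ih, D_gen]

/-- A homomorphism which is compatible with `∂` on the generators is a differential
homomorphism. -/
theorem algHom_D (φ : SDiffPoly p →ₐ[ℂ] SDiffPoly p')
    (h : ∀ b k, φ (gen p b (k + 1)) = D p' (φ (gen p b k))) (a : SDiffPoly p) :
    φ (D p a) = D p' (φ a) := by
  refine induction p (C := fun a => φ (D p a) = D p' (φ a)) ?_ ?_ ?_ ?_ a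
  · intro r; rw [D_algebraMap, AlgHom.commutes, D_algebraMap, map_zero]
  · intro b k; rw [D_gen, h]
  · intro x y hx hy; rw [D_mul, map_add, map_mul, map_mul, map_mul, D_mul, hx, hy]
  · intro x y hx hy; simp only [map_add, hx, hy]

theorem diffHom_D (f : B → SDiffPoly p') (hf : ∀ b, f b ∈ parityPart p' (p b)) (a : SDiffPoly p) :
    diffHom p p' f hf (D p a) = D p' (diffHom p p' f hf a) := by
  apply algHom_D
  intro b k
  rw [diffHom_gen, diffHom_gen, pow_succ', Module.End.mul_apply]

theorem diffHom_D_pow (f : B → SDiffPoly p') (hf : ∀ b, f b ∈ parityPart p' (p b)) (k : ℕ)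
    (a : SDiffPoly p) :
    diffHom p p' f hf ((D p ^ k) a) = (D p' ^ k) (diffHom p p' f hf a) := by
  induction k with
  | zero => rfl
  | succ k ih => rw [pow_succ', pow_succ', Module.End.mul_apply, Module.End.mul_apply, diffHom_D, ih]

theorem tw_diffHom (f : B → SDiffPoly p') (hf : ∀ b, f b ∈ parityPart p' (p b)) (c : ZMod 2)
    (a : SDiffPoly p) : tw p' c (diffHom p p' f hf a) = diffHom p p' f hf (tw p c a) := by
  refine induction p (C := fun a => tw p' c (diffHom p p' f hf a) = diffHom p p' f hf (tw p c a))
    ?_ ?_ ?_ ?_ a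
  · intro r; simp only [AlgHom.commutes]
  · intro b k; rw [tw_gen, map_smul, diffHom_gen, D_pow_mem p' (hf b) k c]
  · intro x y hx hy; simp only [map_mul, hx, hy]
  · intro x y hx hy; simp only [map_add, hx, hy]

theorem diffHom_mem (f : B → SDiffPoly p') (hf : ∀ b, f b ∈ parityPart p' (p b)) {i : ZMod 2}
    {a : SDiffPoly p} (ha : a ∈ parityPart p i) : diffHom p p' f hf a ∈ parityPart p' i := by
  intro c
  rw [tw_diffHom, ha c, map_smul]

/-- Twisted derivations are determined by their values on the generators. -/
theorem der_ext {S : Type} [Ring S] [Algebra ℂ S] (φ ψ : SDiffPoly p →ₐ[ℂ] S)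
    {d e : SDiffPoly p →ₗ[ℂ] S}
    (hd : ∀ a b, d (a * b) = φ a * d b + d a * ψ b)
    (he : ∀ a b, e (a * b) = φ a * e b + e a * ψ b)
    (h : ∀ b k, d (gen p b k) = e (gen p b k)) : d = e := by
  have h1 : ∀ {d : SDiffPoly p →ₗ[ℂ] S} (_ : ∀ a b, d (a * b) = φ a * d b + d a * ψ b),
      d 1 = 0 := by
    intro d hd
    have := hd 1 1
    rw [map_one φ, map_one ψ, mul_one, mul_one, one_mul] at this
    exact left_eq_add.mp this
  ext a
  refine induction p (C := fun a => d a = e a) ?_ h ?_ ?_ a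
  · intro r
    rw [Algebra.algebraMap_eq_smul_one, map_smul, map_smul, h1 hd, h1 he]
  · intro x y hx hy; rw [hd, he, hx, hy]
  · intro x y hx hy; rw [map_add, map_add, hx, hy]

end DiffHom

/-! ### Triangular endomorphisms -/

section Triangular

variable {B : Type} (p : B → ZMod 2) (r : B → ℕ)

/-- The subalgebra generated by the `u_b^{(k)}` with `r b < n`. -/
def lowSub (n : ℕ) : Subalgebra ℂ (SDiffPoly p) :=
  Algebra.adjoin ℂ {x | ∃ b k, r b < n ∧ x = gen p b k}

variable {p r}

theorem gen_mem_lowSub {n : ℕ} {b : B} (k : ℕ) (h : r b < n) : gen p b k ∈ lowSub p r n :=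
  Algebra.subset_adjoin ⟨b, k, h, rfl⟩

theorem lowSub_mono {n n' : ℕ} (h : n ≤ n') : lowSub p r n ≤ lowSub p r n' :=
  Algebra.adjoin_mono fun _ ⟨b, k, hb, hx⟩ => ⟨b, k, hb.trans_le h, hx⟩

theorem D_mem_lowSub {n : ℕ} {a : SDiffPoly p} (ha : a ∈ lowSub p r n) :
    D p a ∈ lowSub p r n := by
  induction ha using Algebra.adjoin_induction with
  | mem x hx =>
    obtain ⟨b, k, hb, rfl⟩ := hx
    rw [D_gen]; exact gen_mem_lowSub _ hb
  | algebraMap c => rw [D_algebraMap]; exact zero_mem _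
  | add x y _ _ hx hy => rw [map_add]; exact add_mem hx hy
  | mul x y hx' hy' hx hy =>
    rw [D_mul]; exact add_mem (mul_mem hx' hy) (mul_mem hx hy')

theorem D_pow_mem_lowSub {n : ℕ} {a : SDiffPoly p} (ha : a ∈ lowSub p r n) (k : ℕ) :
    (D p ^ k) a ∈ lowSub p r n := by
  induction k with
  | zero => exact ha
  | succ k ih => rw [pow_succ']; exact D_mem_lowSub ih

theorem diffHom_mem_lowSub (g : B → SDiffPoly p) (hg : ∀ b, g b ∈ parityPart p (p b)) {n : ℕ}
    (h : ∀ b, r b < n → g b ∈ lowSub p r n) {a : SDiffPoly p} (ha : a ∈ lowSub p r n) :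
    diffHom p p g hg a ∈ lowSub p r n := by
  induction ha using Algebra.adjoin_induction with
  | mem x hx =>
    obtain ⟨b, k, hb, rfl⟩ := hx
    rw [diffHom_gen]; exact D_pow_mem_lowSub (h b hb) k
  | algebraMap c => rw [AlgHom.commutes]; exact Subalgebra.algebraMap_mem _ c
  | add x y _ _ hx hy => rw [map_add]; exact add_mem hx hy
  | mul x y _ _ hx hy => rw [map_mul]; exact mul_mem hx hy

theorem diffHom_comp_eq_self (f g : B → SDiffPoly p) (hf : ∀ b, f b ∈ parityPart p (p b))
    (hg : ∀ b, g b ∈ parityPart p (p b)) {n : ℕ}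
    (h : ∀ b, r b < n → diffHom p p f hf (g b) = gen p b 0) {a : SDiffPoly p}
    (ha : a ∈ lowSub p r n) : diffHom p p f hf (diffHom p p g hg a) = a := by
  induction ha using Algebra.adjoin_induction with
  | mem x hx =>
    obtain ⟨b, k, hb, rfl⟩ := hx
    rw [diffHom_gen, diffHom_D_pow, h b hb, D_pow_gen]
  | algebraMap c => simp only [AlgHom.commutes]
  | add x y _ _ hx hy => simp only [map_add, hx, hy]
  | mul x y _ _ hx hy => simp only [map_mul, hx, hy]

/-- A triangular differential endomorphism has a triangular right inverse. -/
theorem exists_triangular_rightInverse (M : ℕ) (hM : ∀ b, r b < M) (c : B → ℂ)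
    (hc : ∀ b, c b ≠ 0) (f : B → SDiffPoly p) (hf : ∀ b, f b ∈ parityPart p (p b))
    (htri : ∀ b, f b - c b • gen p b 0 ∈ lowSub p r (r b)) :
    ∃ (g : B → SDiffPoly p) (hg : ∀ b, g b ∈ parityPart p (p b)),
      (∀ b, g b - (c b)⁻¹ • gen p b 0 ∈ lowSub p r (r b)) ∧
      ∀ a, diffHom p p f hf (diffHom p p g hg a) = a := by
  have key : ∀ n, ∃ (g : B → SDiffPoly p) (_ : ∀ b, g b ∈ parityPart p (p b)),
      (∀ b, g b - (c b)⁻¹ • gen p b 0 ∈ lowSub p r (r b)) ∧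
      ∀ b, r b < n → diffHom p p f hf (g b) = gen p b 0 := by
    intro n
    induction n with
    | zero =>
      refine ⟨fun b => (c b)⁻¹ • gen p b 0, fun b => Submodule.smul_mem _ _ (gen_mem p b 0),
        fun b => ?_, fun b hb => absurd hb (Nat.not_lt_zero _)⟩
      rw [sub_self]; exact zero_mem _
    | succ n ih =>
      obtain ⟨g, hg, hgt, hgi⟩ := ih
      have hlow : ∀ k b, r b < k → g b ∈ lowSub p r k := by
        intro k b hb
        have h1 := lowSub_mono hb.le (hgt b)
        have h2 := add_mem h1 (Subalgebra.smul_mem _ (gen_mem_lowSub (p := p) 0 hb) (c b)⁻¹)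
        rwa [sub_add_cancel] at h2
      have hpar : ∀ b, f b - c b • gen p b 0 ∈ parityPart p (p b) := fun b =>
        sub_mem (hf b) (Submodule.smul_mem _ _ (gen_mem p b 0))
      -- Solve `f b = c b • gen p b 0 + lower` for the generator: the lower part involves only ranks
      -- on which the previous `g` is already a right inverse.
      refine ⟨fun b => (c b)⁻¹ • (gen p b 0 - diffHom p p g hg (f b - c b • gen p b 0)),
        fun b => Submodule.smul_mem _ _ (sub_mem (gen_mem p b 0) (diffHom_mem g hg (hpar b))),
        fun b => ?_, fun b hb => ?_⟩
      · have h1 := diffHom_mem_lowSub g hg (fun b' hb' => hlow (r b) b' hb') (htri b)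
        simp only [smul_sub, sub_sub_cancel_left]
        exact neg_mem (Subalgebra.smul_mem _ h1 _)
      · have h1 := lowSub_mono (Nat.lt_succ_iff.mp hb) (htri b)
        rw [map_smul, map_sub, diffHom_gen_zero, diffHom_comp_eq_self f g hf hg hgi h1,
          sub_sub_cancel, smul_smul, inv_mul_cancel₀ (hc b), one_smul]
  obtain ⟨g, hg, hgt, hgi⟩ := key M
  refine ⟨g, hg, hgt, fun a => ?_⟩
  have : (diffHom p p f hf).comp (diffHom p p g hg) = AlgHom.id ℂ _ := by
    apply algHom_ext
    intro b k
    rw [AlgHom.comp_apply, diffHom_gen, diffHom_D_pow, hgi b (hM b), D_pow_gen, AlgHom.id_apply]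
  exact DFunLike.congr_fun this a

/-- The right inverse is again triangular, so it has a right inverse of its own; hence both maps are
bijective. -/
theorem diffHom_bijective_of_triangular (M : ℕ) (hM : ∀ b, r b < M) (c : B → ℂ)
    (hc : ∀ b, c b ≠ 0) (f : B → SDiffPoly p) (hf : ∀ b, f b ∈ parityPart p (p b))
    (htri : ∀ b, f b - c b • gen p b 0 ∈ lowSub p r (r b)) :
    Function.Bijective (diffHom p p f hf) := by
  obtain ⟨g, hg, hgt, hfg⟩ := exists_triangular_rightInverse M hM c hc f hf htri
  obtain ⟨f', hf', -, hgf⟩ := exists_triangular_rightInverse M hM (fun b => (c b)⁻¹)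
    (fun b => inv_ne_zero (hc b)) g hg hgt
  refine ⟨fun a b hab => ?_, fun a => ⟨_, hfg a⟩⟩
  rw [← hgf a, ← hgf b, hfg, hfg] at hab
  rw [← hgf a, ← hgf b, hab]

end Triangular

/-! ### The Euler derivation of a set of generators -/

section Euler

variable {B : Type} (p : B → ZMod 2) (S : B → Prop) [DecidablePred S]

/-- The derivation which multiplies the generators `u_b^{(k)}` with `b ∈ S` by `1` and kills the
other generators. -/
def euler : SDiffPoly p →ₗ[ℂ] SDiffPoly p :=
  twDer p (AlgHom.id ℂ _) (AlgHom.id ℂ _) (fun b k => if S b then gen p b k else 0) (by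
    intro b k c l
    simp only [AlgHom.id_apply]
    split_ifs
    · rw [gen_comm p b c k l, smul_add]
    · rw [zero_mul, mul_zero, add_zero, zero_add, gen_comm p b c k l]
    · rw [zero_mul, mul_zero, add_zero, zero_add, gen_comm p b c k l]
    · simp)

theorem euler_gen (b : B) (k : ℕ) : euler p S (gen p b k) = if S b then gen p b k else 0 :=
  twDer_gen p _ _ _ _ b k

theorem euler_mul (a b : SDiffPoly p) : euler p S (a * b) = a * euler p S b + euler p S a * b :=
  twDer_mul p _ _ _ _ a b

/-- The homomorphism which kills the generators `u_b^{(k)}` with `b ∈ S`. -/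
def killHom : SDiffPoly p →ₐ[ℂ] SDiffPoly p :=
  lift p (fun b k => if S b then 0 else gen p b k) (by
    intro b k c l
    split_ifs
    · simp
    · simp
    · simp
    · exact gen_comm p b c k l)

theorem killHom_gen (b : B) (k : ℕ) : killHom p S (gen p b k) = if S b then 0 else gen p b k :=
  lift_gen p _ _ b k

/-- The homomorphism to `𝒱[t]` which multiplies the generators `u_b^{(k)}` with `b ∈ S` by `t`. -/
def scaleHom : SDiffPoly p →ₐ[ℂ] (SDiffPoly p)[X] :=
  lift p (fun b k => C (gen p b k) * if S b then X else 1) (by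
    intro b k c l
    have h : ∀ (b c : B) (k l : ℕ),
        (C (gen p b k) * if S b then X else 1) * (C (gen p c l) * if S c then X else 1) =
        C (gen p b k * gen p c l) * ((if S b then X else 1) * if S c then X else 1) := by
      intro b c k l
      rw [C_mul]
      split_ifs
      · rw [mul_assoc, mul_assoc, ← mul_assoc X, X_mul_C, mul_assoc]
      · simp only [mul_one]; rw [mul_assoc, mul_assoc, X_mul_C]
      · simp only [mul_one, one_mul, mul_assoc]
      · simp only [mul_one]
    rw [h, h, gen_comm p b c k l, ← smul_C, smul_mul_assoc]
    split_ifs <;> simp)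

theorem scaleHom_gen (b : B) (k : ℕ) :
    scaleHom p S (gen p b k) = C (gen p b k) * if S b then X else 1 :=
  lift_gen p _ _ b k

/-- The Euler derivation measures the degree in the generators from `S`, and this degree is the
exponent of `t` after scaling; so it becomes t d/dt. -/
theorem X_mul_derivative_scaleHom (a : SDiffPoly p) :
    X * derivative (scaleHom p S a) = scaleHom p S (euler p S a) := by
  have h1 : euler p S 1 = 0 := by
    have := euler_mul p S 1 1
    rw [mul_one, mul_one, one_mul] at this
    exact left_eq_add.mp this
  refine induction p (C := fun a => X * derivative (scaleHom p S a) = scaleHom p S (euler p S a))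
    ?_ ?_ ?_ ?_ a
  · intro r
    rw [AlgHom.commutes, Polynomial.algebraMap_apply, derivative_C, mul_zero,
      Algebra.algebraMap_eq_smul_one, (euler p S).map_smul, h1, smul_zero, map_zero]
  · intro b k
    rw [euler_gen, scaleHom_gen]
    split_ifs with h
    · rw [scaleHom_gen, if_pos h, derivative_C_mul, derivative_X, mul_one, X_mul_C]
    · simp
  · intro x y hx hy
    rw [map_mul, derivative_mul, euler_mul, map_add, map_mul, map_mul, ← hx, ← hy, mul_add,
      add_comm, ← mul_assoc, ← mul_assoc, ← mul_assoc, X_mul]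
  · intro x y hx hy; simp only [map_add, mul_add, hx, hy]

/-- Elements killed by the Euler derivation do not involve the corresponding generators. -/
theorem killHom_eq_of_euler_eq_zero {a : SDiffPoly p} (ha : euler p S a = 0) :
    killHom p S a = a := by
  have h0 : ∀ a, killHom p S a = (scaleHom p S a).eval 0 := by
    intro a
    refine induction p (C := fun a => killHom p S a = (scaleHom p S a).eval 0) ?_ ?_ ?_ ?_ a
    · intro r; rw [AlgHom.commutes, AlgHom.commutes, Polynomial.algebraMap_apply, eval_C]
    · intro b k; rw [killHom_gen, scaleHom_gen]; split_ifs <;> simp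
    · intro x y hx hy
      rw [map_mul, map_mul, hx, hy]
      -- Evaluation over a noncommutative ring is multiplicative only at central points; 0, and 1
      -- below, are central.
      exact (eval₂_mul_noncomm _ _ fun _ => Commute.zero_right _).symm
    · intro x y hx hy; simp only [map_add, eval_add, hx, hy]
  have h1 : ∀ a, a = (scaleHom p S a).eval 1 := by
    intro a
    refine induction p (C := fun a => a = (scaleHom p S a).eval 1) ?_ ?_ ?_ ?_ a
    · intro r; rw [AlgHom.commutes, Polynomial.algebraMap_apply, eval_C]
    · intro b k; rw [scaleHom_gen]; split_ifs <;> simp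
    · intro x y hx hy
      nth_rw 1 [hx, hy]
      rw [map_mul]
      exact (eval₂_mul_noncomm _ _ fun _ => Commute.one_right _).symm
    · intro x y hx hy; rw [map_add, eval_add, ← hx, ← hy]
  have h2 := X_mul_derivative_scaleHom p S a
  rw [ha, map_zero] at h2
  -- From t d/dt = 0 the scaled element is constant in `t`, as n + 1 is invertible in ℂ. Its values
  -- at 0 and at 1 therefore agree.
  have h3 : scaleHom p S a = C ((scaleHom p S a).coeff 0) := by
    ext n
    cases n with
    | zero => simp
    | succ n =>
      have h4 := congrArg (fun f => f.coeff (n + 1)) h2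
      simp only [coeff_X_mul, coeff_derivative, coeff_zero] at h4
      rw [coeff_C, if_neg (Nat.succ_ne_zero n)]
      have h5 : ((n : ℂ) + 1) • (scaleHom p S a).coeff (n + 1) = 0 := by
        rw [← h4, Algebra.smul_def, Algebra.commutes]
        simp
      exact (smul_eq_zero.mp h5).resolve_left (Nat.cast_add_one_ne_zero n)
  rw [h0]
  nth_rw 2 [h1 a]
  rw [h3, eval_C, eval_C]

end Euler

end SDiffPoly

/-! ### Pseudo-differential operators -/

namespace PsiDO

variable {B : Type} {p : B → ZMod 2}

theorem ext {A A' : PsiDO p} (h : ∀ n, A.coeff n = A'.coeff n) : A = A' := Subtype.ext (funext h)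

@[simp] theorem coeff_zero (n : ℤ) : (0 : PsiDO p).coeff n = 0 := rfl

@[simp] theorem coeff_add (A A' : PsiDO p) (n : ℤ) :
    (A + A').coeff n = A.coeff n + A'.coeff n := rfl

@[simp] theorem coeff_sub (A A' : PsiDO p) (n : ℤ) :
    (A - A').coeff n = A.coeff n - A'.coeff n := rfl

@[simp] theorem coeff_neg (A : PsiDO p) (n : ℤ) : (-A).coeff n = -A.coeff n := rfl

@[simp] theorem coeff_smul (r : ℂ) (A : PsiDO p) (n : ℤ) : (r • A).coeff n = r • A.coeff n := rfl

theorem coeff_sum {ι : Type} (s : Finset ι) (A : ι → PsiDO p) (n : ℤ) :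
    (∑ i ∈ s, A i).coeff n = ∑ i ∈ s, (A i).coeff n :=
  map_sum (⟨⟨fun A : PsiDO p => A.coeff n, rfl⟩, fun _ _ => rfl⟩ : PsiDO p →+ SDiffPoly p) A s

theorem coeff_monomial (k : ℤ) (a : SDiffPoly p) (n : ℤ) :
    (monomial p k a).coeff n = if n = k then a else 0 := Pi.single_apply k a n

theorem coeff_one (n : ℤ) : (1 : PsiDO p).coeff n = if n = 0 then 1 else 0 := coeff_monomial 0 1 n

@[simp] theorem coeff_map {B' : Type} {p' : B' → ZMod 2} (φ : SDiffPoly p →ₐ[ℂ] SDiffPoly p')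
    (A : PsiDO p) (n : ℤ) : (A.map φ).coeff n = φ (A.coeff n) := rfl

theorem finite_support_of_bdd {T : ℤ × ℕ → SDiffPoly p} {M M' n : ℤ}
    (h : ∀ x, T x ≠ 0 → x.1 ≤ M ∧ n - x.1 + x.2 ≤ M') : (Function.support T).Finite := by
  apply Set.Finite.subset (Set.Finite.prod (Set.finite_Icc (n - M') M)
    (Set.finite_Iic (M + M' - n).toNat))
  rintro ⟨m, k⟩ hx
  have := h _ hx
  simp only [Set.mem_prod, Set.mem_Icc, Set.mem_Iic] at this ⊢
  omega

theorem mulTerm_add_left (A A' C : PsiDO p) (n : ℤ) (x : ℤ × ℕ) :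
    mulTerm (A + A') C n x = mulTerm A C n x + mulTerm A' C n x := by
  simp only [mulTerm, coeff_add, add_mul, smul_add]

theorem mulTerm_add_right (A C C' : PsiDO p) (n : ℤ) (x : ℤ × ℕ) :
    mulTerm A (C + C') n x = mulTerm A C n x + mulTerm A C' n x := by
  simp only [mulTerm, coeff_add, map_add, mul_add, smul_add]

-- Associativity is left out on purpose: the cases that are used go through `LeftAssoc`.
scoped instance : NonUnitalNonAssocRing (PsiDO p) where
  left_distrib A C C' := by
    apply ext; intro n
    simp only [coeff_add, coeff_mul, mulTerm_add_right]
    exact finsum_add_distrib (mulTerm_support_finite _ _ _) (mulTerm_support_finite _ _ _)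
  right_distrib A A' C := by
    apply ext; intro n
    simp only [coeff_add, coeff_mul, mulTerm_add_left]
    exact finsum_add_distrib (mulTerm_support_finite _ _ _) (mulTerm_support_finite _ _ _)
  zero_mul A := by
    apply ext; intro n
    simp [coeff_mul, mulTerm]
  mul_zero A := by
    apply ext; intro n
    simp [coeff_mul, mulTerm]

theorem smul_mul (r : ℂ) (A C : PsiDO p) : (r • A) * C = r • (A * C) := by
  apply ext; intro n
  rw [coeff_smul, coeff_mul, coeff_mul, smul_finsum]
  refine finsum_congr fun x => ?_
  rw [mulTerm, mulTerm, coeff_smul, smul_mul_assoc, smul_comm]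

theorem mul_smul (r : ℂ) (A C : PsiDO p) : A * (r • C) = r • (A * C) := by
  apply ext; intro n
  rw [coeff_smul, coeff_mul, coeff_mul, smul_finsum]
  refine finsum_congr fun x => ?_
  rw [mulTerm, mulTerm, coeff_smul, map_smul, mul_smul_comm, smul_comm]

theorem coeff_monomial_zero_mul (a : SDiffPoly p) (A : PsiDO p) (n : ℤ) :
    (monomial p 0 a * A).coeff n = a * A.coeff n := by
  rw [coeff_mul, finsum_eq_single _ ((0 : ℤ), 0)]
  · simp [mulTerm, coeff_monomial]
  · rintro ⟨m, k⟩ h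
    by_cases hm : m = 0
    · subst hm
      have hk : 0 < k := by
        rcases Nat.eq_zero_or_pos k with rfl | h'
        · exact absurd rfl h
        · exact h'
      simp [mulTerm, Ring.choose_zero_pos ℤ hk]
    · simp [mulTerm, coeff_monomial, hm]

scoped instance : MulOneClass (PsiDO p) where
  one_mul A := by
    apply ext; intro n
    exact (coeff_monomial_zero_mul 1 A n).trans (one_mul _)
  mul_one A := by
    apply ext; intro n
    rw [coeff_mul, finsum_eq_single _ (n, 0)]
    · simp [mulTerm, coeff_one]
    · rintro ⟨m, k⟩ h
      rw [mulTerm, coeff_one]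
      split_ifs with h1
      · rcases Nat.eq_zero_or_pos k with rfl | hk
        · have hm : m = n := by simp only [Nat.cast_zero, add_zero] at h1; omega
          exact absurd (by rw [hm]) h
        · obtain ⟨j, rfl⟩ := Nat.exists_eq_succ_of_ne_zero hk.ne'
          have : (D p ^ (j + 1)) (1 : SDiffPoly p) = 0 := by
            rw [pow_succ, Module.End.mul_apply, ← map_one (algebraMap ℂ _), D_algebraMap, map_zero]
          simp [this]
      · simp

theorem map_mul {B' : Type} {p' : B' → ZMod 2} (φ : SDiffPoly p →ₐ[ℂ] SDiffPoly p')
    (hφ : ∀ a, φ (D p a) = D p' (φ a)) (A C : PsiDO p) :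
    (A * C).map φ = A.map φ * C.map φ := by
  have hφk : ∀ k a, φ ((D p ^ k) a) = (D p' ^ k) (φ a) := by
    intro k a
    induction k with
    | zero => rfl
    | succ k ih => rw [pow_succ', pow_succ', Module.End.mul_apply, Module.End.mul_apply, hφ, ih]
  apply ext; intro n
  rw [coeff_map, coeff_mul, coeff_mul]
  refine ((φ : SDiffPoly p →+ SDiffPoly p').map_finsum (mulTerm_support_finite A C n)).trans
    (finsum_congr fun x => ?_)
  simp only [mulTerm, coeff_map, AddMonoidHom.coe_coe]
  rw [map_zsmul, _root_.map_mul, hφk]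

/-! #### Orders -/

/-- The order of `A` is at most `M`. -/
def OrdLE (A : PsiDO p) (M : ℤ) : Prop := ∀ n, M < n → A.coeff n = 0

theorem OrdLE.mono {A : PsiDO p} {M M' : ℤ} (h : A.OrdLE M) (hM : M ≤ M') : A.OrdLE M' :=
  fun n hn => h n (hM.trans_lt hn)

theorem OrdLE.mul {A C : PsiDO p} {M M' : ℤ} (hA : A.OrdLE M) (hC : C.OrdLE M') :
    (A * C).OrdLE (M + M') := by
  intro n hn
  rw [coeff_mul]
  refine finsum_eq_zero_of_forall_eq_zero fun x => ?_
  by_cases h1 : M < x.1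
  · simp [mulTerm, hA _ h1]
  · simp [mulTerm, hC (n - x.1 + x.2) (by omega)]

/-- Each derivative falling on `C` lowers the order by one, so only the product of the two top terms
reaches the order M + M'. -/
theorem OrdLE.coeff_mul {A C : PsiDO p} {M M' : ℤ} (hA : A.OrdLE M) (hC : C.OrdLE M') :
    (A * C).coeff (M + M') = A.coeff M * C.coeff M' := by
  rw [PsiDO.coeff_mul, finsum_eq_single _ (M, 0)]
  · simp [mulTerm]
  · rintro ⟨m, k⟩ h
    by_cases h1 : M < m
    · simp [mulTerm, hA _ h1]
    · by_cases h2 : m = M ∧ k = 0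
      · exact absurd (Prod.ext h2.1 h2.2) h
      · simp only [mulTerm]
        rw [hC _ (by omega), map_zero, mul_zero, smul_zero]

/-! #### The operator `∂` and the left nucleus -/

variable (p) in
/-- The operator `∂`. -/
def partialOp : PsiDO p := monomial p 1 1

theorem coeff_partialOp_mul (A : PsiDO p) (n : ℤ) :
    (partialOp p * A).coeff n = A.coeff (n - 1) + D p (A.coeff n) := by
  rw [coeff_mul, finsum_eq_finsetSum_of_support_subset (s := {((1 : ℤ), 0), ((1 : ℤ), 1)})]
  · rw [Finset.sum_pair (by simp)]
    simp [mulTerm, partialOp, coeff_monomial]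
  · rintro ⟨m, k⟩ h
    by_cases hm : m = 1
    · subst hm
      by_cases hk : k = 0
      · simp [hk]
      · by_cases hk1 : k = 1
        · simp [hk1]
        · exfalso
          apply h
          have : Ring.choose (1 : ℤ) k = 0 := by
            have := Ring.choose_natCast (R := ℤ) 1 k
            rw [Nat.cast_one] at this
            rw [this, Nat.choose_eq_zero_of_lt (by omega), Nat.cast_zero]
          simp [mulTerm, this]
    · exact absurd (by simp [mulTerm, partialOp, coeff_monomial, hm]) h

/-- Left multiplication by `A` is compatible with products. -/
def LeftAssoc (A : PsiDO p) : Prop := ∀ C E : PsiDO p, A * C * E = A * (C * E)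

theorem LeftAssoc.add {A A' : PsiDO p} (h : LeftAssoc A) (h' : LeftAssoc A') :
    LeftAssoc (A + A') := by
  intro C E; rw [add_mul, add_mul, add_mul, h, h']

theorem LeftAssoc.mul {A A' : PsiDO p} (h : LeftAssoc A) (h' : LeftAssoc A') :
    LeftAssoc (A * A') := by
  intro C E; rw [h, h, h', h]

theorem leftAssoc_zero : LeftAssoc (0 : PsiDO p) := by intro C E; simp only [zero_mul]

theorem leftAssoc_one : LeftAssoc (1 : PsiDO p) := by intro C E; simp only [one_mul]

theorem leftAssoc_monomial_zero (a : SDiffPoly p) : LeftAssoc (monomial p 0 a) := by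
  intro C E
  apply ext; intro n
  rw [coeff_monomial_zero_mul, coeff_mul, coeff_mul,
    ← AddMonoidHom.coe_mulLeft a, (AddMonoidHom.mulLeft a).map_finsum (mulTerm_support_finite _ _ _)]
  refine finsum_congr fun x => ?_
  simp only [mulTerm, coeff_monomial_zero_mul, AddMonoidHom.coe_mulLeft, mul_smul_comm, mul_assoc]

/-- Pascal's rule for binom(m+1, k), summed over m and k; the last sum is reindexed by k ↦ k + 1.
The bounds only ensure finite supports. -/
theorem finsum_pascal (F : ℤ × ℕ → SDiffPoly p) {M M' n : ℤ}
    (hF : ∀ x, F x ≠ 0 → x.1 ≤ M ∧ n - x.1 + x.2 ≤ M') :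
    ∑ᶠ x : ℤ × ℕ, Ring.choose (x.1 + 1) x.2 • F x =
      ∑ᶠ x : ℤ × ℕ, Ring.choose x.1 x.2 • F x +
        ∑ᶠ x : ℤ × ℕ, Ring.choose x.1 x.2 • F (x.1, x.2 + 1) := by
  let G : ℤ × ℕ → SDiffPoly p := fun x =>
    if x.2 = 0 then 0 else Ring.choose x.1 (x.2 - 1) • F x
  let g : ℤ × ℕ → ℤ × ℕ := fun x => (x.1, x.2 + 1)
  have hg : Function.Injective g := by
    rintro ⟨a, b⟩ ⟨c, d⟩ h
    simpa [g] using h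
  have h1 : ∑ᶠ x : ℤ × ℕ, Ring.choose x.1 x.2 • F (x.1, x.2 + 1) = ∑ᶠ x, G x := by
    have h2 := finsum_mem_range (f := G) hg
    rw [finsum_mem_def, Set.indicator_eq_self.mpr] at h2
    · rw [h2]; rfl
    · rintro ⟨m, k⟩ hx
      have hk : k ≠ 0 := by rintro rfl; exact hx rfl
      exact ⟨(m, k - 1), Prod.ext rfl (Nat.sub_add_cancel (Nat.pos_of_ne_zero hk))⟩
  rw [h1, ← finsum_add_distrib]
  · refine finsum_congr ?_
    rintro ⟨m, k⟩
    cases k with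
    | zero => simp [G]
    | succ k => simp [G, Ring.choose_succ_succ, add_smul, add_comm]
  · exact finite_support_of_bdd (n := n) fun x hx => hF x fun h => hx (by rw [h, smul_zero])
  · refine finite_support_of_bdd (n := n) fun x hx => hF x fun h => hx ?_
    simp [G, h]

/-- On both sides the terms in which ∂ differentiates a coefficient of `C` form the same sum `H`. In
the remaining terms ∂ either raises the exponent of `C` or differentiates a coefficient of `E`, and
they agree by `finsum_pascal`. -/
theorem leftAssoc_partialOp : LeftAssoc (partialOp p) := by
  intro C E
  obtain ⟨M, hM⟩ := C.bdd
  obtain ⟨M', hM'⟩ := E.bdd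
  apply ext; intro n
  let F : ℤ × ℕ → SDiffPoly p := fun x => C.coeff x.1 * (D p ^ x.2) (E.coeff (n - 1 - x.1 + x.2))
  let H : ℤ × ℕ → SDiffPoly p := fun x =>
    Ring.choose x.1 x.2 • (D p (C.coeff x.1) * (D p ^ x.2) (E.coeff (n - x.1 + x.2)))
  have hF : ∀ x, F x ≠ 0 → x.1 ≤ M ∧ n - 1 - x.1 + x.2 ≤ M' := by
    intro x hx
    constructor
    · by_contra h; exact hx (by simp [F, hM _ (lt_of_not_ge h)])
    · by_contra h; exact hx (by simp [F, hM' _ (lt_of_not_ge h)])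
  have hH : (Function.support H).Finite := by
    refine finite_support_of_bdd (M := M) (M' := M') (n := n) fun x hx => ⟨?_, ?_⟩
    · by_contra h; exact hx (by simp [H, hM _ (lt_of_not_ge h)])
    · by_contra h; exact hx (by simp [H, hM' _ (lt_of_not_ge h)])
  have e0 : ∑ᶠ x : ℤ × ℕ, Ring.choose x.1 x.2 •
        (C.coeff (x.1 - 1) * (D p ^ x.2) (E.coeff (n - x.1 + x.2))) =
      ∑ᶠ x : ℤ × ℕ, Ring.choose (x.1 + 1) x.2 • F x := by
    refine (finsum_eq_of_bijective (fun x : ℤ × ℕ => (x.1 + 1, x.2)) ?_ ?_).symm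
    · exact ((Equiv.addRight (1 : ℤ)).prodCongr (Equiv.refl ℕ)).bijective
    · rintro ⟨m, k⟩
      have : n - 1 - m + k = n - (m + 1) + k := by ring
      simp only [F, this, add_sub_cancel_right]
  have e1 : (partialOp p * C * E).coeff n =
      ∑ᶠ x : ℤ × ℕ, Ring.choose (x.1 + 1) x.2 • F x + ∑ᶠ x, H x := by
    rw [← e0, coeff_mul, ← finsum_add_distrib _ hH]
    · refine finsum_congr fun x => ?_
      simp only [mulTerm, coeff_partialOp_mul, add_mul, smul_add, H]
    · refine finite_support_of_bdd (M := M + 1) (M' := M') (n := n) fun x hx => ⟨?_, ?_⟩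
      · by_contra h; exact hx (by simp [hM (x.1 - 1) (by omega)])
      · by_contra h; exact hx (by simp [hM' _ (lt_of_not_ge h)])
  have e2 : D p ((C * E).coeff n) =
      ∑ᶠ x : ℤ × ℕ, Ring.choose x.1 x.2 • F (x.1, x.2 + 1) + ∑ᶠ x, H x := by
    rw [coeff_mul, ← LinearMap.toAddMonoidHom_coe,
      (D p).toAddMonoidHom.map_finsum (mulTerm_support_finite _ _ _), ← finsum_add_distrib _ hH]
    · refine finsum_congr fun x => ?_
      have : n - 1 - x.1 + ((x.2 + 1 : ℕ) : ℤ) = n - x.1 + x.2 := by push_cast; ring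
      simp only [mulTerm, H, F, this, LinearMap.toAddMonoidHom_coe, map_zsmul, D_mul, smul_add,
        pow_succ', Module.End.mul_apply]
    · refine finite_support_of_bdd (M := M) (M' := M') (n := n) fun x hx => ?_
      have := hF (x.1, x.2 + 1) fun h => hx (by rw [h, smul_zero])
      refine ⟨this.1, le_trans (le_of_eq ?_) this.2⟩
      push_cast; ring
  rw [e1, finsum_pascal F hF, coeff_partialOp_mul, e2, coeff_mul, add_assoc]
  rfl

/-! #### Differential operators -/

variable (p) in
/-- The differential operator with symbol `f`. -/
def ofSymbol : (SDiffPoly p)[X] →ₗ[ℂ] PsiDO p where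
  toFun f := ⟨fun n => if 0 ≤ n then f.coeff n.toNat else 0, f.natDegree, fun n hn => by
    beta_reduce
    split_ifs with h
    · exact coeff_eq_zero_of_natDegree_lt (by omega)
    · rfl⟩
  map_add' f g := by
    apply ext; intro n
    change (if 0 ≤ n then (f + g).coeff n.toNat else 0) =
      (if 0 ≤ n then f.coeff n.toNat else 0) + if 0 ≤ n then g.coeff n.toNat else 0
    split_ifs <;> simp
  map_smul' r f := by
    apply ext; intro n
    change (if 0 ≤ n then (r • f).coeff n.toNat else 0) =
      r • if 0 ≤ n then f.coeff n.toNat else 0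
    split_ifs <;> simp

theorem coeff_ofSymbol (f : (SDiffPoly p)[X]) (n : ℤ) :
    (ofSymbol p f).coeff n = if 0 ≤ n then f.coeff n.toNat else 0 := rfl

theorem coeff_ofSymbol_natCast (f : (SDiffPoly p)[X]) (n : ℕ) :
    (ofSymbol p f).coeff n = f.coeff n := by
  rw [coeff_ofSymbol, if_pos (Int.natCast_nonneg n), Int.toNat_natCast]

theorem ofSymbol_one : ofSymbol p 1 = 1 := by
  apply ext; intro n
  rw [coeff_ofSymbol, coeff_one, Polynomial.coeff_one]
  split_ifs <;> first | rfl | omega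

theorem ofSymbol_C_mul (a : SDiffPoly p) (f : (SDiffPoly p)[X]) :
    ofSymbol p (C a * f) = monomial p 0 a * ofSymbol p f := by
  apply ext; intro n
  rw [coeff_monomial_zero_mul, coeff_ofSymbol, coeff_ofSymbol, coeff_C_mul]
  split_ifs <;> simp

theorem ofSymbol_lamD (f : (SDiffPoly p)[X]) :
    ofSymbol p (lamD p f) = partialOp p * ofSymbol p f := by
  apply ext; intro n
  rw [coeff_partialOp_mul, coeff_ofSymbol, coeff_ofSymbol, coeff_ofSymbol, lamD_apply,
    Polynomial.coeff_add, coeff_DPoly]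
  rcases lt_trichotomy n 0 with h | h | h
  · rw [if_neg (by omega), if_neg (by omega), if_neg (by omega), map_zero, add_zero]
  · subst h; simp
  · obtain ⟨k, rfl⟩ := Int.eq_succ_of_zero_lt h
    rw [if_pos (by omega), if_pos (by omega), if_pos (by omega)]
    have e1 : ((k : ℤ) + 1).toNat = k + 1 := by omega
    have e2 : ((k : ℤ) + 1 - 1).toNat = k := by omega
    rw [e1, e2, coeff_X_mul]

/-- Left-associating operators are closed under sums and products, and differential operators are
generated by ∂ and the multiplication operators. -/
theorem leftAssoc_ofSymbol (f : (SDiffPoly p)[X]) : LeftAssoc (ofSymbol p f) := by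
  induction f using Polynomial.induction_on' with
  | add f g hf hg => rw [map_add]; exact hf.add hg
  | monomial n a =>
    rw [← C_mul_X_pow_eq_monomial, ofSymbol_C_mul]
    refine (leftAssoc_monomial_zero a).mul ?_
    induction n with
    | zero => rw [pow_zero, ofSymbol_one]; exact leftAssoc_one
    | succ n ih =>
      have : (X ^ (n + 1) : (SDiffPoly p)[X]) = lamD p (X ^ n) := by
        have h0 : DPoly p (X ^ n) = 0 := by
          ext k
          rw [coeff_DPoly, coeff_X_pow]
          split_ifs
          · rw [← map_one (algebraMap ℂ _), D_algebraMap]; rfl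
          · simp
        rw [lamD_apply, h0, add_zero, pow_succ']
      rw [this, ofSymbol_lamD]
      exact leftAssoc_partialOp.mul ih

end PsiDO

/-! ### The coefficients of `ρ(A(∂))` -/

section Coefficients

variable (N m n : ℕ)

theorem form_fNil_single (x y : Idx N m n) :
    form (par N m n) (fNil N m n) (Matrix.single x y 1) =
      if y.1.val = x.1.val + 1 ∧ y.2 = x.2 then eps (par N m n y) else 0 := by
  unfold form str
  rw [Finset.sum_eq_single y]
  · simp [fNil]
  · intro z _ hz; rw [Matrix.mul_single_apply_of_ne _ _ _ _ _ hz, mul_zero]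
  · simp

/-- The matrix `ρ(A(0))`, so that `ρ(A(∂)) = ∂ + ρ(A(0))`. -/
def rhoCoeff (x y : Idx N m n) : VP N m n := eps (par N m n x) • rhoUnit N m n (x, y)

variable {N m n}

theorem rhoCoeff_mem (x y : Idx N m n) :
    rhoCoeff N m n x y ∈ parityPart (pPar N m n) (par N m n x + par N m n y) :=
  Submodule.smul_mem _ _ (rhoUnit_mem N m n (x, y))

/-- The basis vector `e_{xy}` of `𝔭`. -/
def pIdx (x y : Idx N m n) (h : deg x y < 1) : PIdx N m n := ⟨(x, y), h⟩

theorem rhoUnit_of_le {x y : Idx N m n} (h : deg x y < 1) :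
    rhoUnit N m n (x, y) = gen (pPar N m n) (pIdx x y h) 0 := by
  have h1 : ¬(y.1.val = x.1.val + 1 ∧ y.2 = x.2) := by
    rintro ⟨h1, -⟩
    simp only [deg] at h
    omega
  rw [rhoUnit, dif_pos h, form_fNil_single, if_neg h1, map_zero, add_zero]
  rfl

theorem rhoCoeff_of_le {x y : Idx N m n} (h : deg x y < 1) :
    rhoCoeff N m n x y = eps (par N m n x) • gen (pPar N m n) (pIdx x y h) 0 := by
  rw [rhoCoeff, rhoUnit_of_le h]

/-- The sign in the definition of A(∂) cancels the supertrace sign in (f|e_{xy}); this is the source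
of the identity blocks above the diagonal. -/
theorem rhoCoeff_of_eq_succ {x y : Idx N m n} (h : y.1.val = x.1.val + 1) :
    rhoCoeff N m n x y = if x.2 = y.2 then 1 else 0 := by
  have h1 : ¬ deg x y < 1 := by simp only [deg]; omega
  rw [rhoCoeff, rhoUnit, dif_neg h1, form_fNil_single, zero_add]
  by_cases h2 : x.2 = y.2
  · rw [if_pos ⟨h, h2.symm⟩, if_pos h2, Algebra.smul_def, ← map_mul, par, par, h2,
      eps_mul_self, map_one]
  · rw [if_neg fun h3 => h2 h3.2.symm, if_neg h2, map_zero, smul_zero]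

theorem rhoCoeff_of_lt {x y : Idx N m n} (h : x.1.val + 1 < y.1.val) :
    rhoCoeff N m n x y = 0 := by
  have h1 : ¬ deg x y < 1 := by simp only [deg]; omega
  rw [rhoCoeff, rhoUnit, dif_neg h1, form_fNil_single, if_neg (by simp only; omega), map_zero,
    zero_add, smul_zero]

theorem rhoA_apply (x y : Idx N m n) :
    rhoA N m n x y = (if x = y then PsiDO.partialOp _ else 0) +
      PsiDO.monomial _ 0 (rhoCoeff N m n x y) := by
  apply PsiDO.ext
  intro k
  have h : rho N m n (gen (glParity (par N m n)) (x, y) 0) = rhoUnit N m n (x, y) := by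
    rw [rho, lift_gen]; rfl
  simp only [rhoA, affineOp, Matrix.map_apply, PsiDO.coeff_map, PsiDO.coeff_add,
    PsiDO.coeff_monomial, map_add]
  congr 1
  · split_ifs with h1
    · simp only [PsiDO.partialOp, PsiDO.coeff_monomial]
      split_ifs <;> simp
    · simp
  · split_ifs with h1
    · rw [map_smul, h, rhoCoeff]
    · rw [map_zero]

variable (N m n) in
/-- The entries of `ρ(A(0))`, with the blocks numbered by arbitrary natural numbers. -/
def blockCoeff (u : ℕ) (i : Fin m ⊕ Fin n) (v : ℕ) (j : Fin m ⊕ Fin n) : VP N m n :=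
  if h : u < N ∧ v < N then rhoCoeff N m n (⟨u, h.1⟩, i) (⟨v, h.2⟩, j) else 0

theorem blockCoeff_mem (u : ℕ) (i : Fin m ⊕ Fin n) (v : ℕ) (j : Fin m ⊕ Fin n) :
    blockCoeff N m n u i v j ∈ parityPart (pPar N m n) (inPar m n i + inPar m n j) := by
  rw [blockCoeff]
  split_ifs with h
  · exact rhoCoeff_mem (N := N) (⟨u, h.1⟩, i) (⟨v, h.2⟩, j)
  · exact zero_mem _

theorem rhoCoeff_eq_blockCoeff (x y : Idx N m n) :
    rhoCoeff N m n x y = blockCoeff N m n x.1 x.2 y.1 y.2 := by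
  rw [blockCoeff, dif_pos ⟨x.1.isLt, y.1.isLt⟩]

end Coefficients

/-! ### The solution of the block triangular system -/

section Symbols

variable (N m n : ℕ)

/-- The symbols `Y_u` of the differential operators with `Y_0 = 1` that solve the linear system
`(ρ(A(∂)) Y)_u = 0` for all blocks `u` but the last, extended by one step. -/
def symb : ℕ → Fin m ⊕ Fin n → Fin m ⊕ Fin n → (VP N m n)[X]
  | 0, i, c => if i = c then 1 else 0
  | u + 1, i, c => -(lamD (pPar N m n) (symb u i c) +
      ∑ v : Fin (u + 1), ∑ j, C (blockCoeff N m n u i v j) * symb v j c)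

variable {N m n}

theorem symb_zero (i c : Fin m ⊕ Fin n) : symb N m n 0 i c = if i = c then 1 else 0 := by
  rw [symb]

theorem symb_succ (u : ℕ) (i c : Fin m ⊕ Fin n) :
    symb N m n (u + 1) i c = -(lamD (pPar N m n) (symb N m n u i c) +
      ∑ v ∈ Finset.range (u + 1), ∑ j, C (blockCoeff N m n u i v j) * symb N m n v j c) := by
  rw [symb, ← Fin.sum_univ_eq_sum_range
    (fun v => ∑ j, C (blockCoeff N m n u i v j) * symb N m n v j c)]

theorem PolyParity.C_mul {B : Type} {p : B → ZMod 2} {a : SDiffPoly p} {f : (SDiffPoly p)[X]}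
    {i j : ZMod 2} (ha : a ∈ parityPart p i) (hf : PolyParity p j f) :
    PolyParity p (i + j) (C a * f) := by
  intro k
  rw [coeff_C_mul]
  exact mul_mem_parityPart p ha (hf k)

theorem PolyParity.neg {B : Type} {p : B → ZMod 2} {f : (SDiffPoly p)[X]} {i : ZMod 2}
    (hf : PolyParity p i f) : PolyParity p i (-f) := by
  intro k; rw [coeff_neg]; exact neg_mem (hf k)

theorem PolyParity.add {B : Type} {p : B → ZMod 2} {f g : (SDiffPoly p)[X]} {i : ZMod 2}
    (hf : PolyParity p i f) (hg : PolyParity p i g) : PolyParity p i (f + g) := by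
  intro k; rw [coeff_add]; exact add_mem (hf k) (hg k)

theorem PolyParity.sum {B ι : Type} {p : B → ZMod 2} {s : Finset ι} {f : ι → (SDiffPoly p)[X]}
    {i : ZMod 2} (hf : ∀ x ∈ s, PolyParity p i (f x)) : PolyParity p i (∑ x ∈ s, f x) := by
  intro k; rw [finsetSum_coeff]; exact sum_mem fun x hx => hf x hx k

theorem symb_parity (u : ℕ) (i c : Fin m ⊕ Fin n) :
    PolyParity (pPar N m n) (inPar m n i + inPar m n c) (symb N m n u i c) := by
  induction u using Nat.strong_induction_on generalizing i with
  | _ u ih =>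
    cases u with
    | zero =>
      rw [symb_zero]
      intro k
      split_ifs with h
      · rw [h, CharTwo.add_self_eq_zero, coeff_one]
        split_ifs
        · exact one_mem_parityPart _
        · exact zero_mem _
      · exact zero_mem _
    | succ u =>
      rw [symb_succ]
      refine PolyParity.neg (PolyParity.add (lamD_parity _ (ih u u.lt_succ_self i))
        (PolyParity.sum fun v hv => PolyParity.sum fun j _ => ?_))
      have h := PolyParity.C_mul (blockCoeff_mem (N := N) u i v j)
        (ih v (Finset.mem_range.mp hv) j)
      have e : ∀ a b c : ZMod 2, a + b + (b + c) = a + c := by decide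
      rwa [e] at h

theorem coeff_lamD {B : Type} (p : B → ZMod 2) (f : (SDiffPoly p)[X]) (k : ℕ) :
    (lamD p f).coeff k = (X * f).coeff k + D p (f.coeff k) := by
  rw [lamD_apply, coeff_add, coeff_DPoly]

theorem coeff_symb_of_lt {u k : ℕ} (h : u < k) (i c : Fin m ⊕ Fin n) :
    (symb N m n u i c).coeff k = 0 := by
  induction u using Nat.strong_induction_on generalizing i k with
  | _ u ih =>
    cases u with
    | zero =>
      rw [symb_zero]
      split_ifs
      · rw [coeff_one, if_neg h.ne']
      · exact coeff_zero k
    | succ u =>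
      obtain ⟨k, rfl⟩ := Nat.exists_eq_succ_of_ne_zero (Nat.ne_zero_of_lt h)
      rw [symb_succ, coeff_neg, coeff_add, coeff_lamD, finsetSum_coeff, coeff_X_mul,
        ih u u.lt_succ_self (by omega), ih u u.lt_succ_self (by omega), map_zero, zero_add,
        zero_add, Finset.sum_eq_zero, neg_zero]
      intro v hv
      rw [finsetSum_coeff]
      refine Finset.sum_eq_zero fun j _ => ?_
      rw [Finset.mem_range] at hv
      rw [coeff_C_mul, ih v hv (by omega), mul_zero]

theorem coeff_symb_self (u : ℕ) (i c : Fin m ⊕ Fin n) :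
    (symb N m n u i c).coeff u = if i = c then (-1) ^ u else 0 := by
  induction u with
  | zero => rw [symb_zero]; split_ifs <;> simp
  | succ u ih =>
    rw [symb_succ, coeff_neg, coeff_add, coeff_lamD, finsetSum_coeff, coeff_X_mul, ih,
      coeff_symb_of_lt u.lt_succ_self, map_zero, add_zero, Finset.sum_eq_zero, add_zero]
    · split_ifs
      · rw [pow_succ, mul_neg_one]
      · rw [neg_zero]
    · intro v hv
      rw [finsetSum_coeff]
      refine Finset.sum_eq_zero fun j _ => ?_
      rw [Finset.mem_range] at hv
      rw [coeff_C_mul, coeff_symb_of_lt hv, mul_zero]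

theorem sum_idx {M : Type} [AddCommMonoid M] (g : ℕ → Fin m ⊕ Fin n → M) :
    ∑ y : Idx N m n, g y.1 y.2 = ∑ v ∈ Finset.range N, ∑ j, g v j := by
  rw [Fintype.sum_prod_type, ← Fin.sum_univ_eq_sum_range (fun v => ∑ j, g v j)]

/-- The identity block in column u + 1 contributes exactly Y_{u+1}, which cancels the rest of row u
by the recursion. The last row has no such block, so -Y_N is left over. -/
theorem symb_row (x : Idx N m n) (c : Fin m ⊕ Fin n) :
    lamD (pPar N m n) (symb N m n x.1 x.2 c) +
      ∑ y : Idx N m n, C (rhoCoeff N m n x y) * symb N m n y.1 y.2 c =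
      if x.1.val + 1 < N then 0 else -symb N m n (x.1 + 1) x.2 c := by
  obtain ⟨⟨u, hu⟩, i⟩ := x
  simp only [rhoCoeff_eq_blockCoeff]
  rw [sum_idx fun v j => C (blockCoeff N m n u i v j) * symb N m n v j c]
  split_ifs with h
  · have h1 : Finset.range (u + 2) ⊆ Finset.range N := Finset.range_mono h
    rw [← Finset.sum_subset h1, Finset.sum_range_succ, ← add_assoc, ← neg_neg
      (lamD (pPar N m n) (symb N m n u i c) + _), ← symb_succ, Finset.sum_eq_single i]
    · rw [blockCoeff, dif_pos ⟨hu, h⟩, rhoCoeff_of_eq_succ rfl, if_pos rfl, C_1, one_mul,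
        neg_add_cancel]
    · intro j _ hj
      rw [blockCoeff, dif_pos ⟨hu, h⟩, rhoCoeff_of_eq_succ rfl, if_neg hj.symm, C_0, zero_mul]
    · simp
    · intro v hv hv'
      rw [Finset.mem_range] at hv hv'
      refine Finset.sum_eq_zero fun j _ => ?_
      rw [blockCoeff, dif_pos ⟨hu, hv⟩, rhoCoeff_of_lt (show u + 1 < v by omega), C_0, zero_mul]
  · obtain rfl : N = u + 1 := by omega
    rw [symb_succ, neg_neg]

end Symbols

/-! ### Inverses for the `⋆`-product -/

section StarProduct

open scoped PsiDO

theorem tw_zero {B : Type} {p : B → ZMod 2} (a : SDiffPoly p) : tw p 0 a = a := by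
  have : tw p 0 = AlgHom.id ℂ _ := algHom_ext p fun b k => by simp [eps_zero]
  rw [this, AlgHom.id_apply]

theorem starMul_one {B : Type} {p : B → ZMod 2} {J K : Type} [Fintype K] [DecidableEq K]
    (pJ : J → ZMod 2) (pK : K → ZMod 2) (A : Matrix J K (PsiDO p)) :
    starMul pJ pK pK A (fun i j => if i = j then 1 else 0) = A := by
  funext i l
  unfold starMul
  beta_reduce
  rw [Finset.sum_eq_single l]
  · rw [CharTwo.add_self_eq_zero, mul_zero, eps_zero, one_smul, if_pos rfl, mul_one]
    exact PsiDO.ext fun n => tw_zero _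
  · intro k _ hk
    rw [if_neg hk, mul_zero, smul_zero]
  · simp

variable {B : Type} {p : B → ZMod 2} {J K L M : Type} [Fintype J] [Fintype K] [Fintype L]
  [Fintype M] [DecidableEq J]
  (pJ : J → ZMod 2) (pK : K → ZMod 2) (pL : L → ZMod 2) (pM : M → ZMod 2)

theorem one_starMul (A : Matrix J K (PsiDO p)) :
    starMul pJ pJ pK (fun i j => if i = j then 1 else 0) A = A := by
  have h : IsEvenMat (p := p) pJ pJ (fun i j => if i = j then 1 else 0) := by
    intro i k n
    beta_reduce
    split_ifs with h
    · rw [h, CharTwo.add_self_eq_zero, PsiDO.coeff_one]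
      split_ifs
      · exact one_mem_parityPart p
      · exact zero_mem _
    · exact zero_mem _
  rw [starMul_of_even pJ pJ pK h]
  funext i l
  simp

variable {pJ pK pL} in
theorem starMul_apply_of_even [DecidableEq K] {A : Matrix J K (PsiDO p)} (hA : IsEvenMat pJ pK A)
    (C : Matrix K L (PsiDO p)) (i : J) (l : L) :
    starMul pJ pK pL A C i l = A.mulVec (fun k => C k l) i := by
  rw [starMul_of_even pJ pK pL hA]; rfl

/-- Evenness of `A` turns the parity twist of a product `A i j * C j k` into a sign times the twist
of the second factor; the signs then match by an identity in ℤ/2, and associativity is needed only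
with entries of `A` on the left. -/
theorem starMul_assoc_of_even [DecidableEq K] {A : Matrix J K (PsiDO p)} (hA : IsEvenMat pJ pK A)
    (hA' : ∀ i k, PsiDO.LeftAssoc (A i k)) (C : Matrix K L (PsiDO p)) (E : Matrix L M (PsiDO p)) :
    starMul pJ pL pM (starMul pJ pK pL A C) E = starMul pJ pK pM A (starMul pK pL pM C E) := by
  rw [starMul_of_even pJ pK pL hA, starMul_of_even pJ pK pM hA]
  funext i l
  have hmap : ∀ (c : ZMod 2) (i : J) (k : K), (A i k).map (tw p c) =
      eps (c * (pJ i + pK k)) • A i k := by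
    intro c i k
    exact PsiDO.ext fun n => hA i k n c
  have hsum : ∀ (c : ZMod 2) (k : L), (∑ j, A i j * C j k).map (tw p c) =
      ∑ j, eps (c * (pJ i + pK j)) • (A i j * (C j k).map (tw p c)) := by
    intro c k
    have : (∑ j, A i j * C j k).map (tw p c) = ∑ j, (A i j * C j k).map (tw p c) := by
      apply PsiDO.ext; intro n
      simp only [PsiDO.coeff_map, PsiDO.coeff_sum, map_sum]
    rw [this]
    refine Finset.sum_congr rfl fun j _ => ?_
    rw [PsiDO.map_mul _ fun a => (D_tw p c a).symm, hmap, PsiDO.smul_mul]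
  simp only [starMul, hsum, Finset.sum_mul, Finset.mul_sum, Finset.smul_sum]
  rw [Finset.sum_comm]
  refine Finset.sum_congr rfl fun j _ => Finset.sum_congr rfl fun k _ => ?_
  rw [PsiDO.smul_mul, PsiDO.mul_smul, hA', smul_smul, ← eps_add]
  congr 2
  have : ∀ a b c d : ZMod 2, (a + c) * (c + d) + (c + d) * (a + b) = (b + c) * (c + d) := by decide
  exact this _ _ _ _

variable {pJ}

theorem eq_of_starMul_eq {A : Matrix J J (PsiDO p)} (hA : IsEvenMat pJ pJ A)
    (hinj : Function.Injective A.mulVec) {C C' : Matrix J K (PsiDO p)}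
    (h : starMul pJ pJ pK A C = starMul pJ pJ pK A C') : C = C' := by
  ext i k
  refine congrFun (hinj (a₁ := fun i => C i k) (a₂ := fun i => C' i k) (funext fun j => ?_)) i
  rw [← starMul_apply_of_even (pL := pK) hA, ← starMul_apply_of_even (pL := pK) hA, h]

/-- An even matrix of differential operators which acts bijectively on columns is invertible. -/
theorem exists_isStarInv {A : Matrix J J (PsiDO p)} (hA : IsEvenMat pJ pJ A)
    (hA' : ∀ i k, PsiDO.LeftAssoc (A i k)) (hbij : Function.Bijective A.mulVec) :
    ∃ C, IsStarInv pJ pJ A C := by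
  obtain ⟨C, hC⟩ : ∃ C : Matrix J J (PsiDO p), ∀ l,
      A.mulVec (fun i => C i l) = fun i => if i = l then 1 else 0 := by
    choose C hC using fun l : J => hbij.2 (fun i => if i = l then 1 else 0)
    exact ⟨fun i l => C l i, hC⟩
  have h1 : starMul pJ pJ pJ A C = fun i j => if i = j then 1 else 0 := by
    funext i l
    rw [starMul_apply_of_even hA, hC]
  refine ⟨C, h1, ?_⟩
  -- A right inverse is also a left inverse: A(CA) = (AC)A = A = A·1, and `A` can be cancelled on
  -- the left.
  apply eq_of_starMul_eq pJ hA hbij.1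
  rw [← starMul_assoc_of_even pJ pJ pJ pJ hA hA', h1, one_starMul, starMul_one]

end StarProduct

/-! ### Operators with invertible constant leading coefficient -/

section Monic

open scoped PsiDO

variable {B : Type} {p : B → ZMod 2} {J : Type} [Fintype J]

theorem exists_ordLE (V : J → PsiDO p) : ∃ M : ℤ, ∀ i, (V i).OrdLE M := by
  choose M hM using fun i => (V i).bdd
  obtain ⟨M', hM'⟩ := (Set.finite_range M).bddAbove
  exact ⟨M', fun i => PsiDO.OrdLE.mono (hM i) (hM' ⟨i, rfl⟩)⟩

variable {A : Matrix J J (PsiDO p)} {N : ℤ} {c : ℂ}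

theorem ordLE_mulVec (hA : ∀ i j, (A i j).OrdLE N) {V : J → PsiDO p} {M : ℤ}
    (hV : ∀ i, (V i).OrdLE M) (i : J) : (A.mulVec V i).OrdLE (N + M) := by
  intro n hn
  rw [Matrix.mulVec, dotProduct, PsiDO.coeff_sum]
  exact Finset.sum_eq_zero fun j _ => (hA i j).mul (hV j) n hn

theorem coeff_mulVec [DecidableEq J] (hA : ∀ i j, (A i j).OrdLE N)
    (hA' : ∀ i j, (A i j).coeff N = if i = j then algebraMap ℂ _ c else 0) {V : J → PsiDO p} {M : ℤ}
    (hV : ∀ i, (V i).OrdLE M) (i : J) : (A.mulVec V i).coeff (N + M) = c • (V i).coeff M := by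
  rw [Matrix.mulVec, dotProduct, PsiDO.coeff_sum, Finset.sum_eq_single i]
  · rw [(hA i i).coeff_mul (hV i), hA', if_pos rfl, Algebra.smul_def]
  · intro j _ hj
    rw [(hA i j).coeff_mul (hV j), hA', if_neg hj.symm, zero_mul]
  · simp

theorem PsiDO.OrdLE.pred {A : PsiDO p} {M : ℤ} (h : A.OrdLE M) (h' : A.coeff M = 0) :
    A.OrdLE (M - 1) := by
  intro n hn
  rcases eq_or_lt_of_le (Int.sub_one_lt_iff.mp hn) with rfl | h1
  · exact h'
  · exact h n h1

theorem PsiDO.eq_zero_of_ordLE {A : PsiDO p} {M : ℤ} (h : ∀ k : ℕ, A.OrdLE (M - k)) : A = 0 :=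
  PsiDO.ext fun n => h ((M - n).toNat + 1) n (by push_cast; omega)

/-- The top coefficient of A V is c times that of V. If A V = 0, the bound on the order of V can
thus be lowered indefinitely. -/
theorem mulVec_injective_of_leadingCoeff [DecidableEq J] (hA : ∀ i j, (A i j).OrdLE N)
    (hA' : ∀ i j, (A i j).coeff N = if i = j then algebraMap ℂ _ c else 0) (hc : c ≠ 0) :
    Function.Injective A.mulVec := by
  have key : ∀ V, A.mulVec V = 0 → V = 0 := by
    intro V h
    obtain ⟨M, hM⟩ := exists_ordLE V
    have hk : ∀ k : ℕ, ∀ i, (V i).OrdLE (M - k) := by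
      intro k
      induction k with
      | zero => intro i; simpa using hM i
      | succ k ih =>
        intro i
        have h1 := coeff_mulVec hA hA' ih i
        rw [h, Pi.zero_apply, PsiDO.coeff_zero] at h1
        have h2 := (ih i).pred ((smul_eq_zero.mp h1.symm).resolve_left hc)
        rwa [sub_sub, ← Nat.cast_succ] at h2
    exact funext fun i => PsiDO.eq_zero_of_ordLE fun k => hk k i
  intro V W h
  have := key (V - W) (by rw [Matrix.mulVec_sub]; exact sub_eq_zero.mpr h)
  exact sub_eq_zero.mp this

/-- Successive approximations to the solution of `A V = r`. -/
def approx (A : Matrix J J (PsiDO p)) (N : ℤ) (c : ℂ) (r : J → PsiDO p) (M : ℤ) : ℕ → J → PsiDO p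
  | 0 => 0
  | k + 1 => approx A N c r M k + fun i => PsiDO.monomial p (M - k)
      (c⁻¹ • ((r - A.mulVec (approx A N c r M k)) i).coeff (N + (M - k)))

/-- The correction in step k is chosen to cancel the coefficient of order N + M - k of the residual,
so the order of the residual drops by one in every step. -/
theorem approx_residual [DecidableEq J] (hA : ∀ i j, (A i j).OrdLE N)
    (hA' : ∀ i j, (A i j).coeff N = if i = j then algebraMap ℂ _ c else 0) (hc : c ≠ 0)
    {r : J → PsiDO p} {M : ℤ} (hr : ∀ i, (r i).OrdLE (N + M)) (k : ℕ) (i : J) :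
    ((r - A.mulVec (approx A N c r M k)) i).OrdLE (N + (M - k)) := by
  induction k generalizing i with
  | zero => simpa [approx] using hr i
  | succ k ih =>
    let δ : J → PsiDO p := fun i => PsiDO.monomial p (M - k)
      (c⁻¹ • ((r - A.mulVec (approx A N c r M k)) i).coeff (N + (M - k)))
    have hδ : ∀ i, (δ i).OrdLE (M - k) := by
      intro i n hn
      rw [PsiDO.coeff_monomial, if_neg hn.ne']
    have e : r - A.mulVec (approx A N c r M (k + 1)) =
        (r - A.mulVec (approx A N c r M k)) - A.mulVec δ := by
      rw [approx, Matrix.mulVec_add, sub_sub]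
    have h1 := ordLE_mulVec hA hδ i
    have h2 := coeff_mulVec hA hA' hδ i
    rw [PsiDO.coeff_monomial, if_pos rfl, smul_smul, mul_inv_cancel₀ hc, one_smul] at h2
    have h3 : ((r - A.mulVec (approx A N c r M (k + 1))) i).OrdLE (N + (M - k) - 1) := by
      apply PsiDO.OrdLE.pred
      · intro n hn
        rw [e, Pi.sub_apply, PsiDO.coeff_sub, ih i n hn, h1 n hn, sub_zero]
      · rw [e, Pi.sub_apply, PsiDO.coeff_sub, h2, sub_self]
    refine h3.mono (le_of_eq ?_)
    push_cast; ring

theorem approx_coeff_stable (r : J → PsiDO p) (M : ℤ) {k l : ℕ} (hkl : k ≤ l) {n : ℤ}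
    (hn : M - k < n) (i : J) :
    (approx A N c r M l i).coeff n = (approx A N c r M k i).coeff n := by
  induction l, hkl using Nat.le_induction with
  | base => rfl
  | succ l hl ih =>
    rw [approx, Pi.add_apply, PsiDO.coeff_add, ih, PsiDO.coeff_monomial, if_neg (by omega),
      add_zero]

theorem mulVec_surjective_of_leadingCoeff [DecidableEq J] (hA : ∀ i j, (A i j).OrdLE N)
    (hA' : ∀ i j, (A i j).coeff N = if i = j then algebraMap ℂ _ c else 0) (hc : c ≠ 0) :
    Function.Surjective A.mulVec := by
  intro r
  obtain ⟨M', hM'⟩ := exists_ordLE r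
  obtain ⟨M, rfl⟩ : ∃ M, M' = N + M := ⟨M' - N, by ring⟩
  -- Step k adds only a term of order M - k, so the coefficient of ∂^n is final after M - n + 1
  -- steps.
  let V : J → PsiDO p := fun i =>
    ⟨fun n => (approx A N c r M ((M - n).toNat + 1) i).coeff n, M, fun n hn => by
      beta_reduce
      rw [approx_coeff_stable r M (Nat.zero_le _) (by push_cast; omega)]; rfl⟩
  have hV : ∀ k i, ((V - approx A N c r M k) i).OrdLE (M - k) := by
    intro k i n hn
    rw [Pi.sub_apply, PsiDO.coeff_sub, sub_eq_zero]
    change (approx A N c r M ((M - n).toNat + 1) i).coeff n = _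
    rcases le_total k ((M - n).toNat + 1) with h | h
    · exact approx_coeff_stable r M h hn i
    · exact (approx_coeff_stable r M h (by push_cast; omega) i).symm
  refine ⟨V, (sub_eq_zero.mp (funext fun i => PsiDO.eq_zero_of_ordLE (M := N + M) fun k => ?_)).symm⟩
  have e : r - A.mulVec V = (r - A.mulVec (approx A N c r M k)) -
      A.mulVec (V - approx A N c r M k) := by
    rw [Matrix.mulVec_sub]; abel
  intro n hn
  rw [add_sub_assoc] at hn
  rw [e, Pi.sub_apply, PsiDO.coeff_sub, approx_residual hA hA' hc hM' k i n hn,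
    ordLE_mulVec hA (hV k) i n hn, sub_zero]

end Monic

/-! ### The quasi-determinant of `ρ(A(∂))` -/

section QuasiDet

open scoped PsiDO

variable {N m n : ℕ}

theorem rhoA_isEvenMat : IsEvenMat (par N m n) (par N m n) (rhoA N m n) := by
  intro x y k
  rw [rhoA_apply, PsiDO.coeff_add]
  refine add_mem ?_ ?_
  · split_ifs with h
    · rw [h, CharTwo.add_self_eq_zero, PsiDO.partialOp, PsiDO.coeff_monomial]
      split_ifs
      · exact one_mem_parityPart _
      · exact zero_mem _
    · exact zero_mem _
  · rw [PsiDO.coeff_monomial]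
    split_ifs
    · exact rhoCoeff_mem x y
    · exact zero_mem _

theorem rhoA_leftAssoc (x y : Idx N m n) : PsiDO.LeftAssoc (rhoA N m n x y) := by
  rw [rhoA_apply]
  refine PsiDO.LeftAssoc.add ?_ (PsiDO.leftAssoc_monomial_zero _)
  split_ifs
  · exact PsiDO.leftAssoc_partialOp
  · exact PsiDO.leftAssoc_zero

theorem rhoA_mulVec (V : Idx N m n → PsiDO (pPar N m n)) (x : Idx N m n) :
    (rhoA N m n).mulVec V x = PsiDO.partialOp _ * V x +
      ∑ y, PsiDO.monomial _ 0 (rhoCoeff N m n x y) * V y := by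
  simp only [Matrix.mulVec, dotProduct, rhoA_apply, add_mul, Finset.sum_add_distrib, ite_mul,
    zero_mul, Finset.sum_ite_eq, Finset.mem_univ, if_true]

/-- A block row of ρ(A(∂)) has nothing beyond the identity block just above the diagonal. This
permits forward substitution. -/
theorem rhoA_mulVec_of_vanish {V : Idx N m n → PsiDO (pPar N m n)} {x : Idx N m n}
    (hx : x.1.val + 1 < N) (hV : ∀ y : Idx N m n, y.1.val ≤ x.1.val → V y = 0) :
    (rhoA N m n).mulVec V x = V (⟨x.1.val + 1, hx⟩, x.2) := by
  rw [rhoA_mulVec, hV x le_rfl, mul_zero, zero_add, Finset.sum_eq_single (⟨x.1.val + 1, hx⟩, x.2)]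
  · rw [rhoCoeff_of_eq_succ rfl, if_pos rfl]; exact one_mul _
  · intro y _ hy
    rcases lt_trichotomy y.1.val (x.1.val + 1) with h | h | h
    · rw [hV y (Nat.lt_succ_iff.mp h), mul_zero]
    · rw [rhoCoeff_of_eq_succ h, if_neg]
      · have : PsiDO.monomial (pPar N m n) 0 0 = 0 := PsiDO.ext fun k => by
          rw [PsiDO.coeff_monomial]; split_ifs <;> rfl
        rw [this, zero_mul]
      · intro h2
        exact hy (Prod.ext (Fin.ext h) h2.symm)
    · have : PsiDO.monomial (pPar N m n) 0 0 = 0 := PsiDO.ext fun k => by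
        rw [PsiDO.coeff_monomial]; split_ifs <;> rfl
      rw [rhoCoeff_of_lt h, this, zero_mul]
  · simp

/-- A column which is killed by all blocks of rows of `ρ(A(∂))` but the last is determined by its
first block. -/
theorem eq_zero_of_rhoA_mulVec {V : Idx N m n → PsiDO (pPar N m n)}
    (h0 : ∀ x : Idx N m n, x.1.val = 0 → V x = 0)
    (h : ∀ x : Idx N m n, x.1.val + 1 < N → (rhoA N m n).mulVec V x = 0) : V = 0 := by
  have key : ∀ t : ℕ, ∀ x : Idx N m n, x.1.val ≤ t → V x = 0 := by
    intro t
    induction t with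
    | zero => exact fun x hx => h0 x (Nat.le_zero.mp hx)
    | succ t ih =>
      rintro ⟨⟨u, hu⟩, i⟩ hx
      rcases Nat.le_succ_iff.mp hx with h1 | h1
      · exact ih _ h1
      · simp only at h1
        subst h1
        have h2 := h (⟨t, by omega⟩, i) hu
        rwa [rhoA_mulVec_of_vanish (x := (⟨t, by omega⟩, i)) hu fun y hy => ih y hy] at h2
  exact funext fun x => key _ x le_rfl

theorem exists_rhoA_mulVec (r : Idx N m n → PsiDO (pPar N m n)) (t : ℕ) :
    ∃ V : Idx N m n → PsiDO (pPar N m n), (∀ x : Idx N m n, x.1.val = 0 → V x = 0) ∧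
      ∀ x : Idx N m n, x.1.val < t → x.1.val + 1 < N → (rhoA N m n).mulVec V x = r x := by
  induction t with
  | zero => exact ⟨0, fun _ _ => rfl, fun x hx => absurd hx (Nat.not_lt_zero _)⟩
  | succ t ih =>
    obtain ⟨V, hV0, hV⟩ := ih
    by_cases ht : t + 1 < N
    -- A correction supported in block t + 1 changes row t by exactly its own value and leaves the
    -- earlier rows alone.
    · let δ : Idx N m n → PsiDO (pPar N m n) := fun x =>
        if x.1.val = t + 1 then
          r (⟨t, by omega⟩, x.2) - (rhoA N m n).mulVec V (⟨t, by omega⟩, x.2)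
        else 0
      refine ⟨V + δ, fun x hx => ?_, fun x hx hx' => ?_⟩
      · rw [Pi.add_apply, hV0 x hx, zero_add]
        exact if_neg (by omega)
      · have h1 : (rhoA N m n).mulVec δ x = δ (⟨x.1.val + 1, hx'⟩, x.2) :=
          rhoA_mulVec_of_vanish hx' fun y hy => if_neg (by omega)
        rw [Matrix.mulVec_add, Pi.add_apply, h1]
        rcases Nat.lt_succ_iff_lt_or_eq.mp hx with h2 | h2
        · rw [hV x h2 hx']
          simp only [δ]
          rw [if_neg (by omega), add_zero]
        · have h3 : x = (⟨t, by omega⟩, x.2) := Prod.ext (Fin.ext h2) rfl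
          simp only [δ]
          rw [if_pos (by omega), ← h3, add_sub_cancel]
    · exact ⟨V, hV0, fun x hx hx' => hV x (by omega) hx'⟩

/-! ### The solution matrix Y and the candidate -Y_N for the quasi-determinant. -/

variable (N m n) in
/-- The matrix of differential operators with symbols `Y_u`. -/
def solOp : Matrix (Idx N m n) (Fin m ⊕ Fin n) (PsiDO (pPar N m n)) :=
  fun x c => PsiDO.ofSymbol _ (symb N m n x.1 x.2 c)

variable (N m n) in
/-- The quasi-determinant `|ρ(A(∂))|_{IJ}`. -/
def quasiDet : Matrix (Fin m ⊕ Fin n) (Fin m ⊕ Fin n) (PsiDO (pPar N m n)) :=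
  fun i c => -PsiDO.ofSymbol _ (symb N m n N i c)

theorem rhoA_mulVec_solOp (g : Fin m ⊕ Fin n → PsiDO (pPar N m n)) (x : Idx N m n) :
    (rhoA N m n).mulVec ((solOp N m n).mulVec g) x =
      if x.1.val + 1 < N then 0 else (quasiDet N m n).mulVec g x.2 := by
  have h1 : ∀ c, ∑ y, rhoA N m n x y * solOp N m n y c =
      if x.1.val + 1 < N then 0 else quasiDet N m n x.2 c := by
    intro c
    have h2 := rhoA_mulVec (fun y => solOp N m n y c) x
    rw [Matrix.mulVec, dotProduct] at h2
    rw [h2]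
    simp only [solOp, ← PsiDO.ofSymbol_C_mul, ← PsiDO.ofSymbol_lamD, ← map_sum, ← map_add,
      symb_row]
    split_ifs with h
    · rw [map_zero]
    · have : x.1.val + 1 = N := by omega
      rw [this, map_neg, quasiDet]
  have h2 : (rhoA N m n).mulVec ((solOp N m n).mulVec g) x =
      ∑ c, (∑ y, rhoA N m n x y * solOp N m n y c) * g c := by
    simp only [Matrix.mulVec, dotProduct, Finset.mul_sum, Finset.sum_mul]
    rw [Finset.sum_comm]
    exact Finset.sum_congr rfl fun c _ => Finset.sum_congr rfl fun y _ =>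
      (rhoA_leftAssoc x y _ _).symm
  rw [h2]
  simp only [h1]
  split_ifs with h
  · simp only [zero_mul, Finset.sum_const_zero]
  · rfl

theorem solOp_mulVec_first (g : Fin m ⊕ Fin n → PsiDO (pPar N m n)) {x : Idx N m n}
    (hx : x.1.val = 0) : (solOp N m n).mulVec g x = g x.2 := by
  rw [Matrix.mulVec, dotProduct, Finset.sum_eq_single x.2]
  · rw [solOp, hx, symb_zero, if_pos rfl, PsiDO.ofSymbol_one, one_mul]
  · intro c _ hc
    rw [solOp, hx, symb_zero, if_neg hc.symm, map_zero, zero_mul]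
  · simp

theorem ordLE_quasiDet (i j : Fin m ⊕ Fin n) : (quasiDet N m n i j).OrdLE N := by
  intro k hk
  rw [quasiDet, PsiDO.coeff_neg, PsiDO.coeff_ofSymbol, if_pos (by omega),
    coeff_symb_of_lt (by omega), neg_zero]

theorem coeff_quasiDet (i j : Fin m ⊕ Fin n) :
    (quasiDet N m n i j).coeff N = if i = j then algebraMap ℂ _ (-(-1) ^ N) else 0 := by
  rw [quasiDet, PsiDO.coeff_neg, PsiDO.coeff_ofSymbol_natCast, coeff_symb_self]
  split_ifs <;> simp

/-- The leading coefficient of -Y_N is the nonzero scalar -(-1)^N. -/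
theorem quasiDet_bijective : Function.Bijective (quasiDet N m n).mulVec :=
  have hc : (-(-1) ^ N : ℂ) ≠ 0 := neg_ne_zero.mpr (pow_ne_zero _ (neg_ne_zero.mpr one_ne_zero))
  ⟨mulVec_injective_of_leadingCoeff ordLE_quasiDet coeff_quasiDet hc,
    mulVec_surjective_of_leadingCoeff ordLE_quasiDet coeff_quasiDet hc⟩

theorem quasiDet_isEvenMat : IsEvenMat (inPar m n) (inPar m n) (quasiDet N m n) := by
  intro i j k
  rw [quasiDet, PsiDO.coeff_neg, PsiDO.coeff_ofSymbol]
  refine neg_mem ?_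
  split_ifs
  · exact symb_parity N i j _
  · exact zero_mem _

theorem quasiDet_leftAssoc (i j : Fin m ⊕ Fin n) : PsiDO.LeftAssoc (quasiDet N m n i j) := by
  rw [quasiDet, ← map_neg]
  exact PsiDO.leftAssoc_ofSymbol _

/-! ### Existence and uniqueness of the quasi-determinant. -/

variable (hN : 2 ≤ N)

/-- Both columns have the same first block and are killed by all block rows but the last, and
forward substitution leaves no further freedom. -/
theorem eq_solOp_mulVec {V : Idx N m n → PsiDO (pPar N m n)}
    (h : ∀ x : Idx N m n, x.1.val + 1 < N → (rhoA N m n).mulVec V x = 0) :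
    V = (solOp N m n).mulVec (fun i => V (firstBlock m n hN i)) := by
  rw [← sub_eq_zero]
  apply eq_zero_of_rhoA_mulVec
  · intro x hx
    rw [Pi.sub_apply, solOp_mulVec_first _ hx, sub_eq_zero]
    exact congrArg V (Prod.ext (Fin.ext hx) rfl)
  · intro x hx
    rw [Matrix.mulVec_sub, Pi.sub_apply, h x hx, rhoA_mulVec_solOp, if_pos hx, sub_zero]

theorem quasiDet_mulVec_first {V : Idx N m n → PsiDO (pPar N m n)}
    (h : ∀ x : Idx N m n, x.1.val + 1 < N → (rhoA N m n).mulVec V x = 0) (i : Fin m ⊕ Fin n) :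
    (quasiDet N m n).mulVec (fun i => V (firstBlock m n hN i)) i =
      (rhoA N m n).mulVec V (lastBlock m n hN i) := by
  conv_rhs => rw [eq_solOp_mulVec hN h]
  rw [rhoA_mulVec_solOp, if_neg]
  · rfl
  · simp only [lastBlock]; omega

/-- All rows but the last are solved by substitution, up to adding Y g with g an arbitrary first
block. The last row becomes an equation for g with operator -Y_N, which is bijective. -/
theorem rhoA_bijective (hN : 2 ≤ N) : Function.Bijective (rhoA N m n).mulVec := by
  constructor
  · have key : ∀ V, (rhoA N m n).mulVec V = 0 → V = 0 := by
      intro V hV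
      have h1 : (fun i => V (firstBlock m n hN i)) = 0 := by
        apply quasiDet_bijective.1
        rw [Matrix.mulVec_zero]
        funext i
        rw [quasiDet_mulVec_first hN (fun x _ => congrFun hV x), hV]; rfl
      rw [eq_solOp_mulVec hN (fun x _ => congrFun hV x), h1, Matrix.mulVec_zero]
    intro V W h
    exact sub_eq_zero.mp (key _ (by rw [Matrix.mulVec_sub]; exact sub_eq_zero.mpr h))
  · intro r
    obtain ⟨V, -, hV⟩ := exists_rhoA_mulVec r N
    obtain ⟨g, hg⟩ := quasiDet_bijective.2
      (fun i => (r - (rhoA N m n).mulVec V) (lastBlock m n hN i))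
    refine ⟨V + (solOp N m n).mulVec g, funext fun x => ?_⟩
    rw [Matrix.mulVec_add, Pi.add_apply, rhoA_mulVec_solOp]
    split_ifs with hx
    · rw [hV x x.1.isLt hx, add_zero]
    · have h1 : x = lastBlock m n hN x.2 :=
        Prod.ext (Fin.ext (by have := x.1.isLt; simp only [lastBlock]; omega)) rfl
      have h2 := congrFun hg x.2
      beta_reduce at h2
      rw [h2, ← h1, Pi.sub_apply, add_sub_cancel]

/-- The columns of `C` indexed by the last block are killed by all rows of ρ(A(∂)) but those of the
last block, so -Y_N maps their first blocks to the identity. Cancelling -Y_N identifies the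
submatrix with the two-sided inverse `G`. -/
theorem isStarInv_submatrix {C : Matrix (Idx N m n) (Idx N m n) (PsiDO (pPar N m n))}
    (hC : IsStarInv (par N m n) (par N m n) (rhoA N m n) C) :
    IsStarInv (inPar m n) (inPar m n) (quasiDet N m n)
      (C.submatrix (firstBlock m n hN) (lastBlock m n hN)) := by
  obtain ⟨G, hG⟩ := exists_isStarInv quasiDet_isEvenMat (quasiDet_leftAssoc (N := N))
    quasiDet_bijective
  have h : C.submatrix (firstBlock m n hN) (lastBlock m n hN) = G := by
    apply eq_of_starMul_eq (inPar m n) quasiDet_isEvenMat quasiDet_bijective.1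
    rw [hG.1]
    have hcol : ∀ (j : Fin m ⊕ Fin n) (x : Idx N m n),
        (rhoA N m n).mulVec (fun y => C y (lastBlock m n hN j)) x =
          if x = lastBlock m n hN j then 1 else 0 := by
      intro j x
      have := congrFun (congrFun hC.1 x) (lastBlock m n hN j)
      rwa [starMul_apply_of_even rhoA_isEvenMat] at this
    funext i j
    rw [starMul_apply_of_even quasiDet_isEvenMat]
    refine (quasiDet_mulVec_first hN (V := fun y => C y (lastBlock m n hN j)) ?_ i).trans ?_
    · intro x hx
      rw [hcol, if_neg]
      rintro rfl
      simp only [lastBlock] at hx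
      omega
    · rw [hcol]
      refine if_congr ?_ rfl rfl
      simp [lastBlock]
  rw [h]
  exact hG

theorem isQuasiDet_quasiDet : IsQuasiDet (par N m n) (rhoA N m n) (lastBlock m n hN)
    (firstBlock m n hN) (quasiDet N m n) := by
  obtain ⟨C, hC⟩ := exists_isStarInv rhoA_isEvenMat rhoA_leftAssoc (rhoA_bijective hN)
  exact ⟨C, hC, (isStarInv_submatrix hN hC).2, (isStarInv_submatrix hN hC).1⟩

/-- With C' the submatrix of the inverse, Q = (-Y_N C') Q = -Y_N (C' Q) = -Y_N; this bracketing has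
the differential operator on the left. -/
theorem eq_quasiDet_of_isQuasiDet
    {Q : Matrix (Fin m ⊕ Fin n) (Fin m ⊕ Fin n) (PsiDO (pPar N m n))}
    (hQ : IsQuasiDet (par N m n) (rhoA N m n) (lastBlock m n hN) (firstBlock m n hN) Q) :
    Q = quasiDet N m n := by
  obtain ⟨C, hC, hQ1, -⟩ := hQ
  have hQ1' : starMul (inPar m n) (inPar m n) (inPar m n)
      (C.submatrix (firstBlock m n hN) (lastBlock m n hN)) Q =
      fun i j => if i = j then 1 else 0 := hQ1
  have h := starMul_assoc_of_even (inPar m n) (inPar m n) (inPar m n) (inPar m n)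
    quasiDet_isEvenMat (quasiDet_leftAssoc (N := N))
    (C.submatrix (firstBlock m n hN) (lastBlock m n hN)) Q
  rwa [(isStarInv_submatrix hN hC).1, hQ1', one_starMul, starMul_one] at h

theorem isMonicDiffOp_quasiDet (hN : 2 ≤ N) :
    IsMonicDiffOp N ((-1 : ℂ) ^ (N - 1) • quasiDet N m n) := by
  intro i j
  rw [Matrix.smul_apply]
  simp only [PsiDO.coeff_smul]
  refine ⟨?_, fun k hk => ?_⟩
  · rw [coeff_quasiDet]
    split_ifs
    · obtain ⟨M, rfl⟩ : ∃ M, N = M + 1 := ⟨N - 1, by omega⟩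
      rw [Nat.add_sub_cancel, pow_succ, mul_neg_one, neg_neg, Algebra.smul_def, ← map_mul,
        ← mul_pow, neg_one_mul, neg_neg, one_pow, map_one]
    · rw [smul_zero]
  · rcases hk with hk | hk
    · rw [quasiDet, PsiDO.coeff_neg, PsiDO.coeff_ofSymbol, if_neg (by omega), neg_zero, smul_zero]
    · rw [ordLE_quasiDet i j k hk, smul_zero]

end QuasiDet

/-! ### The action of `𝔫` on `𝒱(𝔭)` -/

section NilpotentAction

variable {N m n : ℕ}

theorem rho_gen (x : Idx N m n × Idx N m n) (k : ℕ) :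
    rho N m n (gen (glParity (par N m n)) x k) = (D (pPar N m n) ^ k) (rhoUnit N m n x) :=
  lift_gen _ _ _ x k

theorem rho_D (v : VGl (par N m n)) :
    rho N m n (D (glParity (par N m n)) v) = D (pPar N m n) (rho N m n v) :=
  diffHom_D (rhoUnit N m n) (rhoUnit_mem N m n) v

theorem inclP_gen (x : PIdx N m n) (k : ℕ) :
    inclP N m n (gen (pPar N m n) x k) = gen (glParity (par N m n)) x.1 k :=
  lift_gen _ _ _ x k

theorem inclP_D (v : VP N m n) :
    inclP N m n (D (pPar N m n) v) = D (glParity (par N m n)) (inclP N m n v) := by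
  apply algHom_D
  intro b k
  rw [inclP_gen, inclP_gen, D_gen]

theorem rho_tw_inclP (c : ZMod 2) (v : VP N m n) :
    rho N m n (tw (glParity (par N m n)) c (inclP N m n v)) = tw (pPar N m n) c v := by
  have h : ((rho N m n).comp (tw (glParity (par N m n)) c)).comp (inclP N m n) =
      tw (pPar N m n) c := by
    apply SDiffPoly.algHom_ext
    intro b k
    rw [AlgHom.comp_apply, AlgHom.comp_apply, inclP_gen, tw_gen, tw_gen, map_smul, rho_gen]
    congr 1
    obtain ⟨⟨x, y⟩, hb⟩ := b
    rw [rhoUnit_of_le hb, D_pow_gen]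
    rfl
  exact DFunLike.congr_fun h v

theorem rho_inclP (v : VP N m n) : rho N m n (inclP N m n v) = v := by
  have := rho_tw_inclP 0 v
  rwa [tw_zero, tw_zero] at this

theorem mapAlgHom_rho_lamD (f : (VGl (par N m n))[X]) :
    mapAlgHom (rho N m n) (lamD (glParity (par N m n)) f) =
      lamD (pPar N m n) (mapAlgHom (rho N m n) f) := by
  ext k
  have h : ∀ (g : (VGl (par N m n))[X]) (k : ℕ),
      (mapAlgHom (rho N m n) g).coeff k = rho N m n (g.coeff k) := fun g k => coeff_map _ k
  rw [h, coeff_lamD, coeff_lamD, map_add, rho_D, h]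
  congr 1
  cases k with
  | zero => simp
  | succ k => rw [coeff_X_mul, coeff_X_mul, h]

/-- The map `v ↦ ρ({e_{xy} _λ v})` on `𝒱(𝔭)`. -/
def rhoBracket (x y : Idx N m n) : VP N m n →ₗ[ℂ] (VP N m n)[X] :=
  (mapAlgHom (rho N m n)).toLinearMap ∘ₗ affUnit (par N m n) (-1) x y ∘ₗ
    (inclP N m n).toLinearMap

theorem rhoBracket_apply (x y : Idx N m n) (v : VP N m n) :
    rhoBracket x y v = mapAlgHom (rho N m n) (affUnit (par N m n) (-1) x y (inclP N m n v)) := rfl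

theorem affBracket_single (k : ℂ) (x y : Idx N m n) :
    affBracket (par N m n) k (Matrix.single x y 1) = affUnit (par N m n) k x y := by
  rw [affBracket, Finset.sum_eq_single x, Finset.sum_eq_single y]
  · simp
  · intro z _ hz; simp [hz.symm]
  · simp
  · intro z _ hz; simp [hz.symm]
  · simp

/-- The degrees are integers, so 𝔫 is spanned by the matrix units strictly above the block diagonal,
and the bracket is linear in its first argument. -/
theorem mem_WAlg_iff (v : VP N m n) :
    v ∈ WAlg N m n (-1) ↔ ∀ x y : Idx N m n, x.1.val < y.1.val → rhoBracket x y v = 0 := by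
  constructor
  · intro h x y hxy
    have h1 : Matrix.single x y 1 ∈ nSub N m n := by
      intro x' y' h'
      have h2 : x = x' ∧ y = y' := by
        by_contra h2
        exact h' (Matrix.single_apply_of_ne _ _ _ _ _ h2)
      rw [← h2.1, ← h2.2]
      have h3 : (1 : ℤ) ≤ deg x y := by simp only [deg]; omega
      have h4 : (1 : ℚ) ≤ deg x y := by exact_mod_cast h3
      linarith
    have h2 := h _ h1
    rwa [affBracket_single] at h2
  · intro h a ha
    simp only [affBracket, LinearMap.sum_apply, LinearMap.smul_apply, map_sum, map_smul]
    refine Finset.sum_eq_zero fun x _ => Finset.sum_eq_zero fun y _ => ?_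
    by_cases hxy : a x y = 0
    · rw [hxy, zero_smul]
    · have h1 : (0 : ℚ) < deg x y := lt_of_lt_of_le (by norm_num) (ha x y hxy)
      have h2 : 0 < deg x y := by exact_mod_cast h1
      rw [← rhoBracket_apply, h x y (by simp only [deg] at h2; omega), smul_zero]

/-- Since ρ restricts to the identity on 𝒱(𝔭), the Leibniz rule on 𝒱(𝔤) descends to a twisted
derivation of 𝒱(𝔭). -/
theorem rhoBracket_mul (x y : Idx N m n) (a b : VP N m n) :
    rhoBracket x y (a * b) = C (tw (pPar N m n) (par N m n x + par N m n y) a) * rhoBracket x y b +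
      rhoBracket x y a * C b := by
  have h := twDer_mul _ _ _ _ (affUnit_aux (par N m n) (-1) x y) (inclP N m n a) (inclP N m n b)
  have hC : ∀ v, mapAlgHom (rho N m n) (C v) = C (rho N m n v) := fun v => map_C _
  rw [rhoBracket_apply, map_mul]
  refine (congrArg _ h).trans ?_
  rw [map_add, map_mul, map_mul]
  simp only [constHom, AlgHom.comp_apply, CAlgHom_apply, hC, rho_tw_inclP, rho_inclP]
  rfl

theorem rhoBracket_one (x y : Idx N m n) : rhoBracket x y 1 = 0 := by
  have h := rhoBracket_mul x y 1 1
  rw [map_one, C_1, mul_one, mul_one, one_mul] at h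
  exact left_eq_add.mp h

theorem rhoBracket_algebraMap (x y : Idx N m n) (r : ℂ) :
    rhoBracket x y (algebraMap ℂ _ r) = 0 := by
  rw [Algebra.algebraMap_eq_smul_one, map_smul, rhoBracket_one, smul_zero]

theorem rhoBracket_D (x y : Idx N m n) (v : VP N m n) :
    rhoBracket x y (D (pPar N m n) v) = lamD (pPar N m n) (rhoBracket x y v) := by
  rw [rhoBracket_apply, inclP_D, ← affBracket_single, affBracket_D, mapAlgHom_rho_lamD]
  rw [affBracket_single, rhoBracket_apply]

theorem ofGl_sub (a b : Matrix (Idx N m n) (Idx N m n) ℂ) :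
    ofGl (par N m n) (a - b) = ofGl (par N m n) a - ofGl (par N m n) b := by
  simp only [ofGl, Matrix.sub_apply, sub_smul, Finset.sum_sub_distrib]

theorem ofGl_smul (r : ℂ) (a : Matrix (Idx N m n) (Idx N m n) ℂ) :
    ofGl (par N m n) (r • a) = r • ofGl (par N m n) a := by
  simp only [ofGl, Matrix.smul_apply, smul_assoc, Finset.smul_sum]

theorem ofGl_zero : ofGl (par N m n) 0 = 0 := by
  simp [ofGl]

theorem rhoBracket_gen (x y z w : Idx N m n) (h : deg z w < 1) :
    rhoBracket x y (gen (pPar N m n) (pIdx z w h) 0) =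
      (if y = z then C (rhoUnit N m n (x, w)) else 0) -
        eps ((par N m n x + par N m n y) * (par N m n z + par N m n w)) •
          (if x = w then C (rhoUnit N m n (z, y)) else 0) -
        if y = z ∧ x = w then eps (par N m n x) • X else 0 := by
  have hC : ∀ v, mapAlgHom (rho N m n) (C v) = C (rho N m n v) := fun v => map_C _
  have hX : mapAlgHom (rho N m n) X = X := map_X _
  have hU : ∀ x y, rho N m n (ofGl (par N m n) (Matrix.single x y 1)) = rhoUnit N m n (x, y) := by
    intro x y
    rw [ofGl_single, rho_gen]; rfl
  rw [rhoBracket_apply, inclP_gen, pIdx, affUnit_gen, pow_zero, Module.End.one_apply, affBase, map_add,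
    map_mul, hC, hC, hX, superBracket_single, form_single, ofGl_sub, ofGl_smul, map_sub, map_smul,
    C_sub, ← smul_C, AlgHom.commutes, sub_eq_add_neg _ (ite (y = z ∧ x = w) _ _)]
  congr 1
  · congr 1
    · split_ifs
      · rw [hU]
      · rw [ofGl_zero, map_zero, C_0]
    · congr 1
      split_ifs
      · rw [hU]
      · rw [ofGl_zero, map_zero, C_0]
  · split_ifs
    · rw [neg_one_mul, map_neg, C_neg, neg_mul, Algebra.algebraMap_eq_smul_one, ← smul_C, C_1,
        smul_mul_assoc, one_mul]
    · simp

/-- The sign in the infinitesimal gauge action. -/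
def gaugeSign (x y : Idx N m n) : ℂ := eps (par N m n x + par N m n x * par N m n y)

/-- `𝔫` acts on `ρ(A(∂))` by infinitesimal gauge transformations. -/
theorem rhoBracket_rhoCoeff {x y : Idx N m n} (hxy : x.1.val < y.1.val) (z w : Idx N m n) :
    eps ((par N m n x + par N m n y) * par N m n z) • rhoBracket x y (rhoCoeff N m n z w) =
      gaugeSign x y • ((if z = y then C (rhoCoeff N m n x w) else 0) -
        (if w = x then C (rhoCoeff N m n z y) else 0) - if z = y ∧ w = x then X else 0) := by
  by_cases h : deg z w < 1
  · have s1 : ∀ a b : ZMod 2, (a + b) * b + b = a + a * b + a := by decide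
    have s2 : ∀ a b c : ZMod 2, (a + b) * c + c + (a + b) * (c + a) = a + a * b + c := by decide
    have s3 : ∀ a b : ZMod 2, (a + b) * b + b + a = a + a * b := by decide
    rw [rhoCoeff_of_le h, map_smul, rhoBracket_gen, smul_smul, smul_sub, smul_sub, smul_sub,
      smul_sub, ← eps_add]
    simp only [@eq_comm _ y z, @eq_comm _ x w]
    congr 1
    · congr 1
      · split_ifs with h1
        · subst h1
          rw [rhoCoeff, ← smul_C, gaugeSign, smul_smul, ← eps_add, s1]
        · rw [smul_zero, smul_zero]
      · split_ifs with h1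
        · subst h1
          rw [rhoCoeff, ← smul_C, gaugeSign, smul_smul, smul_smul, ← eps_add, ← eps_add, s2]
        · rw [smul_zero, smul_zero, smul_zero]
    · split_ifs with h1
      · obtain ⟨rfl, rfl⟩ := h1
        rw [smul_smul, ← eps_add, s3, gaugeSign]
      · rw [smul_zero, smul_zero]
  -- Above the block diagonal the entry is a constant, so its bracket is zero. As x lies in an
  -- earlier block than y, the entries on the right lie beyond the identity blocks and vanish too,
  -- and z = y, w = x is impossible.
  · have h' : z.1.val < w.1.val := by simp only [deg] at h; omega
    have h0 : rhoBracket x y (rhoCoeff N m n z w) = 0 := by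
      rcases eq_or_lt_of_le (Nat.succ_le_of_lt h') with h1 | h1
      · rw [rhoCoeff_of_eq_succ h1.symm]
        split_ifs
        · exact rhoBracket_one x y
        · exact map_zero _
      · rw [rhoCoeff_of_lt h1, map_zero]
    have h1 : (if z = y then C (rhoCoeff N m n x w) else 0) = 0 := by
      split_ifs with h1
      · rw [rhoCoeff_of_lt (by rw [h1] at h'; omega), C_0]
      · rfl
    have h2 : (if w = x then C (rhoCoeff N m n z y) else 0) = 0 := by
      split_ifs with h2
      · rw [rhoCoeff_of_lt (by rw [h2] at h'; omega), C_0]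
      · rfl
    rw [h0, h1, h2, if_neg, sub_zero, sub_zero, smul_zero, smul_zero]
    rintro ⟨rfl, rfl⟩
    omega

/-! ### The brackets of 𝔫 with the coefficients of Y_u. -/

theorem symb_row_coeff (z : Idx N m n) (c : Fin m ⊕ Fin n) (k : ℕ) :
    (X * symb N m n z.1 z.2 c).coeff k + D (pPar N m n) ((symb N m n z.1 z.2 c).coeff k) +
      ∑ y : Idx N m n, rhoCoeff N m n z y * (symb N m n y.1 y.2 c).coeff k =
      if z.1.val + 1 < N then 0 else -(symb N m n (z.1 + 1) z.2 c).coeff k := by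
  have h := congrArg (fun f => f.coeff k) (symb_row z c)
  simp only [coeff_add, coeff_lamD, finsetSum_coeff, coeff_C_mul] at h
  rw [h]
  split_ifs
  · rfl
  · exact coeff_neg _ _

/-- The difference of the value `U` of `rhoBracket x y` on the symbols `Y_u` and of its gauge
theoretic value `G` solves the linear system which defines the `Y_u`. -/
theorem sum_rhoCoeff_mul_gauge_defect {x y : Idx N m n} (hxy : x.1.val < y.1.val) (z : Idx N m n)
    (c : Fin m ⊕ Fin n)
    (U G : Idx N m n → ℕ → (VP N m n)[X])
    (hU : ∀ z k, U z k = eps ((par N m n x + par N m n y) * par N m n z) •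
      rhoBracket x y ((symb N m n z.1 z.2 c).coeff k))
    (hG : ∀ z k, G z k = gaugeSign x y •
      if z = y then C ((symb N m n x.1 x.2 c).coeff k) else 0)
    (hz : ∀ k, U z k = G z k) (k : ℕ) :
    ∑ w : Idx N m n, C (rhoCoeff N m n z w) * (U w k - G w k) =
      if z.1.val + 1 < N then 0 else -(eps ((par N m n x + par N m n y) * par N m n z) •
        rhoBracket x y ((symb N m n (z.1 + 1) z.2 c).coeff k)) := by
  have h := congrArg (fun v => eps ((par N m n x + par N m n y) * par N m n z) •
    rhoBracket x y v) (symb_row_coeff z c k)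
  have e1 : eps ((par N m n x + par N m n y) * par N m n z) •
      rhoBracket x y ((X * symb N m n z.1 z.2 c).coeff k) =
      gaugeSign x y • if z = y then C ((X * symb N m n x.1 x.2 c).coeff k) else 0 := by
    cases k with
    | zero => simp
    | succ k => rw [coeff_X_mul, coeff_X_mul, ← hU, hz, hG]
  have e2 : eps ((par N m n x + par N m n y) * par N m n z) •
      rhoBracket x y (D (pPar N m n) ((symb N m n z.1 z.2 c).coeff k)) =
      lamD (pPar N m n) (G z k) := by
    rw [rhoBracket_D, ← map_smul, ← hU, hz]
  -- The sign attached to z combines with the Leibniz sign of the entry (z, w) to the sign attached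
  -- to w; this explains the normalization of `U`.
  have e3 : ∀ w, eps ((par N m n x + par N m n y) * par N m n z) •
      rhoBracket x y (rhoCoeff N m n z w * (symb N m n w.1 w.2 c).coeff k) =
      C (rhoCoeff N m n z w) * U w k + gaugeSign x y •
        (((if z = y then C (rhoCoeff N m n x w) else 0) -
        (if w = x then C (rhoCoeff N m n z y) else 0) - if z = y ∧ w = x then X else 0) *
        C ((symb N m n w.1 w.2 c).coeff k)) := by
    intro w
    rw [rhoBracket_mul, smul_add, ← smul_mul_assoc (eps _) (rhoBracket x y (rhoCoeff N m n z w)),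
      rhoBracket_rhoCoeff hxy, smul_mul_assoc, rhoCoeff_mem z w, hU]
    congr 1
    rw [← smul_C, smul_mul_assoc, smul_smul, mul_smul_comm, ← eps_add]
    congr 2
    have : ∀ a b c : ZMod 2, a * b + a * (b + c) = a * c := by decide
    exact this _ _ _
  simp only [map_add, map_sum, smul_add, e1, e2] at h
  rw [Finset.smul_sum] at h
  simp only [e3, Finset.sum_add_distrib] at h
  rw [← Finset.smul_sum] at h
  -- For z = y the first gauge term is the sum in row x. Since x lies in an earlier block than y,
  -- this is not the last block row, so the row equation for x evaluates the sum.
  have e4 : ∑ w, ((if z = y then C (rhoCoeff N m n x w) else 0) -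
        (if w = x then C (rhoCoeff N m n z y) else 0) - if z = y ∧ w = x then X else 0) *
        C ((symb N m n w.1 w.2 c).coeff k) =
      (if z = y then -C ((X * symb N m n x.1 x.2 c).coeff k) -
        lamD (pPar N m n) (C ((symb N m n x.1 x.2 c).coeff k)) else 0) -
      C (rhoCoeff N m n z y) * C ((symb N m n x.1 x.2 c).coeff k) := by
    have h2 : ∑ w, (if w = x then C (rhoCoeff N m n z y) else 0) *
        C ((symb N m n w.1 w.2 c).coeff k) =
        C (rhoCoeff N m n z y) * C ((symb N m n x.1 x.2 c).coeff k) := by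
      simp only [ite_mul, zero_mul, Finset.sum_ite_eq', Finset.mem_univ, if_true]
    have hlam : ∀ a : VP N m n, lamD (pPar N m n) (C a) = X * C a + C (D (pPar N m n) a) := by
      intro a
      rw [lamD_apply]
      congr 1
      ext j
      rw [coeff_DPoly, coeff_C, coeff_C]
      split_ifs
      · rfl
      · exact map_zero _
    simp only [sub_mul, Finset.sum_sub_distrib, h2]
    by_cases hzy : z = y
    · have h3 := symb_row_coeff x c k
      rw [if_pos (by have := y.1.isLt; omega)] at h3
      have h4 : ∑ w, C (rhoCoeff N m n x w) * C ((symb N m n w.1 w.2 c).coeff k) =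
          -C ((X * symb N m n x.1 x.2 c).coeff k) -
            C (D (pPar N m n) ((symb N m n x.1 x.2 c).coeff k)) := by
        simp only [← C_mul]
        rw [← map_sum, ← C_neg, ← C_sub, eq_neg_of_add_eq_zero_right h3, neg_add']
      simp only [hzy, if_true, true_and, h4, ite_mul, zero_mul, Finset.sum_ite_eq',
        Finset.mem_univ, hlam]
      abel
    · simp only [hzy, if_false, false_and, zero_mul, Finset.sum_const_zero, zero_sub, sub_zero]
  have e5 : ∑ w, C (rhoCoeff N m n z w) * G w k =
      gaugeSign x y • (C (rhoCoeff N m n z y) * C ((symb N m n x.1 x.2 c).coeff k)) := by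
    rw [Finset.sum_eq_single y]
    · rw [hG, if_pos rfl, mul_smul_comm]
    · intro w _ hw
      rw [hG, if_neg hw, smul_zero, mul_zero]
    · simp
  -- The two contributions of ∂ in row z cancel against row x and the central term λ of the bracket;
  -- only the sum over w of the defects remains.
  have e6 : gaugeSign x y • (if z = y then C ((X * symb N m n x.1 x.2 c).coeff k) else 0) +
      lamD (pPar N m n) (G z k) + gaugeSign x y • (if z = y then
        -C ((X * symb N m n x.1 x.2 c).coeff k) -
        lamD (pPar N m n) (C ((symb N m n x.1 x.2 c).coeff k)) else 0) = 0 := by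
    rw [hG]
    split_ifs
    · rw [map_smul, ← smul_add, ← smul_add]
      convert smul_zero _
      abel
    · simp
  simp only [mul_sub, Finset.sum_sub_distrib, e5]
  rw [e4, smul_sub] at h
  have h7 : ∀ a b s d e r : (VP N m n)[X], a + b + (s + (d - e)) = r → a + b + d = 0 →
      s - e = r := by
    intro a b s d e r h1 h2
    rw [← h1, ← sub_zero (a + b + (s + (d - e))), ← h2]
    abel
  rw [h7 _ _ _ _ _ _ h e6]
  split_ifs
  · rw [map_zero, smul_zero]
  · rw [map_neg, smul_neg]

theorem sum_rhoCoeff_mul_of_vanish {V : Idx N m n → (VP N m n)[X]} {z : Idx N m n}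
    (hz : z.1.val + 1 < N) (hV : ∀ y : Idx N m n, y.1.val ≤ z.1.val → V y = 0) :
    ∑ w, C (rhoCoeff N m n z w) * V w = V (⟨z.1.val + 1, hz⟩, z.2) := by
  rw [Finset.sum_eq_single (⟨z.1.val + 1, hz⟩, z.2)]
  · rw [rhoCoeff_of_eq_succ rfl, if_pos rfl, C_1, one_mul]
  · intro y _ hy
    rcases lt_trichotomy y.1.val (z.1.val + 1) with h | h | h
    · rw [hV y (Nat.lt_succ_iff.mp h), mul_zero]
    · rw [rhoCoeff_of_eq_succ h, if_neg, C_0, zero_mul]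
      intro h2
      exact hy (Prod.ext (Fin.ext h) h2.symm)
    · rw [rhoCoeff_of_lt h, C_0, zero_mul]
  · simp

/-- The defect satisfies the homogeneous triangular system and is zero on the first block, where Y_0
is constant. Hence it vanishes block by block. -/
theorem rhoBracket_coeff_symb_aux {x y : Idx N m n} (hxy : x.1.val < y.1.val) (z : Idx N m n)
    (c : Fin m ⊕ Fin n) (k : ℕ) :
    eps ((par N m n x + par N m n y) * par N m n z) •
      rhoBracket x y ((symb N m n z.1 z.2 c).coeff k) =
      gaugeSign x y • if z = y then C ((symb N m n x.1 x.2 c).coeff k) else 0 := by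
  let U : Idx N m n → ℕ → (VP N m n)[X] := fun z k =>
    eps ((par N m n x + par N m n y) * par N m n z) •
      rhoBracket x y ((symb N m n z.1 z.2 c).coeff k)
  let G : Idx N m n → ℕ → (VP N m n)[X] := fun z k =>
    gaugeSign x y • if z = y then C ((symb N m n x.1 x.2 c).coeff k) else 0
  have key : ∀ t : ℕ, ∀ z : Idx N m n, z.1.val ≤ t → ∀ k, U z k = G z k := by
    intro t
    induction t with
    | zero =>
      intro z hz k
      have h1 : z ≠ y := by rintro rfl; omega
      have h2 : rhoBracket x y ((symb N m n z.1 z.2 c).coeff k) = 0 := by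
        rw [Nat.le_zero.mp hz, symb_zero]
        split_ifs
        · rw [coeff_one]
          split_ifs
          · exact rhoBracket_one x y
          · exact map_zero _
        · exact map_zero _
      simp only [U, G, h2, if_neg h1, smul_zero]
    | succ t ih =>
      rintro ⟨⟨u, hu⟩, i⟩ hz k
      rcases Nat.le_succ_iff.mp hz with h1 | h1
      · exact ih _ h1 k
      · simp only at h1
        subst h1
        have h2 := sum_rhoCoeff_mul_gauge_defect hxy (⟨t, by omega⟩, i) c U G (fun _ _ => rfl)
          (fun _ _ => rfl) (ih _ le_rfl) k
        rw [sum_rhoCoeff_mul_of_vanish (z := (⟨t, by omega⟩, i)) (V := fun w => U w k - G w k) hu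
          fun y' hy' => sub_eq_zero.mpr (ih y' hy' k), if_pos hu] at h2
        exact sub_eq_zero.mp h2
  exact key _ z le_rfl k

theorem rhoBracket_coeff_symb {x y : Idx N m n} (hxy : x.1.val < y.1.val) (z : Idx N m n)
    (c : Fin m ⊕ Fin n) (k : ℕ) :
    rhoBracket x y ((symb N m n z.1 z.2 c).coeff k) =
      (eps ((par N m n x + par N m n y) * par N m n y) * gaugeSign x y) •
        if z = y then C ((symb N m n x.1 x.2 c).coeff k) else 0 := by
  have h := congrArg (fun v => eps ((par N m n x + par N m n y) * par N m n z) • v)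
    (rhoBracket_coeff_symb_aux hxy z c k)
  simp only [smul_smul, eps_mul_self, one_smul] at h
  rw [h]
  split_ifs with hz
  · rw [hz]
  · rw [smul_zero, smul_zero]

/-- In the last block row the bracket with Y_N takes the place of the missing next block; all
defects are zero, so it vanishes. -/
theorem rhoBracket_coeff_symb_last {x y : Idx N m n} (hxy : x.1.val < y.1.val)
    (i c : Fin m ⊕ Fin n) (k : ℕ) : rhoBracket x y ((symb N m n N i c).coeff k) = 0 := by
  have hN : N - 1 < N := by have := y.1.isLt; omega
  have h := sum_rhoCoeff_mul_gauge_defect hxy (⟨N - 1, hN⟩, i) c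
    (fun z k => eps ((par N m n x + par N m n y) * par N m n z) •
      rhoBracket x y ((symb N m n z.1 z.2 c).coeff k))
    (fun z k => gaugeSign x y • if z = y then C ((symb N m n x.1 x.2 c).coeff k) else 0)
    (fun _ _ => rfl) (fun _ _ => rfl) (rhoBracket_coeff_symb_aux hxy _ c) k
  simp only [rhoBracket_coeff_symb_aux hxy, sub_self, mul_zero, Finset.sum_const_zero] at h
  rw [if_neg (by omega), Nat.sub_add_cancel (by omega), eq_comm, neg_eq_zero] at h
  refine (smul_eq_zero.mp h).resolve_left fun h0 => ?_
  have h1 := eps_mul_self ((par N m n x + par N m n y) * par N m n (⟨N - 1, hN⟩, i))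
  rw [h0, zero_mul] at h1
  exact zero_ne_one h1

end NilpotentAction

/-! ### The symbols `Y_u` as coordinates on `𝒱(𝔭)` -/

section Coordinates

variable {N m n : ℕ}

variable (N m n) in
/-- The coefficients of the monic symbols `(-1)^u Y_u`, indexed by the basis of `𝔭`. -/
def coord (b : PIdx N m n) : VP N m n :=
  (-1 : ℂ) ^ (b.1.1.1.val + 1) •
    (symb N m n (b.1.1.1.val + 1) b.1.1.2 b.1.2.2).coeff b.1.2.1.val

theorem coord_mem (b : PIdx N m n) : coord N m n b ∈ parityPart (pPar N m n) (pPar N m n b) :=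
  Submodule.smul_mem _ _ (symb_parity _ _ _ _)

theorem PIdx.le (b : PIdx N m n) : b.1.2.1.val ≤ b.1.1.1.val := by
  have := b.2
  simp only [deg] at this
  omega

variable (N m n) in
/-- The rank function for which the change of coordinates is triangular. -/
def pRank (b : PIdx N m n) : ℕ := b.1.1.1.val * N + (N - 1 - b.1.2.1.val)

theorem pRank_lt (b : PIdx N m n) : pRank N m n b < N * N := by
  have h1 := b.1.1.1.isLt
  have h2 : (b.1.1.1.val + 1) * N ≤ N * N := Nat.mul_le_mul_right N h1
  rw [Nat.succ_mul] at h2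
  rw [pRank]
  omega

theorem blockCoeff_mem_lowSub {u v M : ℕ} (huv : v ≤ u) (hM : u * N + (N - 1 - v) < M)
    (i j : Fin m ⊕ Fin n) : blockCoeff N m n u i v j ∈ lowSub (pPar N m n) (pRank N m n) M := by
  rw [blockCoeff]
  split_ifs with h
  · have hd : deg (N := N) (m := m) (n := n) (⟨u, h.1⟩, i) (⟨v, h.2⟩, j) < 1 := by
      simp only [deg]; omega
    rw [rhoCoeff_of_le hd]
    exact Subalgebra.smul_mem _ (gen_mem_lowSub (b := pIdx _ _ hd) 0 hM) _
  · exact zero_mem _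

theorem coeff_symb_succ (u : ℕ) (i c : Fin m ⊕ Fin n) (k : ℕ) :
    (symb N m n (u + 1) i c).coeff k = -((X * symb N m n u i c).coeff k +
      D (pPar N m n) ((symb N m n u i c).coeff k) +
      ∑ v ∈ Finset.range (u + 1), ∑ j, blockCoeff N m n u i v j * (symb N m n v j c).coeff k) := by
  simp only [symb_succ, coeff_neg, coeff_add, coeff_lamD, finsetSum_coeff, coeff_C_mul]

/-- By the recursion Y_u involves only entries of the block rows before u, and these have rank below
u N. -/
theorem coeff_symb_mem_lowSub (hN : 0 < N) (u : ℕ) (i c : Fin m ⊕ Fin n) (k : ℕ) :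
    (symb N m n u i c).coeff k ∈ lowSub (pPar N m n) (pRank N m n) (u * N) := by
  induction u using Nat.strong_induction_on generalizing i k with
  | _ u ih =>
    cases u with
    | zero =>
      rw [symb_zero]
      split_ifs
      · rw [coeff_one]
        split_ifs
        · exact one_mem _
        · exact zero_mem _
      · exact zero_mem _
    | succ u =>
      have hle : ∀ v, v ≤ u + 1 → v * N ≤ (u + 1) * N := fun v hv => Nat.mul_le_mul_right N hv
      have hu : ∀ k, (symb N m n u i c).coeff k ∈
          lowSub (pPar N m n) (pRank N m n) ((u + 1) * N) := fun k =>
        lowSub_mono (hle u (Nat.le_succ u)) (ih u u.lt_succ_self i k)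
      rw [coeff_symb_succ]
      refine neg_mem (add_mem (add_mem ?_ (D_mem_lowSub (hu k)))
        (sum_mem fun v hv => sum_mem fun j _ => ?_))
      · cases k with
        | zero => rw [coeff_X_mul_zero]; exact zero_mem _
        | succ k => rw [coeff_X_mul]; exact hu k
      · have hv' := Finset.mem_range.mp hv
        refine mul_mem (blockCoeff_mem_lowSub (Nat.lt_succ_iff.mp hv') ?_ i j)
          (lowSub_mono (hle v hv'.le) (ih v hv' j k))
        rw [Nat.succ_mul]
        omega

theorem mul_neg_one_pow {A : Type} [Ring A] [Algebra ℂ A] (a : A) (k : ℕ) :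
    a * (-1) ^ k = (-1 : ℂ) ^ k • a := by
  rcases neg_one_pow_eq_or ℂ k with h | h <;> rcases neg_one_pow_eq_or A k with h' | h'
  · rw [h, h', mul_one, one_smul]
  · have := congrArg (algebraMap ℂ A) h
    rw [map_pow, map_neg, map_one] at this
    rw [h, this, mul_one, one_smul]
  · have := congrArg (algebraMap ℂ A) h
    rw [map_pow, map_neg, map_one] at this
    rw [h, this, mul_neg_one, neg_one_smul]
  · rw [h, h', mul_neg_one, neg_one_smul]

/-- In the coefficient of ∂^v in Y_{u+1}, the entry (u, v) meets the leading coefficient of Y_v and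
yields the generator with a sign. Entries (u, w) with w < v do not contribute, as Y_w has order
below v; those with w > v have smaller rank, and all else comes from earlier rows. -/
theorem coord_triangular (b : PIdx N m n) :
    coord N m n b - ((-1 : ℂ) ^ (b.1.1.1.val + b.1.2.1.val) * eps (par N m n b.1.1)) •
      gen (pPar N m n) b 0 ∈ lowSub (pPar N m n) (pRank N m n) (pRank N m n b) := by
  have hle := b.le
  obtain ⟨⟨⟨⟨u, hu⟩, i⟩, ⟨⟨v, hv⟩, j⟩⟩, hb⟩ := b
  simp only at hle
  have hN : 0 < N := by omega
  have hr : u * N ≤ u * N + (N - 1 - v) := Nat.le_add_right _ _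
  have hlow : ∀ w, w ≤ u → ∀ i k, (symb N m n w i j).coeff k ∈
      lowSub (pPar N m n) (pRank N m n) (u * N + (N - 1 - v)) := fun w hw i k =>
    lowSub_mono ((Nat.mul_le_mul_right N hw).trans hr) (coeff_symb_mem_lowSub hN w i j k)
  have hterm : ∑ k, blockCoeff N m n u i v k * (symb N m n v k j).coeff v =
      (-1 : ℂ) ^ v • eps (inPar m n i) •
        gen (pPar N m n) (pIdx (⟨u, hu⟩, i) (⟨v, hv⟩, j) hb) 0 := by
    rw [Finset.sum_eq_single j]
    · rw [coeff_symb_self, if_pos rfl, blockCoeff, dif_pos ⟨hu, hv⟩, rhoCoeff_of_le hb,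
        mul_neg_one_pow]
      rfl
    · intro k _ hk
      rw [coeff_symb_self, if_neg hk, mul_zero]
    · simp
  have e : coord N m n (pIdx (⟨u, hu⟩, i) (⟨v, hv⟩, j) hb) -
      ((-1 : ℂ) ^ (u + v) * eps (inPar m n i)) •
        gen (pPar N m n) (pIdx (⟨u, hu⟩, i) (⟨v, hv⟩, j) hb) 0 =
      (-1 : ℂ) ^ u • ((X * symb N m n u i j).coeff v +
        D (pPar N m n) ((symb N m n u i j).coeff v) +
        ∑ w ∈ (Finset.range (u + 1)).erase v,
          ∑ k, blockCoeff N m n u i w k * (symb N m n w k j).coeff v) := by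
    change (-1 : ℂ) ^ (u + 1) • (symb N m n (u + 1) i j).coeff v - _ = _
    rw [coeff_symb_succ, ← Finset.add_sum_erase _ _ (Finset.mem_range.mpr (Nat.lt_succ_of_le hle)),
      hterm, pow_succ, mul_neg_one, neg_smul_neg, pow_add, mul_assoc, mul_smul, mul_smul,
      ← smul_sub]
    congr 1
    abel
  change coord N m n (pIdx (⟨u, hu⟩, i) (⟨v, hv⟩, j) hb) -
      ((-1 : ℂ) ^ (u + v) * eps (inPar m n i)) •
        gen (pPar N m n) (pIdx (⟨u, hu⟩, i) (⟨v, hv⟩, j) hb) 0 ∈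
      lowSub (pPar N m n) (pRank N m n) (u * N + (N - 1 - v))
  rw [e]
  refine Subalgebra.smul_mem _ (add_mem (add_mem ?_ (D_mem_lowSub (hlow u le_rfl i v)))
    (sum_mem fun w hw => sum_mem fun k _ => ?_)) _
  · cases v with
    | zero => rw [coeff_X_mul_zero]; exact zero_mem _
    | succ v => rw [coeff_X_mul]; exact hlow u le_rfl i v
  · obtain ⟨hw1, hw2⟩ := Finset.mem_erase.mp hw
    have hw3 := Nat.lt_succ_iff.mp (Finset.mem_range.mp hw2)
    rcases lt_or_gt_of_ne hw1 with h | h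
    · rw [coeff_symb_of_lt h, mul_zero]; exact zero_mem _
    · exact mul_mem (blockCoeff_mem_lowSub hw3 (by omega) i k) (hlow w hw3 k v)

variable (N m n) in
/-- The endomorphism of `𝒱(𝔭)` that sends the generators to the coefficients of the `(-1)^u Y_u`. -/
def coordHom : VP N m n →ₐ[ℂ] VP N m n :=
  diffHom (pPar N m n) (pPar N m n) (coord N m n) coord_mem

theorem coordHom_bijective : Function.Bijective (coordHom N m n) := by
  refine diffHom_bijective_of_triangular (N * N) pRank_lt _ (fun b => ?_) _ _ coord_triangular
  refine mul_ne_zero (pow_ne_zero _ (neg_ne_zero.mpr one_ne_zero)) fun h => ?_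
  have := eps_mul_self (par N m n b.1.1)
  rw [h, zero_mul] at this
  exact zero_ne_one this

/-! ### Substitution of `∂` for `λ` -/

/-- The value at `λ = ∂`, acting on `h` from the left, of a polynomial in `λ`. -/
def evalPartial {B : Type} {p : B → ZMod 2} (h : SDiffPoly p) :
    (SDiffPoly p)[X] →ₗ[ℂ] SDiffPoly p :=
  Polynomial.lsum fun k => LinearMap.mulLeft ℂ ((D p ^ k) h)

section EvalPartial

variable {B : Type} {p : B → ZMod 2} (h : SDiffPoly p)

theorem evalPartial_monomial (k : ℕ) (a : SDiffPoly p) :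
    evalPartial h (monomial k a) = (D p ^ k) h * a := by
  rw [evalPartial, lsum_apply]
  exact sum_monomial_index _ _ (map_zero _)

theorem evalPartial_C (a : SDiffPoly p) : evalPartial h (C a) = h * a :=
  evalPartial_monomial h 0 a

theorem evalPartial_mul_C (f : (SDiffPoly p)[X]) (a : SDiffPoly p) :
    evalPartial h (f * C a) = evalPartial h f * a := by
  induction f using Polynomial.induction_on' with
  | add f g hf hg => rw [add_mul, map_add, hf, hg, map_add, add_mul]
  | monomial k b => rw [monomial_mul_C, evalPartial_monomial, evalPartial_monomial, mul_assoc]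

theorem mul_tw_eq {i : ZMod 2} {x : SDiffPoly p} (hx : x ∈ parityPart p i) (a : SDiffPoly p) :
    x * tw p i a = a * x := by
  refine induction p (C := fun a => x * tw p i a = a * x) ?_ ?_ ?_ ?_ a
  · intro r; rw [AlgHom.commutes]; exact (Algebra.commutes r _).symm
  · intro b k; rw [tw_gen, gen_supercomm p b k hx, mul_smul_comm, mul_comm (p b)]
  · intro s t hs ht; rw [map_mul, ← mul_assoc, hs, mul_assoc, ht, mul_assoc]
  · intro s t hs ht; rw [map_add, mul_add, hs, ht, add_mul]

/-- If `h` has the parity of the bracket, moving the coefficient past it undoes the twist. The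
twisted derivation of parity `i` thus becomes an ordinary one. -/
theorem evalPartial_C_tw_mul {h : SDiffPoly p} {i : ZMod 2} (hh : h ∈ parityPart p i)
    (f : (SDiffPoly p)[X]) (a : SDiffPoly p) :
    evalPartial h (C (tw p i a) * f) = a * evalPartial h f := by
  induction f using Polynomial.induction_on' with
  | add f g hf hg => rw [mul_add, map_add, hf, hg, map_add, mul_add]
  | monomial k b =>
    rw [C_mul_monomial, evalPartial_monomial, evalPartial_monomial, ← mul_assoc, ← mul_assoc,
      mul_tw_eq (D_pow_mem p hh k)]

theorem evalPartial_lamD (f : (SDiffPoly p)[X]) :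
    evalPartial h (lamD p f) = D p (evalPartial h f) := by
  induction f using Polynomial.induction_on' with
  | add f g hf hg => simp only [map_add, hf, hg]
  | monomial k b =>
    have h1 : DPoly p (monomial k b) = monomial k (D p b) := by
      ext j
      rw [coeff_DPoly, coeff_monomial, coeff_monomial]
      split_ifs
      · rfl
      · exact map_zero _
    rw [lamD_apply, h1, X_mul_monomial, map_add, evalPartial_monomial, evalPartial_monomial,
      evalPartial_monomial, D_mul, pow_succ', Module.End.mul_apply, add_comm]

end EvalPartial

/-! ### Division by the symbols `Y_u` -/

/-- Division with remainder: Y_t has order t and leading coefficient (-1)^t, so a multiple of it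
removes the terms of degree t. Below degree 0 nothing is left, because the constant Y_0 is among the
divisors. -/
theorem exists_eq_sum_C_mul_symb (t : ℕ) (ht : t ≤ N) {π : ZMod 2}
    (g : Fin m ⊕ Fin n → (VP N m n)[X])
    (hg : ∀ j, PolyParity (pPar N m n) (π + inPar m n j) (g j))
    (hg' : ∀ j k, t ≤ k → (g j).coeff k = 0) :
    ∃ H : Idx N m n → VP N m n, (∀ x, H x ∈ parityPart (pPar N m n) (π + par N m n x)) ∧
      (∀ x : Idx N m n, t ≤ x.1.val → H x = 0) ∧
      ∀ j, g j = ∑ x : Idx N m n, C (H x) * symb N m n x.1 x.2 j := by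
  induction t generalizing g with
  | zero =>
    refine ⟨0, fun _ => zero_mem _, fun _ _ => rfl, fun j => ?_⟩
    simp only [Pi.zero_apply, C_0, zero_mul, Finset.sum_const_zero]
    ext k
    rw [hg' j k (Nat.zero_le k), coeff_zero]
  | succ t ih =>
    let K : Idx N m n → VP N m n := fun x =>
      if x.1.val = t then (-1 : ℂ) ^ t • (g x.2).coeff t else 0
    have hK : ∀ x, K x ∈ parityPart (pPar N m n) (π + par N m n x) := by
      intro x
      simp only [K]
      split_ifs
      · exact Submodule.smul_mem _ _ (hg x.2 t)
      · exact zero_mem _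
    have hsum : ∀ j k, t ≤ k → (∑ x : Idx N m n, C (K x) * symb N m n x.1 x.2 j).coeff k =
        if k = t then (g j).coeff t else 0 := by
      intro j k hk
      rw [finsetSum_coeff, Finset.sum_eq_single (⟨t, ht⟩, j)]
      · rw [coeff_C_mul]
        simp only [K, if_true]
        split_ifs with h
        · subst h
          rw [coeff_symb_self, if_pos rfl, mul_neg_one_pow, smul_smul, ← mul_pow, neg_one_mul,
            neg_neg, one_pow, one_smul]
        · rw [coeff_symb_of_lt (by omega), mul_zero]
      · intro x _ hx
        rw [coeff_C_mul]
        by_cases h : x.1.val = t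
        · by_cases h1 : k = t
          · rw [h, h1, coeff_symb_self, if_neg, mul_zero]
            intro h2
            exact hx (Prod.ext (Fin.ext h) h2)
          · rw [coeff_symb_of_lt (by omega), mul_zero]
        · simp only [K, if_neg h, zero_mul]
      · simp
    obtain ⟨H, hH, hH0, hHs⟩ := ih (by omega)
      (fun j => g j - ∑ x : Idx N m n, C (K x) * symb N m n x.1 x.2 j)
      (fun j k => by
        rw [coeff_sub]
        refine sub_mem (hg j k) (PolyParity.sum (fun x _ => ?_) k)
        have h1 := PolyParity.C_mul (hK x) (symb_parity (N := N) x.1 x.2 j)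
        have e : ∀ a b c : ZMod 2, a + b + (b + c) = a + c := by decide
        rwa [par, e] at h1)
      (fun j k hk => by
        rw [coeff_sub, hsum j k hk]
        split_ifs with h
        · rw [h, sub_self]
        · rw [hg' j k (by omega), sub_zero])
    refine ⟨H + K, fun x => add_mem (hH x) (hK x), fun x hx => ?_, fun j => ?_⟩
    · rw [Pi.add_apply, hH0 x (by omega), zero_add]
      exact if_neg (by omega)
    · simp only [Pi.add_apply, C_add, add_mul, Finset.sum_add_distrib]
      rw [← hHs j, sub_add_cancel]

theorem exists_lower_eq_sum (z : Idx N m n) :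
    ∃ H : Idx N m n → VP N m n,
      (∀ x, H x ∈ parityPart (pPar N m n) (par N m n x + par N m n z)) ∧
      (∀ x : Idx N m n, z.1.val ≤ x.1.val → H x = 0) ∧
      ∀ j k, k < z.1.val → (symb N m n z.1 z.2 j).coeff k =
        ∑ x : Idx N m n, H x * (symb N m n x.1 x.2 j).coeff k := by
  obtain ⟨H, hH, hH0, hHs⟩ := exists_eq_sum_C_mul_symb z.1.val z.1.isLt.le (π := par N m n z)
    (fun j => (symb N m n z.1 z.2 j).erase z.1)
    (fun j k => by
      rw [coeff_erase]
      split_ifs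
      · exact zero_mem _
      · exact symb_parity _ _ _ k)
    (fun j k hk => by
      rw [coeff_erase]
      split_ifs with h
      · rfl
      · exact coeff_symb_of_lt (by omega) _ _)
  refine ⟨H, fun x => by rw [add_comm]; exact hH x, hH0, fun j k hk => ?_⟩
  have h := congrArg (fun f => f.coeff k) (hHs j)
  simp only [coeff_erase, if_neg hk.ne, finsetSum_coeff, coeff_C_mul] at h
  exact h

end Coordinates

/-! ### Free generation -/

section FreeGeneration

variable {N m n : ℕ}

/-- The indices of the coordinates that do not belong to the last block of rows. -/
def IsUpper (b : PIdx N m n) : Prop := b.1.1.1.val + 1 < N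

instance : DecidablePred (IsUpper (N := N) (m := m) (n := n)) := fun _ =>
  inferInstanceAs (Decidable (_ < _))

/-- The Euler derivation of the coordinates from Y_1, ..., Y_{N-1} is a combination `δ` of brackets
with 𝔫, in which λ is replaced by ∂ acting on the weights; `δ` vanishes on invariants. -/
theorem euler_eq_zero_of_mem_WAlg {v : VP N m n} (hv : coordHom N m n v ∈ WAlg N m n (-1)) :
    euler (pPar N m n) IsUpper v = 0 := by
  choose H hH hH0 hHs using exists_lower_eq_sum (N := N) (m := m) (n := n)
  -- The sign from `rhoBracket_coeff_symb`; it is put into the weights so that it cancels against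
  -- itself.
  let s : Idx N m n → Idx N m n → ℂ := fun x y =>
    eps ((par N m n x + par N m n y) * par N m n y) * gaugeSign x y
  have hs : ∀ x y, s x y * s x y = 1 := by
    intro x y
    simp only [s, gaugeSign]
    rw [← eps_add, eps_mul_self]
  let δ : VP N m n →ₗ[ℂ] VP N m n := ∑ y : Idx N m n, ∑ x : Idx N m n,
    if x.1.val < y.1.val then evalPartial (s x y • H y x) ∘ₗ rhoBracket x y else 0
  have hδ : ∀ v, δ v = ∑ y : Idx N m n, ∑ x : Idx N m n,
      if x.1.val < y.1.val then evalPartial (s x y • H y x) (rhoBracket x y v) else 0 := by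
    intro v
    simp only [δ, LinearMap.sum_apply]
    refine Finset.sum_congr rfl fun y _ => Finset.sum_congr rfl fun x _ => ?_
    split_ifs <;> rfl
  have hδ_mul : ∀ a b, δ (a * b) = a * δ b + δ a * b := by
    intro a b
    simp only [hδ, Finset.mul_sum, Finset.sum_mul, ← Finset.sum_add_distrib]
    refine Finset.sum_congr rfl fun y _ => Finset.sum_congr rfl fun x _ => ?_
    split_ifs
    · rw [rhoBracket_mul, map_add, evalPartial_mul_C,
        evalPartial_C_tw_mul (Submodule.smul_mem _ _ (hH y x))]
    · rw [mul_zero, zero_mul, add_zero]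
  have hδ_D : ∀ a, δ (D (pPar N m n) a) = D (pPar N m n) (δ a) := by
    intro a
    simp only [hδ, map_sum]
    refine Finset.sum_congr rfl fun y _ => Finset.sum_congr rfl fun x _ => ?_
    split_ifs
    · rw [rhoBracket_D, evalPartial_lamD]
    · rw [map_zero]
  have hδ_coord : ∀ b, δ (coord N m n b) = if IsUpper b then coord N m n b else 0 := by
    intro b
    have hle := b.le
    rw [coord, map_smul, hδ]
    split_ifs with hb
    · congr 1
      -- Coordinates of row u belong to Y_{u+1}. Only the brackets with y = z act on them, and with
      -- weights H they reassemble the division of the lower part of Y_{u+1}.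
      let z : Idx N m n := (⟨b.1.1.1.val + 1, hb⟩, b.1.1.2)
      have hz := hHs z b.1.2.2 b.1.2.1.val (Nat.lt_succ_of_le hle)
      refine Eq.trans ?_ hz.symm
      rw [Finset.sum_eq_single z]
      · refine Finset.sum_congr rfl fun x _ => ?_
        split_ifs with hx
        · have h1 := rhoBracket_coeff_symb hx z b.1.2.2 b.1.2.1.val
          rw [if_pos rfl] at h1
          refine (congrArg _ h1).trans ?_
          rw [map_smul, evalPartial_C, smul_mul_assoc, smul_smul]
          exact (congrArg (· • _) (hs x z)).trans (one_smul _ _)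
        · rw [hH0 z x (not_lt.mp hx), zero_mul]
      · intro y _ hy
        refine Finset.sum_eq_zero fun x _ => ?_
        split_ifs with hx
        · have h1 := rhoBracket_coeff_symb hx z b.1.2.2 b.1.2.1.val
          rw [if_neg hy.symm, smul_zero] at h1
          exact (congrArg _ h1).trans (map_zero _)
        · rfl
      · simp
    · have hN : b.1.1.1.val + 1 = N := by
        have := b.1.1.1.isLt
        simp only [IsUpper] at hb
        omega
      rw [hN]
      rw [Finset.sum_eq_zero, smul_zero]
      intro y _
      refine Finset.sum_eq_zero fun x _ => ?_
      split_ifs with hx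
      · rw [rhoBracket_coeff_symb_last hx, map_zero]
      · rfl
  have hδ_Dk : ∀ k a, δ ((D (pPar N m n) ^ k) a) = (D (pPar N m n) ^ k) (δ a) := by
    intro k a
    induction k with
    | zero => rfl
    | succ k ih => rw [pow_succ', Module.End.mul_apply, Module.End.mul_apply, hδ_D, ih]
  have key : (coordHom N m n).toLinearMap ∘ₗ euler (pPar N m n) IsUpper =
      δ ∘ₗ (coordHom N m n).toLinearMap := by
    apply der_ext (coordHom N m n) (coordHom N m n)
    · intro a b
      simp only [LinearMap.comp_apply, AlgHom.toLinearMap_apply, euler_mul, map_add, map_mul]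
    · intro a b
      simp only [LinearMap.comp_apply, AlgHom.toLinearMap_apply, hδ_mul, map_mul]
    · intro b k
      simp only [LinearMap.comp_apply, AlgHom.toLinearMap_apply, euler_gen]
      rw [coordHom, diffHom_gen, hδ_Dk, hδ_coord]
      split_ifs
      · rw [diffHom_gen]
      · rw [map_zero, map_zero]
  apply coordHom_bijective.1
  rw [map_zero]
  refine (LinearMap.congr_fun key v).trans ?_
  rw [LinearMap.comp_apply, AlgHom.toLinearMap_apply, hδ]
  refine Finset.sum_eq_zero fun y _ => Finset.sum_eq_zero fun x _ => ?_
  split_ifs with hx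
  · rw [(mem_WAlg_iff _).mp hv x y hx, map_zero]
  · rfl

/-- The kernel of a twisted derivation that intertwines ∂ with λ + ∂ is a differential subalgebra.
-/
theorem map_mem_WAlg {G : Type} {pG : G → ZMod 2} (w : G → VP N m n)
    (hw : ∀ g, w g ∈ parityPart (pPar N m n) (pG g)) (hW : ∀ g, w g ∈ WAlg N m n (-1))
    (a : SDiffPoly pG) : diffHom pG (pPar N m n) w hw a ∈ WAlg N m n (-1) := by
  rw [mem_WAlg_iff]
  intro x y hxy
  refine induction pG (C := fun a => rhoBracket x y (diffHom pG (pPar N m n) w hw a) = 0)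
    ?_ ?_ ?_ ?_ a
  · intro r
    rw [AlgHom.commutes]
    exact rhoBracket_algebraMap x y r
  · intro g k
    rw [diffHom_gen]
    induction k with
    | zero => exact (mem_WAlg_iff _).mp (hW g) x y hxy
    | succ k ih => rw [pow_succ', Module.End.mul_apply, rhoBracket_D, ih, map_zero]
  · intro a b ha hb
    rw [map_mul, rhoBracket_mul, ha, hb, mul_zero, zero_mul, add_zero]
  · intro a b ha hb
    rw [map_add, map_add, ha, hb, add_zero]

theorem freelyGenerates_quasiDet (hN : 2 ≤ N) :
    FreelyGenerates
      (fun g : ((Fin m ⊕ Fin n) × (Fin m ⊕ Fin n)) × Fin N =>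
        inPar m n g.1.1 + inPar m n g.1.2)
      (fun g => (((-1 : ℂ) ^ (N - 1) • quasiDet N m n) g.1.1 g.1.2).coeff (g.2.val : ℤ))
      (WAlg N m n (-1)) := by
  let pG : ((Fin m ⊕ Fin n) × (Fin m ⊕ Fin n)) × Fin N → ZMod 2 := fun g =>
    inPar m n g.1.1 + inPar m n g.1.2
  let emb : ((Fin m ⊕ Fin n) × (Fin m ⊕ Fin n)) × Fin N → PIdx N m n := fun g =>
    pIdx (lastBlock m n hN g.1.1) (g.2, g.1.2) (by
      have := g.2.isLt
      simp only [deg, lastBlock]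
      omega)
  have hw : ∀ g : ((Fin m ⊕ Fin n) × (Fin m ⊕ Fin n)) × Fin N,
      (((-1 : ℂ) ^ (N - 1) • quasiDet N m n) g.1.1 g.1.2).coeff (g.2.val : ℤ) =
        coord N m n (emb g) := by
    intro g
    -- (-1)^{N-1} times -Y_N is (-1)^N Y_N, the normalization used in `coord`.
    obtain ⟨M, rfl⟩ : ∃ M, N = M + 1 := ⟨N - 1, by omega⟩
    rw [Matrix.smul_apply, PsiDO.coeff_smul, quasiDet, PsiDO.coeff_neg,
      PsiDO.coeff_ofSymbol_natCast, smul_neg, ← neg_smul, ← mul_neg_one, ← pow_succ]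
    rfl
  have hpar : ∀ g, coord N m n (emb g) ∈ parityPart (pPar N m n) (pG g) := fun g =>
    coord_mem (emb g)
  let Φ := diffHom pG (pPar N m n) (fun g => coord N m n (emb g)) hpar
  -- `ι` includes the coordinates of the last block row, and `κ` projects onto them by killing the
  -- others. Then `Φ` is `coordHom` after `ι`: injectivity follows from κ ∘ ι = id, and surjectivity
  -- onto the invariants from ι ∘ κ = `killHom`.
  let ι := diffHom pG (pPar N m n) (fun g => gen (pPar N m n) (emb g) 0)
    (fun g => gen_mem (pPar N m n) (emb g) 0)
  let κ := diffHom (pPar N m n) pG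
    (fun b => if IsUpper b then 0 else gen pG ((b.1.1.2, b.1.2.2), b.1.2.1) 0)
    (fun b => by
      split_ifs
      · exact zero_mem _
      · exact gen_mem pG ((b.1.1.2, b.1.2.2), b.1.2.1) 0)
  have hι : ∀ g k, ι (gen pG g k) = gen (pPar N m n) (emb g) k := fun g k =>
    (diffHom_gen _ _ g k).trans (D_pow_gen _ _)
  have hκ : ∀ b k, κ (gen (pPar N m n) b k) =
      if IsUpper b then 0 else gen pG ((b.1.1.2, b.1.2.2), b.1.2.1) k := by
    intro b k
    refine (diffHom_gen _ _ b k).trans ?_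
    split_ifs
    · exact map_zero _
    · exact D_pow_gen _ _
  have hΦ : ∀ a, Φ a = coordHom N m n (ι a) := by
    have : Φ = (coordHom N m n).comp ι := by
      apply SDiffPoly.algHom_ext
      intro g k
      refine (diffHom_gen _ _ g k).trans ?_
      rw [AlgHom.comp_apply, hι, coordHom, diffHom_gen]
    intro a
    rw [this]; rfl
  have hupper : ∀ g, ¬ IsUpper (emb g) := by
    intro g
    simp only [IsUpper, emb, pIdx, lastBlock]
    omega
  have hκι : ∀ a, κ (ι a) = a := by
    have : κ.comp ι = AlgHom.id ℂ _ := by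
      apply SDiffPoly.algHom_ext
      intro g k
      rw [AlgHom.comp_apply, AlgHom.id_apply, hι, hκ, if_neg (hupper g)]
      rfl
    exact fun a => DFunLike.congr_fun this a
  have hικ : ∀ a, ι (κ a) = killHom (pPar N m n) IsUpper a := by
    have : ι.comp κ = killHom (pPar N m n) IsUpper := by
      apply SDiffPoly.algHom_ext
      intro b k
      rw [AlgHom.comp_apply, killHom_gen, hκ]
      split_ifs with hb
      · rw [map_zero]
      · rw [hι]
        congr 1
        apply Subtype.ext
        refine Prod.ext (Prod.ext (Fin.ext ?_) rfl) rfl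
        have := b.1.1.1.isLt
        simp only [IsUpper] at hb
        simp only [emb, pIdx, lastBlock]
        omega
    exact fun a => DFunLike.congr_fun this a
  simp only [hw]
  refine ⟨hpar, Φ, diffHom_D _ _, diffHom_gen_zero _ _, ?_, ?_⟩
  · intro a b hab
    rw [hΦ, hΦ] at hab
    rw [← hκι a, ← hκι b, coordHom_bijective.1 hab]
  · apply le_antisymm
    · rintro _ ⟨a, rfl⟩
      refine map_mem_WAlg _ hpar (fun g => ?_) a
      rw [mem_WAlg_iff]
      intro x y hxy
      rw [coord, map_smul]
      have hN' : (emb g).1.1.1.val + 1 = N := by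
        simp only [emb, pIdx, lastBlock]
        omega
      rw [hN', rhoBracket_coeff_symb_last hxy, smul_zero]
    · intro v hv
      obtain ⟨a, rfl⟩ := coordHom_bijective.2 v
      have h1 := killHom_eq_of_euler_eq_zero _ _ (euler_eq_zero_of_mem_WAlg hv)
      refine ⟨κ a, ?_⟩
      rw [AlgHom.toLinearMap_apply, hΦ, hικ, h1]

end FreeGeneration

end RectW

theorem theorem4p7 (N m n : ℕ) (hN : 2 ≤ N) :
    (∃! Q : Matrix (Fin m ⊕ Fin n) (Fin m ⊕ Fin n) (RectW.PsiDO (RectW.pPar N m n)),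
      RectW.IsQuasiDet (RectW.par N m n) (RectW.rhoA N m n)
        (RectW.lastBlock m n hN) (RectW.firstBlock m n hN) Q) ∧
    ∀ Q L : Matrix (Fin m ⊕ Fin n) (Fin m ⊕ Fin n) (RectW.PsiDO (RectW.pPar N m n)),
      RectW.IsQuasiDet (RectW.par N m n) (RectW.rhoA N m n)
        (RectW.lastBlock m n hN) (RectW.firstBlock m n hN) Q →
      L = (-1 : ℂ) ^ (N - 1) • Q →
      RectW.IsMonicDiffOp N L ∧
      RectW.FreelyGenerates
        (fun g : ((Fin m ⊕ Fin n) × (Fin m ⊕ Fin n)) × Fin N =>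
          RectW.inPar m n g.1.1 + RectW.inPar m n g.1.2)
        (fun g => (L g.1.1 g.1.2).coeff (g.2.val : ℤ))
        (RectW.WAlg N m n (-1)) := by
  refine ⟨⟨RectW.quasiDet N m n, RectW.isQuasiDet_quasiDet hN, fun Q hQ =>
    RectW.eq_quasiDet_of_isQuasiDet hN hQ⟩, ?_⟩
  rintro Q L hQ rfl
  rw [RectW.eq_quasiDet_of_isQuasiDet hN hQ]
  exact ⟨RectW.isMonicDiffOp_quasiDet hN, RectW.freelyGenerates_quasiDet hN⟩
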